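/- **Theorem.** $\mathsf{PLS}^{\mathsf{PLS}} = \mathsf{PLS}$. Here a search problem is a relation $R\subseteq\{0,1\}^*\times\{0,1\}^*$ ($y$ is a solution of $x$ if $(x,y)\in R$). It is in $\mathsf{TFNP}$ if it is total, its solutions have length polynomial in $|x|$, and $(x,y)\in R$ is decidable in time $\mathrm{poly}(|x|,|y|)$. A many-to-one reduction from $R$ to $Q$ is a pair of polynomial-time functions $f,g$ with $(f(x),y)\in Q\Rightarrow(x,g(y))\in R$. *Sink-of-DAG*: given Boolean circuits $S,V:\{0,1\}^n\to\{0,1\}^n$ (presented as one circuit $x\mapsto S(x)\Vert V(x)$), find $v\in\{0,1\}^n$ such that $S(v)\ne v$ and either $S(S(v))=S(v)$ or $V(S(v))\le V(v)$ (values compared as binary numbers); if $S(0^n)=0^n$, then $v=0^n$ is also a solution. A string that encodes no such pair has the empty string as its only solution. $\mathsf{PLS}$ is the class of all $\mathsf{TFNP}$ problems that are many-to-one reducible to Sink-of-DAG. *Relativization*: let $B$ be Sink-of-DAG. An instance of $\text{Sink-of-DAG}^{B}$ is a circuit $C:\{0,1\}^n\to\{0,1\}^{2n}$, $C(x)=S(x)\Vert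 V(x)$, which may contain $t$ oracle gates for $B$; an oracle gate with $k$ input bits has $k$ output bits (solutions of $B$ are never longer than their instances). Given strings $w_1,\dots,w_t$ of the lengths of the gate outputs, $C$ is evaluated on $x$ by taking $w_j$ as the output of the $j$-th oracle gate in evaluation order. A solution of the instance is a string $v\Vert w_{1,1}\Vert\cdots\Vert w_{1,t}\Vert w_{2,1}\Vert\cdots\Vert w_{2,t}$ with $|v|=n$ that is accepted by the following verifier. It evaluates $C(v)$ with $w_{1,1},\dots,w_{1,t}$ and reads off $S(v),V(v)$. If $S(v)=v$, it requires $v=0^n$. If $S(v)\neq v$, it evaluates $C(S(v))$ with $w_{2,1},\dots,w_{2,t}$ and requires $S(S(v))=S(v)$ or $V(S(v))\le V(v)$. Moreover, for each oracle query $u$ made in the evaluations performed, the answer $w_{i,j}$ used must have a suffix that is a solution of $B$ on $u$, and any two equal queries must have received equal answers (internal consistency). A string that encodes no instance has the empty string as its only solution. $\mathsf{PLS}^{\mathsf{PLS}}$ is the class of all $\mathsf{TFNP}$ problems $R$ that are many-to-one reducible to $\text{Sink-of-DAG}^{\text{Sink-of-DAG}}$ under $\mathsf{FP}^{\mathsf{PLS}}$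 reductions. That is, there are functions $f^b,g^b$, each computed by one polynomial-time oracle program, with a time bound valid for all oracles considered, such that for every function $b$ that maps each string $u$ to some solution of Sink-of-DAG on $u$, and all $x,y$: if $y$ is a solution of $\text{Sink-of-DAG}^{\text{Sink-of-DAG}}$ on $f^b(x)$, then $(x,g^b(y))\in R$. -/

import Mathlib

namespace TotalSearch

/-! ## Search problems -/

/-- A search problem is a binary relation on bit strings; `R x y` means that `y` is a solution
of `x`. -/
abbrev SearchProblem := List Bool → List Bool → Prop

/-! ## Machine model: structured programs over finitely many stacks of bits, with a step count

Each elementary step pushes, pops or inspects a single bit on top of one stack, as a multitape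
Turing machine does. A query step hands the content of a stack to an oracle and is charged for the
length of the question and of the answer. -/

/-- Programs. The natural numbers `r`, `s` name stacks. -/
inductive Prog : Type
  | skip : Prog
  | push (r : ℕ) (c : Bool) : Prog
  | pop (r : ℕ) : Prog
  | query (r s : ℕ) : Prog
  | seq (P Q : Prog) : Prog
  | branch (r : ℕ) (Pempty Pfalse Ptrue : Prog) : Prog
  | loop (r : ℕ) (P : Prog) : Prog

/-- The program contains no oracle query. -/
def Prog.QueryFree : Prog → Prop
  | .skip => True
  | .push _ _ => True
  | .pop _ => True
  | .query _ _ => False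
  | .seq P Q => P.QueryFree ∧ Q.QueryFree
  | .branch _ P Q S => P.QueryFree ∧ Q.QueryFree ∧ S.QueryFree
  | .loop _ P => P.QueryFree

/-- The contents of all stacks; the head of a list is the top of the stack. -/
abbrev Store := ℕ → List Bool

/-- `Runs b P σ σ' t`: with the function `b` as oracle, the program `P` started in `σ` halts in
`σ'` after exactly `t` steps. -/
inductive Runs (b : List Bool → List Bool) : Prog → Store → Store → ℕ → Prop
  | skip (σ : Store) : Runs b .skip σ σ 1
  | push (σ : Store) (r : ℕ) (c : Bool) :
      Runs b (.push r c) σ (Function.update σ r (c :: σ r)) 1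
  | pop (σ : Store) (r : ℕ) : Runs b (.pop r) σ (Function.update σ r (σ r).tail) 1
  | query (σ : Store) (r s : ℕ) :
      Runs b (.query r s) σ (Function.update σ s (b (σ r)))
        (1 + (σ r).length + (b (σ r)).length)
  | seq {P Q : Prog} {σ τ υ : Store} {t t' : ℕ} :
      Runs b P σ τ t → Runs b Q τ υ t' → Runs b (.seq P Q) σ υ (t + t')
  | branchEmpty {r : ℕ} {P Q S : Prog} {σ τ : Store} {t : ℕ} :
      σ r = [] → Runs b P σ τ t → Runs b (.branch r P Q S) σ τ (1 + t)
  | branchFalse {r : ℕ} {P Q S : Prog} {σ τ : Store} {t : ℕ} :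
      (σ r).head? = some false → Runs b Q σ τ t → Runs b (.branch r P Q S) σ τ (1 + t)
  | branchTrue {r : ℕ} {P Q S : Prog} {σ τ : Store} {t : ℕ} :
      (σ r).head? = some true → Runs b S σ τ t → Runs b (.branch r P Q S) σ τ (1 + t)
  | loopStop {r : ℕ} {P : Prog} {σ : Store} : σ r = [] → Runs b (.loop r P) σ σ 1
  | loopStep {r : ℕ} {P : Prog} {σ τ υ : Store} {t t' : ℕ} :
      σ r ≠ [] → Runs b P σ τ t → Runs b (.loop r P) τ υ t' →
      Runs b (.loop r P) σ υ (1 + t + t')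

/-- `P` with oracle `b`, started with `inputs` on stacks `0, 1, …` and all other stacks empty,
halts within `T` steps with `out` on stack `0`. -/
def Prog.Computes (P : Prog) (b : List Bool → List Bool) (inputs : List (List Bool))
    (out : List Bool) (T : ℕ) : Prop :=
  ∃ (σ : Store) (t : ℕ), Runs b P (fun i => inputs.getD i []) σ t ∧ t ≤ T ∧ σ 0 = out

/-- The oracle used to run query-free programs; it is never consulted. -/
def noOracle : List Bool → List Bool := fun _ => []

/-- Polynomial-time computable functions on bit strings. -/
def FP (f : List Bool → List Bool) : Prop :=
  ∃ (P : Prog) (p : Polynomial ℕ), P.QueryFree ∧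
    ∀ x, P.Computes noOracle [x] (f x) (p.eval x.length)

/-- Polynomial-time decidable binary relations on bit strings. -/
def PolyTimeDecidable (R : SearchProblem) : Prop :=
  ∃ (P : Prog) (p : Polynomial ℕ), P.QueryFree ∧
    ∀ x y, ∃ out, P.Computes noOracle [x, y] out (p.eval (x.length + y.length)) ∧
      (out = [true] ↔ R x y)

/-- `b` is an instantiation of an oracle for `B`: a function consistent with the relation. -/
def Instantiates (b : List Bool → List Bool) (B : SearchProblem) : Prop := ∀ u, B u (b u)

/-- `f b x` is computed in polynomial time with oracle `b`, by one program and with one time bound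
for all instantiations `b` of the oracle problem `B`. -/
def FPOracle (B : SearchProblem) (f : (List Bool → List Bool) → List Bool → List Bool) : Prop :=
  ∃ (P : Prog) (p : Polynomial ℕ), ∀ b, Instantiates b B →
    ∀ x, P.Computes b [x] (f b x) (p.eval x.length)

/-! ## TFNP and reductions -/

/-- Total NP search problems. -/
def IsTFNP (R : SearchProblem) : Prop :=
  (∃ p : Polynomial ℕ, ∀ x y, R x y → y.length ≤ p.eval x.length) ∧
  (∀ x, ∃ y, R x y) ∧
  PolyTimeDecidable R

/-- Many-to-one reductions. -/
def ManyOneReducible (R Q : SearchProblem) : Prop :=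
  ∃ f g : List Bool → List Bool, FP f ∧ FP g ∧ ∀ x y, Q (f x) y → R x (g y)

/-- Many-to-one reductions whose two functions may use an oracle for the search problem `B`; they
have to be correct for every instantiation of that oracle. -/
def ManyOneReducibleWithOracle (B R Q : SearchProblem) : Prop :=
  ∃ f g : (List Bool → List Bool) → List Bool → List Bool,
    FPOracle B f ∧ FPOracle B g ∧
      ∀ b, Instantiates b B → ∀ x y, Q (f b x) y → R x (g b y)

/-! ## Boolean circuits with oracle gates -/

/-- Gates. Numbers refer to wires, in the order in which the wires come into being: first the
inputs of the circuit, then the output wires of the gates, in the order of the gates. -/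
inductive Gate : Type
  | const (c : Bool) : Gate
  | nand (i j : ℕ) : Gate
  | oracle (ins : List ℕ) : Gate

/-- A circuit: number of inputs, gates in the order of evaluation, wires that carry the output. -/
structure Circuit : Type where
  inputs : ℕ
  gates : List Gate
  outputs : List ℕ

/-- The value on wire `i`; a number that names no existing wire stands for the constant `0`. -/
def wire (vals : List Bool) (i : ℕ) : Bool := vals.getD i false

/-- Simulation of the gates, with the successive blocks of `w` used as the outputs of the oracle
gates; an oracle gate with `k` input wires has `p k` output wires. Returned are the values of all
wires and the list of all pairs (oracle query, answer used). -/
def runGates (p : ℕ → ℕ) : List Gate → List Bool → List Bool →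
    List Bool × List (List Bool × List Bool)
  | [], vals, _ => (vals, [])
  | .const c :: gs, vals, w => runGates p gs (vals ++ [c]) w
  | .nand i j :: gs, vals, w => runGates p gs (vals ++ [!(wire vals i && wire vals j)]) w
  | .oracle ins :: gs, vals, w =>
      let rest := runGates p gs (vals ++ w.take (p ins.length)) (w.drop (p ins.length))
      (rest.1, (ins.map (wire vals), w.take (p ins.length)) :: rest.2)

/-- Evaluation of a circuit on `x` with auxiliary oracle answers `w`: the output and the list of
all pairs (oracle query, answer used). -/
def Circuit.run (C : Circuit) (p : ℕ → ℕ) (x w : List Bool) :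
    List Bool × List (List Bool × List Bool) :=
  let r := runGates p C.gates x w
  (C.outputs.map (wire r.1), r.2)

/-- The number of output bits of the oracle gate, `0` for the other gates. -/
def Gate.answerBits (p : ℕ → ℕ) : Gate → ℕ
  | .const _ => 0
  | .nand _ _ => 0
  | .oracle ins => p ins.length

/-- The total number of output bits of all oracle gates of a circuit. -/
def Circuit.answerBits (C : Circuit) (p : ℕ → ℕ) : ℕ :=
  (C.gates.map (Gate.answerBits p)).sum

/-- The gate is not an oracle gate. -/
def Gate.Plain : Gate → Prop
  | .const _ => True
  | .nand _ _ => True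
  | .oracle _ => False

/-- Ordinary Boolean circuits: no oracle gates. -/
def Circuit.Plain (C : Circuit) : Prop := ∀ g ∈ C.gates, g.Plain

/-- The function computed by an ordinary circuit. -/
def Circuit.eval (C : Circuit) (x : List Bool) : List Bool := (C.run (fun _ => 0) x []).1

/-! ### Circuits as bit strings -/

/-- Self-delimiting code of a natural number. -/
def natCode (n : ℕ) : List Bool := List.replicate n true ++ [false]

/-- Self-delimiting code of a list. -/
def listCode {α : Type} (code : α → List Bool) (l : List α) : List Bool :=
  natCode l.length ++ l.flatMap code

/-- Self-delimiting code of a gate. -/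
def Gate.encode : Gate → List Bool
  | .const false => natCode 0
  | .const true => natCode 1
  | .nand i j => natCode 2 ++ natCode i ++ natCode j
  | .oracle ins => natCode 3 ++ listCode natCode ins

/-- The bit string that describes a circuit. -/
def Circuit.encode (C : Circuit) : List Bool :=
  natCode C.inputs ++ listCode Gate.encode C.gates ++ listCode natCode C.outputs

/-- A problem about circuits as a search problem on bit strings: a string that does not describe
an instance has the empty string as its only solution. -/
def ofCircuits (inst : Circuit → Prop) (sol : Circuit → List Bool → Prop) : SearchProblem :=
  fun x y => (∃ C : Circuit, inst C ∧ x = C.encode ∧ sol C y) ∨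
    ((¬ ∃ C : Circuit, inst C ∧ x = C.encode) ∧ y = [])

/-! ## Circuit problems with a black-box verifier, and their relativization -/

/-- A verifier that accesses a circuit only by asking for its value at points: it accepts or
rejects, or asks for the value at `x` and goes on in dependence on the value. -/
inductive BlackBox : Type
  | ret (accept : Bool) : BlackBox
  | ask (x : List Bool) (next : List Bool → BlackBox) : BlackBox

/-- The verdict when the questions are answered by the function `c`. -/
def BlackBox.verdict (c : List Bool → List Bool) : BlackBox → Bool
  | .ret a => a
  | .ask x next => (next (c x)).verdict c

/-- The verdict when the `i`-th question is answered by evaluating the oracle circuit `C` with the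
`i`-th member of `rows` as oracle answers, and the list of all pairs (oracle query, answer used).
-/
def BlackBox.simulate (C : Circuit) (p : ℕ → ℕ) :
    BlackBox → List (List Bool) → Bool × List (List Bool × List Bool)
  | .ret a, _ => (a, [])
  | .ask _ _, [] => (false, [])
  | .ask x next, w :: rows =>
      let r := C.run p x w
      let rest := (next r.1).simulate C p rows
      (rest.1, r.2 ++ rest.2)

/-- A circuit problem with a black-box verifier. The instances are the circuits with some number
`n` of inputs and `outLen n` outputs, the candidate solutions are strings of length `solLen n`,
and the verifier evaluates the circuit at most `queries n` times. -/
structure CircuitProblem : Type where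
  outLen : ℕ → ℕ
  solLen : ℕ → ℕ
  queries : ℕ → ℕ
  verifier : ℕ → List Bool → BlackBox

/-- A list of (oracle query, answer) pairs is internally consistent if equal queries have equal
answers. -/
def InternallyConsistent (tr : List (List Bool × List Bool)) : Prop :=
  ∀ u a a', (u, a) ∈ tr → (u, a') ∈ tr → a = a'

/-- Every answer has a suffix that is a solution of the query. -/
def AnswersValid (B : SearchProblem) (tr : List (List Bool × List Bool)) : Prop :=
  ∀ u a, (u, a) ∈ tr → ∃ s, s <:+ a ∧ B u s

/-- Solutions of the circuit problem `A` on a circuit `C` with oracle gates for `B`. Such a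
solution is the concatenation `y ‖ w₁ ‖ w₂ ‖ …`, where `wᵢ` holds the answers to all oracle gates
in the `i`-th evaluation of `C` by the verifier. -/
def IsRelativizedSolution (A : CircuitProblem) (B : SearchProblem) (p : ℕ → ℕ) (C : Circuit)
    (z : List Bool) : Prop :=
  let L := C.answerBits p
  let y := z.take (A.solLen C.inputs)
  let w := z.drop (A.solLen C.inputs)
  let rows := (List.range (A.queries C.inputs)).map fun i => (w.drop (i * L)).take L
  let r := (A.verifier C.inputs y).simulate C p rows
  z.length = A.solLen C.inputs + A.queries C.inputs * L ∧
    AnswersValid B r.2 ∧ InternallyConsistent r.2 ∧ r.1 = true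

/-- The search problem `A^B`, where `p` is a polynomial that bounds the lengths of the solutions
of `B`; oracle gates with `k` inputs have `p k` outputs. -/
def relativize (A : CircuitProblem) (B : SearchProblem) (p : Polynomial ℕ) : SearchProblem :=
  ofCircuits (fun C => C.outputs.length = A.outLen C.inputs)
    (IsRelativizedSolution A B fun k => p.eval k)

/-- The class of all TFNP problems that reduce to `A^B` by many-to-one reductions with an oracle
for `B`. -/
def relativizedClass (A : CircuitProblem) (B : SearchProblem) (p : Polynomial ℕ) :
    Set SearchProblem :=
  {R | IsTFNP R ∧ ManyOneReducibleWithOracle B R (relativize A B p)}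

/-! ## Sink-of-DAG and PLS -/

/-- The number with the given binary digits, most significant digit first. -/
def bitsToNat (l : List Bool) : ℕ := l.foldl (fun a c => 2 * a + c.toNat) 0

/-- The string `0ⁿ`. -/
def zeros (n : ℕ) : List Bool := List.replicate n false

/-- `v` solves the Sink-of-DAG instance with successor `S` and value function `V` on `n`-bit
strings. If the instance violates the requirement `S(0) ≠ 0`, then `0` is a solution. -/
def IsSinkOfDAGSolution (n : ℕ) (S V : List Bool → List Bool) (v : List Bool) : Prop :=
  (S v ≠ v ∧ (S (S v) = S v ∨ bitsToNat (V (S v)) ≤ bitsToNat (V v))) ∨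
    (v = zeros n ∧ S (zeros n) = zeros n)

/-- Sink-of-DAG. The two circuits `S` and `V` on `n`-bit strings are given as one circuit with
output `S(x) ‖ V(x)`. -/
def SinkOfDAG : SearchProblem :=
  ofCircuits (fun C => C.Plain ∧ C.outputs.length = 2 * C.inputs) fun C v =>
    v.length = C.inputs ∧
      IsSinkOfDAGSolution C.inputs (fun x => (C.eval x).take C.inputs)
        (fun x => (C.eval x).drop C.inputs) v

/-- The black-box verifier of Sink-of-DAG. -/
def sinkOfDAGVerifier (n : ℕ) (v : List Bool) : BlackBox :=
  .ask v fun r =>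
    if r.take n = v then .ret (decide (v = zeros n))
    else .ask (r.take n) fun r' =>
      .ret (decide (r'.take n = r.take n ∨ bitsToNat (r'.drop n) ≤ bitsToNat (r.drop n)))

/-- Sink-of-DAG as a circuit problem with a black-box verifier. -/
def sinkOfDAGProblem : CircuitProblem where
  outLen n := 2 * n
  solLen n := n
  queries _ := 2
  verifier := sinkOfDAGVerifier

/-- A polynomial that bounds the lengths of the solutions of Sink-of-DAG. -/
noncomputable def sinkOfDAGBound : Polynomial ℕ := Polynomial.X

/-- The class PLS. -/
def PLS : Set SearchProblem := {R | IsTFNP R ∧ ManyOneReducible R SinkOfDAG}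

/-- The class PLS with an oracle for PLS. -/
def PLSrelPLS : Set SearchProblem :=
  relativizedClass sinkOfDAGProblem SinkOfDAG sinkOfDAGBound

/-! ## The definitions fit together -/

theorem natCode_append_inj {a b : ℕ} {s t : List Bool}
    (h : natCode a ++ s = natCode b ++ t) : a = b ∧ s = t := by
  induction a generalizing b with
  | zero => cases b <;> simp_all [natCode, List.replicate_succ]
  | succ a ih =>
    cases b with
    | zero => simp [natCode, List.replicate_succ] at h
    | succ b =>
      have := @ih b (by simpa [natCode, List.replicate_succ] using h)
      simpa using this

theorem listCode_append_inj {α : Type} {code : α → List Bool}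
    (hc : ∀ {a b : α} {s t : List Bool}, code a ++ s = code b ++ t → a = b ∧ s = t)
    {l m : List α} {s t : List Bool}
    (h : listCode code l ++ s = listCode code m ++ t) : l = m ∧ s = t := by
  have h1 : natCode l.length ++ (l.flatMap code ++ s) =
      natCode m.length ++ (m.flatMap code ++ t) := by
    simpa [listCode, List.append_assoc] using h
  obtain ⟨hl, h2⟩ := natCode_append_inj h1
  clear h h1
  induction l generalizing m with
  | nil =>
    cases m with
    | nil => simpa using h2
    | cons _ _ => simp at hl
  | cons a l ih =>
    cases m with
    | nil => simp at hl
    | cons b m =>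
      simp only [List.flatMap_cons, List.append_assoc] at h2
      obtain ⟨hab, h3⟩ := hc h2
      obtain ⟨hlm, hst⟩ := ih (by simpa using hl) h3
      exact ⟨by rw [hab, hlm], hst⟩

theorem Gate.encode_append_inj {g g' : Gate} {s t : List Bool}
    (h : g.encode ++ s = g'.encode ++ t) : g = g' ∧ s = t := by
  rcases g with (_ | _) | ⟨i, j⟩ | ins <;> rcases g' with (_ | _) | ⟨i', j'⟩ | ins' <;>
    simp only [Gate.encode, List.append_assoc] at h <;>
    obtain ⟨h0, h1⟩ := natCode_append_inj h <;> try omega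
  · exact ⟨rfl, h1⟩
  · exact ⟨rfl, h1⟩
  · obtain ⟨h2, h3⟩ := natCode_append_inj h1
    obtain ⟨h4, h5⟩ := natCode_append_inj h3
    exact ⟨by rw [h2, h4], h5⟩
  · obtain ⟨h2, h3⟩ := listCode_append_inj natCode_append_inj h1
    exact ⟨by rw [h2], h3⟩

/-- Distinct circuits have distinct descriptions. -/
theorem Circuit.encode_injective : Function.Injective Circuit.encode := by
  rintro ⟨n, gs, os⟩ ⟨n', gs', os'⟩ h
  simp only [Circuit.encode, List.append_assoc] at h
  obtain ⟨h1, h2⟩ := natCode_append_inj h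
  obtain ⟨h3, h4⟩ := listCode_append_inj Gate.encode_append_inj h2
  obtain ⟨h5, _⟩ := listCode_append_inj (s := []) (t := []) natCode_append_inj (by simpa using h4)
  rw [h1, h3, h5]

/-- The bound on the lengths of the solutions of Sink-of-DAG is correct. -/
theorem SinkOfDAG.length_le {x y : List Bool} (h : SinkOfDAG x y) :
    y.length ≤ sinkOfDAGBound.eval x.length := by
  rcases h with ⟨C, -, rfl, hy, -⟩ | ⟨-, rfl⟩
  · simp [sinkOfDAGBound, hy, Circuit.encode, natCode]
  · simp

/-- The black-box verifier, with its questions answered by a function `c`, accepts exactly the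
solutions of the instance that `c` defines. -/
theorem sinkOfDAGVerifier_verdict (n : ℕ) (c : List Bool → List Bool) (v : List Bool) :
    (sinkOfDAGVerifier n v).verdict c = true ↔
      IsSinkOfDAGSolution n (fun x => (c x).take n) (fun x => (c x).drop n) v := by
  by_cases h : (c v).take n = v
  · simp only [sinkOfDAGVerifier, BlackBox.verdict, IsSinkOfDAGSolution, h, if_true,
      decide_eq_true_eq, ne_eq, not_true_eq_false, false_and, false_or]
    constructor
    · rintro rfl
      exact ⟨rfl, h⟩
    · exact fun h' => h'.1
  · simp only [sinkOfDAGVerifier, BlackBox.verdict, IsSinkOfDAGSolution, h, if_false,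
      decide_eq_true_eq, ne_eq, not_false_eq_true, true_and]
    constructor
    · exact Or.inl
    · rintro (h' | ⟨rfl, h'⟩)
      · exact h'
      · exact absurd h' h

/-- Sink-of-DAG is total, so that its oracle has an instantiation. -/
theorem SinkOfDAG.total (x : List Bool) : ∃ y, SinkOfDAG x y := by
  by_cases h : ∃ C : Circuit, (C.Plain ∧ C.outputs.length = 2 * C.inputs) ∧ x = C.encode
  · obtain ⟨C, hC, rfl⟩ := h
    set n := C.inputs with hn
    let S : List Bool → List Bool := fun x => (C.eval x).take n
    let V : List Bool → List Bool := fun x => (C.eval x).drop n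
    have hS : ∀ v, (S v).length = n := by
      intro v; simp [S, Circuit.eval, Circuit.run, hC.2]; omega
    suffices ∃ v : List Bool, v.length = n ∧ IsSinkOfDAGSolution n S V v by
      obtain ⟨v, h1, h2⟩ := this
      exact ⟨v, Or.inl ⟨C, hC, rfl, h1, h2⟩⟩
    by_cases h0 : S (zeros n) = zeros n
    · exact ⟨zeros n, by simp [zeros], Or.inr ⟨rfl, h0⟩⟩
    · have hfin : ({v : List Bool | v.length = n ∧ S v ≠ v}).Finite :=
        (List.finite_length_eq Bool n).subset fun v h => h.1
      obtain ⟨v, hv, hmax⟩ := Set.exists_max_image _ (fun v => bitsToNat (V v)) hfin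
        ⟨zeros n, by simp [zeros], h0⟩
      refine ⟨v, hv.1, Or.inl ⟨hv.2, ?_⟩⟩
      by_cases h1 : S (S v) = S v
      · exact Or.inl h1
      · exact Or.inr (hmax (S v) ⟨hS v, h1⟩)
  · exact ⟨[], Or.inr ⟨h, rfl⟩⟩

end TotalSearch

/-! The inclusion of $\mathsf{PLS}$ in $\mathsf{PLS}^{\mathsf{PLS}}$ is a matter of conventions: a
circuit without oracle gates is an instance of the relativized problem with the same solutions, and
only strings that encode no Sink-of-DAG instance need care (`PLS_subset_PLSrelPLS`).

The other inclusion rests on one principle: a local search each of whose steps may ask for a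
solution of some Sink-of-DAG instance is again an ordinary local search. While a query is open, the
state also carries the current point of the inner search for its solution. Steps of the inner search
leave the outer state alone and raise the inner value; when the inner search ends, the outer search
makes its step and raises the outer value. The lexicographic order (outer value, inner value)
increases throughout. This is `reducible_of_querySearch`, built on `reducible_of_localSearch`. The
outer search has to progress for every solution of the query, since nothing is known about which one
the inner search finds.

Both uses of the oracle are such searches. For a polynomial-time oracle program
(`reducible_of_fpOracle`), the state is the list of answers received so far, and progress is its
length. The answers recorded have to be solutions and consistent with each other; such a finite
record extends to a total oracle (`exists_instantiates`), so the promise on the program, which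
concerns genuine oracles only, applies to the simulated run. A repeated query gets its old answer
and costs a trivial question.

For an instance with oracle gates (`relativize_sinkOfDAG_reducible`), the state consists of a vertex
$v$ and the oracle answers so far in the evaluations of the circuit at $v$ and at $S(v)$. The
answers are filled in one by one. Once both evaluations are complete and $v$ is no solution, the
search moves to $S(v)$ and keeps the answers used there. Keeping them is essential: $S$ and $V$
depend on the answers, so the comparison $V(v)<V(S(v))$ is worth something only if $V(S(v))$ is not
recomputed with others. Consistency is needed only between the two evaluations that are current;
older answers are forgotten. The value is $V(v)$ followed by a count of answer bits
(`Circuit.isSearchState_next`).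

If now $R$ reduces to the relativized problem by $f^b,g^b$, and $f',g'$ reduce the latter to
Sink-of-DAG, then $x\mapsto g^b(g'(b(f'(f^b(x)))))$ solves $R$ by an oracle program, and
`reducible_of_fpOracle` applies.

To turn a local search into a Sink-of-DAG instance, its step has to be written as a circuit.
`PT.exists_circuits` does this for all polynomial-time functions: a run of a stack program is the
space-time diagram of a cellular automaton, hence a regular array of copies of one fixed circuit.
Membership in polynomial time is established by a calculus of functions `PT` on tree-coded data,
closed under composition, case distinction, bounded iteration and folds. -/

namespace TotalSearch

/-! ### Tree-coded data and elementary stack programs on them. -/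

/-! ## Binary trees as universal data -/

/-- Binary trees, the universal data type of the polynomial-time calculus below. -/
inductive Sexp : Type
  | leaf : Sexp
  | node (a b : Sexp) : Sexp

/-- Preorder code of a tree; it is self-delimiting. -/
def Sexp.enc : Sexp → List Bool
  | .leaf => [false]
  | .node a b => true :: (a.enc ++ b.enc)

/-- Needed only to make codes injective, so that equality of objects can be decided on codes; the
stack programs find the end of a tree by counting pending subtrees. -/
theorem Sexp.enc_append_inj {a b : Sexp} {s t : List Bool} (h : a.enc ++ s = b.enc ++ t) :
    a = b ∧ s = t := by
  induction a generalizing b s t with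
  | leaf => cases b <;> simp_all [Sexp.enc]
  | node a1 a2 ih1 ih2 =>
    cases b with
    | leaf => simp [Sexp.enc] at h
    | node b1 b2 =>
      simp only [Sexp.enc, List.cons_append, List.append_assoc, List.cons.injEq, true_and] at h
      obtain ⟨h1, h2⟩ := ih1 h
      obtain ⟨h3, h4⟩ := ih2 h2
      exact ⟨by rw [h1, h3], h4⟩

theorem Sexp.enc_injective : Function.Injective Sexp.enc := fun a b h =>
  (Sexp.enc_append_inj (s := []) (t := []) (by simpa using h)).1

theorem Sexp.enc_length_pos (a : Sexp) : 0 < a.enc.length := by cases a <;> simp [Sexp.enc]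

/-- Types whose elements are represented by trees. -/
class Rep (α : Type) where
  rep : α → Sexp
  inj : Function.Injective rep

/-- The code of a represented object. -/
def code {α : Type} [Rep α] (a : α) : List Bool := (Rep.rep a).enc

/-- The size of a represented object. -/
def sz {α : Type} [Rep α] (a : α) : ℕ := (code a).length

/-! ## Stores with four stacks -/

/-- The store with four stacks in use. -/
def st (a b c d : List Bool) : Store
  | 0 => a
  | 1 => b
  | 2 => c
  | 3 => d
  | _ => []

@[simp] theorem st_zero (a b c d : List Bool) : st a b c d 0 = a := rfl
@[simp] theorem st_one (a b c d : List Bool) : st a b c d 1 = b := rfl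
@[simp] theorem st_two (a b c d : List Bool) : st a b c d 2 = c := rfl
@[simp] theorem st_three (a b c d : List Bool) : st a b c d 3 = d := rfl

@[simp] theorem update_st_zero (a b c d x : List Bool) :
    Function.update (st a b c d) 0 x = st x b c d := by
  funext i; rcases i with _ | _ | _ | _ | i <;> simp [st, Function.update]

@[simp] theorem update_st_one (a b c d x : List Bool) :
    Function.update (st a b c d) 1 x = st a x c d := by
  funext i; rcases i with _ | _ | _ | _ | i <;> simp [st, Function.update]

@[simp] theorem update_st_two (a b c d x : List Bool) :
    Function.update (st a b c d) 2 x = st a b x d := by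
  funext i; rcases i with _ | _ | _ | _ | i <;> simp [st, Function.update]

@[simp] theorem update_st_three (a b c d x : List Bool) :
    Function.update (st a b c d) 3 x = st a b c x := by
  funext i; rcases i with _ | _ | _ | _ | i <;> simp [st, Function.update]

/-- `P` leads from `σ` to `τ` within `T` steps. -/
def RunsWithin (P : Prog) (σ τ : Store) (T : ℕ) : Prop := ∃ t ≤ T, Runs noOracle P σ τ t

namespace RunsWithin

variable {P Q S : Prog} {σ τ υ : Store} {T T' : ℕ} {r : ℕ} {c : Bool}

theorem mono (h : RunsWithin P σ τ T) (hT : T ≤ T') : RunsWithin P σ τ T' :=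
  let ⟨t, ht, h⟩ := h
  ⟨t, ht.trans hT, h⟩

theorem skip : RunsWithin .skip σ σ 1 := ⟨1, le_rfl, .skip σ⟩

theorem push (h : Function.update σ r (c :: σ r) = τ) : RunsWithin (.push r c) σ τ 1 :=
  ⟨1, le_rfl, h ▸ .push σ r c⟩

theorem pop (h : Function.update σ r (σ r).tail = τ) : RunsWithin (.pop r) σ τ 1 :=
  ⟨1, le_rfl, h ▸ .pop σ r⟩

theorem seq (h : RunsWithin P σ τ T) (h' : RunsWithin Q τ υ T') :
    RunsWithin (.seq P Q) σ υ (T + T') :=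
  let ⟨_, ht, h⟩ := h
  let ⟨_, ht', h'⟩ := h'
  ⟨_, Nat.add_le_add ht ht', .seq h h'⟩

theorem branchFalse (h0 : (σ r).head? = some false) (h : RunsWithin Q σ τ T) :
    RunsWithin (.branch r P Q S) σ τ (1 + T) :=
  let ⟨_, ht, h⟩ := h
  ⟨_, Nat.add_le_add_left ht 1, .branchFalse h0 h⟩

theorem branchTrue (h0 : (σ r).head? = some true) (h : RunsWithin S σ τ T) :
    RunsWithin (.branch r P Q S) σ τ (1 + T) :=
  let ⟨_, ht, h⟩ := h
  ⟨_, Nat.add_le_add_left ht 1, .branchTrue h0 h⟩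

theorem loopStop (h0 : σ r = []) : RunsWithin (.loop r P) σ σ 1 := ⟨1, le_rfl, .loopStop h0⟩

theorem loopStep (h0 : σ r ≠ []) (h : RunsWithin P σ τ T) (h' : RunsWithin (.loop r P) τ υ T') :
    RunsWithin (.loop r P) σ υ (1 + T + T') :=
  let ⟨_, ht, h⟩ := h
  let ⟨_, ht', h'⟩ := h'
  ⟨_, by omega, .loopStep h0 h h'⟩

end RunsWithin

/-! ## Moving trees between stacks -/

/-- Scanning of a tree on stack `0`: its bits are removed one by one, and for each of them one of
two programs is run. Stack `1` counts the subtrees that are still to come. -/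
def scanBody (A : Bool → Prog) : Prog :=
  .seq (.pop 1) (.branch 0 .skip (.seq (.pop 0) (A false))
    (.seq (.pop 0) (.seq (A true) (.seq (.push 1 true) (.push 1 true)))))

/-- See `scanBody`. -/
def scan (A : Bool → Prog) : Prog := .seq (.push 1 true) (.loop 1 (scanBody A))

/-- A node bit replaces one pending subtree by two, a leaf bit removes one, so the counter returns
to `r1` exactly when `t` is used up. The rest of the loop enters as a hypothesis in continuation
style; in the node case the induction hypotheses for the two subtrees then simply compose. -/
theorem scan_loop {A : Bool → Prog} {g h : Bool → List Bool → List Bool} {k : ℕ}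
    (hA : ∀ b r0 r1 r2 r3, RunsWithin (A b) (st r0 r1 r2 r3) (st r0 r1 (g b r2) (h b r3)) k)
    (t : Sexp) : ∀ (r0 r1 r2 r3 : List Bool) (υ : Store) (T : ℕ),
      RunsWithin (.loop 1 (scanBody A))
        (st r0 r1 (t.enc.foldl (fun r b => g b r) r2) (t.enc.foldl (fun r b => h b r) r3)) υ T →
      RunsWithin (.loop 1 (scanBody A)) (st (t.enc ++ r0) (true :: r1) r2 r3) υ
        (T + (k + 6) * t.enc.length) := by
  induction t with
  | leaf =>
    intro r0 r1 r2 r3 υ T H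
    refine (RunsWithin.loopStep (τ := st r0 r1 (g false r2) (h false r3)) (T := 1 + (1 + (1 + k)))
      (by simp) ?_ H).mono (by simp [Sexp.enc]; omega)
    refine (RunsWithin.pop rfl).seq (.branchFalse (by simp [Sexp.enc])
      ((RunsWithin.pop rfl).seq ?_))
    simpa [Sexp.enc] using hA false r0 r1 r2 r3
  | node a b iha ihb =>
    intro r0 r1 r2 r3 υ T H
    simp only [Sexp.enc, List.foldl_cons, List.foldl_append] at H
    have h1 := iha _ _ _ _ _ _ (ihb _ _ _ _ _ _ H)
    refine (RunsWithin.loopStep (T := 1 + (1 + (1 + (k + (1 + 1))))) (by simp) ?_ h1).mono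
      (by simp [Sexp.enc]; ring_nf; omega)
    refine (RunsWithin.pop rfl).seq (.branchTrue (by simp [Sexp.enc])
      ((RunsWithin.pop rfl).seq (.seq (τ := st (a.enc ++ (b.enc ++ r0)) r1 (g true r2) (h true r3))
        ?_ ((RunsWithin.push rfl).seq (RunsWithin.push ?_)))))
    · simpa [Sexp.enc] using hA true _ r1 r2 r3
    · simp

theorem runsWithin_scan {A : Bool → Prog} {g h : Bool → List Bool → List Bool} {k : ℕ}
    (hA : ∀ b r0 r1 r2 r3, RunsWithin (A b) (st r0 r1 r2 r3) (st r0 r1 (g b r2) (h b r3)) k)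
    (t : Sexp) (r0 r2 r3 : List Bool) :
    RunsWithin (scan A) (st (t.enc ++ r0) [] r2 r3)
      (st r0 [] (t.enc.foldl (fun r b => g b r) r2) (t.enc.foldl (fun r b => h b r) r3))
      ((k + 8) * t.enc.length) := by
  have := t.enc_length_pos
  refine ((RunsWithin.push rfl).seq (T' := 1 + (k + 6) * t.enc.length) ?_).mono
    (by ring_nf; omega)
  simpa using scan_loop hA t r0 [] r2 r3 _ _ (RunsWithin.loopStop rfl)

/-- A list of bits on a stack, in a form from which it can be taken back. -/
def frame (l r : List Bool) : List Bool := l.foldr (fun b r => true :: b :: r) (false :: r)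

/-- In a frame every data bit lies under a marker `true`, and a marker `false` closes the block, so
the unwinding loop can tell the block from whatever lies below it. Pushing reverses the order, and
unwinding restores it. -/
theorem foldl_frame (l m r : List Bool) :
    l.foldl (fun r b => true :: b :: r) (frame m r) = frame (l.reverse ++ m) r := by
  induction l generalizing m with
  | nil => rfl
  | cons b l _ =>
    simp [frame]

theorem foldl_frame_nil (l r : List Bool) :
    l.foldl (fun r b => true :: b :: r) (false :: r) = frame l.reverse r := by
  rw [← List.append_nil l.reverse, ← foldl_frame]
  rfl

/-- Unwinding of a frame on stack `s`: for each of its bits one of two programs is run. -/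
def unwindBody (s : ℕ) (B : Bool → Prog) : Prog :=
  .seq (.pop 1) (.branch s .skip (.pop s)
    (.seq (.pop s) (.branch s .skip (.seq (.pop s) (.seq (B false) (.push 1 true)))
      (.seq (.pop s) (.seq (B true) (.push 1 true))))))

/-- See `unwindBody`. -/
def unwind (s : ℕ) (B : Bool → Prog) : Prog := .seq (.push 1 true) (.loop 1 (unwindBody s B))

theorem unwind_loop_two {B : Bool → Prog} {g : Bool → List Bool → List Bool} {k : ℕ}
    (hB : ∀ b r0 r1 r2 r3, RunsWithin (B b) (st r0 r1 r2 r3) (st (g b r0) r1 r2 r3) k)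
    (l r0 r2 r3 : List Bool) :
    RunsWithin (.loop 1 (unwindBody 2 B)) (st r0 [true] (frame l r2) r3)
      (st (l.foldl (fun r b => g b r) r0) [] r2 r3) ((k + 8) * l.length + 5) := by
  induction l generalizing r0 with
  | nil =>
    refine (RunsWithin.loopStep (τ := st r0 [] r2 r3) (by simp)
      ((RunsWithin.pop rfl).seq (.branchFalse (by simp [frame]) (.pop (by simp [frame]))))
      (.loopStop rfl)).mono (by simp)
  | cons b l ih =>
    refine (RunsWithin.loopStep (T := 1 + (1 + (1 + (1 + (1 + (k + 1)))))) (by simp) ?_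
      (ih (g b r0))).mono (by simp only [List.length_cons]; ring_nf; omega)
    refine (RunsWithin.pop rfl).seq (.branchTrue (by simp [frame]) ((RunsWithin.pop rfl).seq ?_))
    cases b
    · refine .branchFalse (by simp [frame]) ((RunsWithin.pop rfl).seq
        (.seq (τ := st (g false r0) [] (frame l r2) r3) ?_ (.push ?_)))
      · simpa [frame] using hB false r0 [] (frame l r2) r3
      · simp
    · refine .branchTrue (by simp [frame]) ((RunsWithin.pop rfl).seq
        (.seq (τ := st (g true r0) [] (frame l r2) r3) ?_ (.push ?_)))
      · simpa [frame] using hB true r0 [] (frame l r2) r3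
      · simp

theorem unwind_loop_three {B : Bool → Prog} {g : Bool → List Bool → List Bool} {k : ℕ}
    (hB : ∀ b r0 r1 r2 r3, RunsWithin (B b) (st r0 r1 r2 r3) (st (g b r0) r1 r2 r3) k)
    (l r0 r2 r3 : List Bool) :
    RunsWithin (.loop 1 (unwindBody 3 B)) (st r0 [true] r2 (frame l r3))
      (st (l.foldl (fun r b => g b r) r0) [] r2 r3) ((k + 8) * l.length + 5) := by
  induction l generalizing r0 with
  | nil =>
    refine (RunsWithin.loopStep (τ := st r0 [] r2 r3) (by simp)
      ((RunsWithin.pop rfl).seq (.branchFalse (by simp [frame]) (.pop (by simp [frame]))))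
      (.loopStop rfl)).mono (by simp)
  | cons b l ih =>
    refine (RunsWithin.loopStep (T := 1 + (1 + (1 + (1 + (1 + (k + 1)))))) (by simp) ?_
      (ih (g b r0))).mono (by simp only [List.length_cons]; ring_nf; omega)
    refine (RunsWithin.pop rfl).seq (.branchTrue (by simp [frame]) ((RunsWithin.pop rfl).seq ?_))
    cases b
    · refine .branchFalse (by simp [frame]) ((RunsWithin.pop rfl).seq
        (.seq (τ := st (g false r0) [] r2 (frame l r3)) ?_ (.push ?_)))
      · simpa [frame] using hB false r0 [] r2 (frame l r3)
      · simp
    · refine .branchTrue (by simp [frame]) ((RunsWithin.pop rfl).seq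
        (.seq (τ := st (g true r0) [] r2 (frame l r3)) ?_ (.push ?_)))
      · simpa [frame] using hB true r0 [] r2 (frame l r3)
      · simp

/-- Removes a tree from stack `0`. -/
def dropTree : Prog := scan fun _ => .skip

theorem runsWithin_dropTree (t : Sexp) (r0 r2 r3 : List Bool) :
    RunsWithin dropTree (st (t.enc ++ r0) [] r2 r3) (st r0 [] r2 r3) (9 * t.enc.length) := by
  have := runsWithin_scan (A := fun _ => .skip) (g := fun _ r => r) (h := fun _ r => r) (k := 1)
    (fun _ _ _ _ _ => .skip) t r0 r2 r3
  simpa [dropTree] using this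

/-- Moves a tree from stack `0` into a frame on stack `2`. -/
def toTwo : Prog := .seq (.push 2 false) (scan fun b => .seq (.push 2 b) (.push 2 true))

theorem runsWithin_toTwo (t : Sexp) (r0 r2 r3 : List Bool) :
    RunsWithin toTwo (st (t.enc ++ r0) [] r2 r3) (st r0 [] (frame t.enc.reverse r2) r3)
      (11 * t.enc.length) := by
  have := t.enc_length_pos
  have := runsWithin_scan (A := fun b => .seq (.push 2 b) (.push 2 true))
    (g := fun b r => true :: b :: r) (h := fun _ r => r) (k := 2)
    (fun _ _ _ _ _ => .seq (.push rfl) (.push (by simp))) t r0 (false :: r2) r3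
  refine RunsWithin.mono (T := 1 + 10 * t.enc.length) (.seq (τ := st (t.enc ++ r0) [] (false :: r2) r3)
    (.push (by simp)) ?_) (by omega)
  simpa [foldl_frame_nil] using this

/-- Moves a tree from stack `0` into a frame on stack `3`. -/
def toThree : Prog := .seq (.push 3 false) (scan fun b => .seq (.push 3 b) (.push 3 true))

theorem runsWithin_toThree (t : Sexp) (r0 r2 r3 : List Bool) :
    RunsWithin toThree (st (t.enc ++ r0) [] r2 r3) (st r0 [] r2 (frame t.enc.reverse r3))
      (11 * t.enc.length) := by
  have := t.enc_length_pos
  have := runsWithin_scan (A := fun b => .seq (.push 3 b) (.push 3 true))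
    (g := fun _ r => r) (h := fun b r => true :: b :: r) (k := 2)
    (fun _ _ _ _ _ => .seq (.push rfl) (.push (by simp))) t r0 r2 (false :: r3)
  refine RunsWithin.mono (T := 1 + 10 * t.enc.length) (.seq (τ := st (t.enc ++ r0) [] r2 (false :: r3))
    (.push (by simp)) ?_) (by omega)
  simpa [foldl_frame_nil] using this

/-- Moves the contents of a frame on stack `2` back to stack `0`. -/
def ofTwo : Prog := unwind 2 fun b => .push 0 b

theorem runsWithin_ofTwo (t : Sexp) (r0 r2 r3 : List Bool) :
    RunsWithin ofTwo (st r0 [] (frame t.enc.reverse r2) r3) (st (t.enc ++ r0) [] r2 r3)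
      (15 * t.enc.length) := by
  have := t.enc_length_pos
  unfold ofTwo unwind
  have := unwind_loop_two (B := fun b => .push 0 b) (g := fun b r => b :: r) (k := 1)
    (fun _ _ _ _ _ => .push (by simp)) t.enc.reverse r0 r2 r3
  refine (RunsWithin.seq (T := 1) (RunsWithin.push rfl) (T' := 9 * t.enc.length + 5) ?_).mono (by omega)
  simpa using this

/-- Moves the contents of a frame on stack `3` back to stack `0`. -/
def ofThree : Prog := unwind 3 fun b => .push 0 b

theorem runsWithin_ofThree (t : Sexp) (r0 r2 r3 : List Bool) :
    RunsWithin ofThree (st r0 [] r2 (frame t.enc.reverse r3)) (st (t.enc ++ r0) [] r2 r3)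
      (15 * t.enc.length) := by
  have := t.enc_length_pos
  unfold ofThree unwind
  have := unwind_loop_three (B := fun b => .push 0 b) (g := fun b r => b :: r) (k := 1)
    (fun _ _ _ _ _ => .push (by simp)) t.enc.reverse r0 r2 r3
  refine (RunsWithin.seq (T := 1) (RunsWithin.push rfl) (T' := 9 * t.enc.length + 5) ?_).mono (by omega)
  simpa using this

/-- Duplicates the tree on top of stack `0`. -/
def dupTree : Prog :=
  .seq (.seq (.push 2 false) (.seq (.push 3 false)
    (scan fun b => .seq (.seq (.push 2 b) (.push 2 true)) (.seq (.push 3 b) (.push 3 true)))))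
    (.seq ofTwo ofThree)

theorem runsWithin_dupTree (t : Sexp) (r0 r2 r3 : List Bool) :
    RunsWithin dupTree (st (t.enc ++ r0) [] r2 r3) (st (t.enc ++ (t.enc ++ r0)) [] r2 r3)
      (44 * t.enc.length) := by
  have := t.enc_length_pos
  have := runsWithin_scan
    (A := fun b => .seq (.seq (.push 2 b) (.push 2 true)) (.seq (.push 3 b) (.push 3 true)))
    (g := fun b r => true :: b :: r) (h := fun b r => true :: b :: r) (k := 4)
    (fun _ _ _ _ _ => ((RunsWithin.push rfl).seq (RunsWithin.push rfl)).seq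
      ((RunsWithin.push rfl).seq (RunsWithin.push (by simp)))) t r0 (false :: r2) (false :: r3)
  refine (RunsWithin.seq (τ := st r0 [] (frame t.enc.reverse r2) (frame t.enc.reverse r3))
    (T := 1 + (1 + 12 * t.enc.length)) ((RunsWithin.push rfl).seq ((RunsWithin.push rfl).seq ?_))
    ((runsWithin_ofTwo t _ _ _).seq (runsWithin_ofThree t _ _ _))).mono (by omega)
  simpa [foldl_frame_nil] using this

/-- Exchanges the two topmost trees of stack `0`. -/
def swapTrees : Prog := .seq toTwo (.seq toThree (.seq ofTwo ofThree))

theorem runsWithin_swapTrees (s t : Sexp) (r0 r2 r3 : List Bool) :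
    RunsWithin swapTrees (st (s.enc ++ (t.enc ++ r0)) [] r2 r3)
      (st (t.enc ++ (s.enc ++ r0)) [] r2 r3) (26 * s.enc.length + 26 * t.enc.length) :=
  ((runsWithin_toTwo s _ _ _).seq ((runsWithin_toThree t _ _ _).seq
    ((runsWithin_ofTwo s _ _ _).seq (runsWithin_ofThree t _ _ _)))).mono (by omega)

/-- Removes the second tree of stack `0`. -/
def nipTree : Prog := .seq toTwo (.seq dropTree ofTwo)

theorem runsWithin_nipTree (s t : Sexp) (r0 r2 r3 : List Bool) :
    RunsWithin nipTree (st (s.enc ++ (t.enc ++ r0)) [] r2 r3)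
      (st (s.enc ++ r0) [] r2 r3) (26 * s.enc.length + 9 * t.enc.length) :=
  ((runsWithin_toTwo s _ _ _).seq ((runsWithin_dropTree t _ _ _).seq
    (runsWithin_ofTwo s _ _ _))).mono (by omega)

theorem queryFree_ofTwo : ofTwo.QueryFree := by simp [ofTwo, unwind, unwindBody, Prog.QueryFree]
theorem queryFree_ofThree : ofThree.QueryFree := by
  simp [ofThree, unwind, unwindBody, Prog.QueryFree]
theorem queryFree_toTwo : toTwo.QueryFree := by simp [toTwo, scan, scanBody, Prog.QueryFree]
theorem queryFree_toThree : toThree.QueryFree := by simp [toThree, scan, scanBody, Prog.QueryFree]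
theorem queryFree_dropTree : dropTree.QueryFree := by
  simp [dropTree, scan, scanBody, Prog.QueryFree]
theorem queryFree_dupTree : dupTree.QueryFree := by
  simp [dupTree, scan, scanBody, Prog.QueryFree, queryFree_ofTwo, queryFree_ofThree]
theorem queryFree_swapTrees : swapTrees.QueryFree := by
  simp [swapTrees, Prog.QueryFree, queryFree_ofTwo, queryFree_ofThree, queryFree_toTwo,
    queryFree_toThree]
theorem queryFree_nipTree : nipTree.QueryFree := by
  simp [nipTree, Prog.QueryFree, queryFree_ofTwo, queryFree_dropTree, queryFree_toTwo]

end TotalSearch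

/-! ### Polynomial-time functions on represented types: composition, pairs, cases, iteration. -/

namespace TotalSearch

variable {α β γ δ ε : Type} [Rep α] [Rep β] [Rep γ] [Rep δ] [Rep ε]

/-! ## Polynomial bounds -/

theorem eval_mono (p : Polynomial ℕ) {m n : ℕ} (h : m ≤ n) : p.eval m ≤ p.eval n := by
  induction p using Polynomial.induction_on' with
  | add p q hp hq => simpa using Nat.add_le_add hp hq
  | monomial k a => simpa using Nat.mul_le_mul_left a (Nat.pow_le_pow_left h k)

/-! ## Polynomial-time functions on represented types -/

/-- `P` replaces the code of `a` on top of stack `0` by the code of `a'`, within `T` steps. -/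
def Transforms (P : Prog) (a : List Bool) (a' : List Bool) (T : ℕ) : Prop :=
  ∀ r0 r2 r3, RunsWithin P (st (a ++ r0) [] r2 r3) (st (a' ++ r0) [] r2 r3) T

theorem Transforms.seq {P Q : Prog} {a b c : List Bool} {T T' : ℕ} (h : Transforms P a b T)
    (h' : Transforms Q b c T') : Transforms (.seq P Q) a c (T + T') :=
  fun r0 r2 r3 => (h r0 r2 r3).seq (h' r0 r2 r3)

theorem Transforms.mono {P : Prog} {a b : List Bool} {T T' : ℕ} (h : Transforms P a b T)
    (hT : T ≤ T') : Transforms P a b T' :=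
  fun r0 r2 r3 => (h r0 r2 r3).mono hT

/-- Functions computable in polynomial time with respect to the codes of their arguments and
values. -/
@[fun_prop]
def PT (f : α → β) : Prop :=
  ∃ (P : Prog) (p : Polynomial ℕ), P.QueryFree ∧
    ∀ a, Transforms P (code a) (code (f a)) (p.eval (sz a))

/-- A step lengthens a stack by at most its cost, also a query, since it is charged for its answer.
Hence running times bound output sizes, which is what lets polynomial bounds compose. -/
theorem Runs.length_le {b : List Bool → List Bool} {P : Prog} {σ τ : Store} {t : ℕ}
    (h : Runs b P σ τ t) (r : ℕ) : (τ r).length ≤ (σ r).length + t := by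
  induction h with
  | skip => omega
  | push σ s c => rw [Function.update_apply]; split_ifs with h <;> simp [h]
  | pop σ s => rw [Function.update_apply]; split_ifs with h <;> simp [h]; omega
  | query σ s s' => rw [Function.update_apply]; split_ifs with h <;> omega
  | seq _ _ ih1 ih2 => omega
  | branchEmpty _ _ ih => omega
  | branchFalse _ _ ih => omega
  | branchTrue _ _ ih => omega
  | loopStop => omega
  | loopStep _ _ _ ih1 ih2 => omega

theorem Transforms.length_le {P : Prog} {a b : List Bool} {T : ℕ} (h : Transforms P a b T) :
    b.length ≤ a.length + T := by
  obtain ⟨t, ht, h⟩ := h [] [] []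
  have := h.length_le 0
  simp at this
  omega

theorem PT.exists_sz_le {f : α → β} (hf : PT f) :
    ∃ q : Polynomial ℕ, ∀ a, sz (f a) ≤ q.eval (sz a) := by
  obtain ⟨P, p, -, h⟩ := hf
  exact ⟨Polynomial.X + p, fun a => by simpa [sz] using (h a).length_le⟩

@[fun_prop]
theorem PT.id : PT (fun a : α => a) :=
  ⟨.skip, 1, trivial, fun a r0 r2 r3 => by simpa using RunsWithin.skip⟩

@[fun_prop]
theorem PT.comp {f : β → γ} {g : α → β} (hf : PT f) (hg : PT g) : PT (fun a => f (g a)) := by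
  obtain ⟨q, hq⟩ := hg.exists_sz_le
  obtain ⟨P, p, hP, hf⟩ := hf
  obtain ⟨P', p', hP', hg⟩ := hg
  refine ⟨.seq P' P, p' + p.comp q, ⟨hP', hP⟩, fun a => ((hg a).seq (hf _)).mono ?_⟩
  simpa using eval_mono p (hq a)

/-- Functions given by the identity on codes. -/
theorem PT.of_rep_eq {f : α → β} (h : ∀ a, Rep.rep (f a) = Rep.rep a) : PT f :=
  ⟨.skip, 1, trivial, fun a r0 r2 r3 => by
    simpa [code, h] using RunsWithin.skip⟩

/-- Programs see codes only. Constructors whose tree is that of a pair (successor, cons, `some`,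
gates, circuits) get their programs from pairing in this way. -/
theorem PT.congr_rep {f : α → β} {g : α → γ} (hf : PT f) (h : ∀ a, Rep.rep (f a) = Rep.rep (g a)) :
    PT g := by
  obtain ⟨P, p, hP, hf⟩ := hf
  exact ⟨P, p, hP, fun a => by simpa [code, h] using hf a⟩

/-- The program that pushes a string. -/
def pushAll : List Bool → Prog
  | [] => .skip
  | b :: l => .seq (pushAll l) (.push 0 b)

theorem queryFree_pushAll (l : List Bool) : (pushAll l).QueryFree := by
  induction l with
  | nil => trivial
  | cons b l ih => exact ⟨ih, trivial⟩

theorem runsWithin_pushAll (l r0 r2 r3 : List Bool) :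
    RunsWithin (pushAll l) (st r0 [] r2 r3) (st (l ++ r0) [] r2 r3) (l.length + 1) := by
  induction l with
  | nil => exact RunsWithin.skip
  | cons b l ih => exact (ih.seq (.push (by simp))).mono (by simp)

@[fun_prop]
theorem PT.const (b : β) : PT (fun _ : α => b) := by
  refine ⟨.seq dropTree (pushAll (code b)), 9 * Polynomial.X + Polynomial.C (sz b + 1),
    ⟨queryFree_dropTree, queryFree_pushAll _⟩, fun a r0 r2 r3 => ?_⟩
  exact ((runsWithin_dropTree _ _ _ _).seq (runsWithin_pushAll _ _ _ _)).mono (by simp [sz, code])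

instance : Rep (α × β) :=
  ⟨fun a => .node (Rep.rep a.1) (Rep.rep a.2), fun a b h => by
    simp only [Sexp.node.injEq] at h
    exact Prod.ext (Rep.inj h.1) (Rep.inj h.2)⟩

theorem code_prod (a : α) (b : β) : code (a, b) = true :: (code a ++ code b) := rfl

theorem sz_prod (a : α) (b : β) : sz (a, b) = 1 + sz a + sz b := by
  simp [sz, code_prod]; omega

@[fun_prop]
theorem PT.prodMk {f : α → β} {g : α → γ} (hf : PT f) (hg : PT g) : PT (fun a => (f a, g a)) := by
  obtain ⟨q, hq⟩ := hf.exists_sz_le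
  obtain ⟨q', hq'⟩ := hg.exists_sz_le
  obtain ⟨P, p, hP, hf⟩ := hf
  obtain ⟨P', p', hP', hg⟩ := hg
  refine ⟨.seq dupTree (.seq P (.seq swapTrees (.seq P' (.seq swapTrees (.push 0 true))))),
    44 * Polynomial.X + p + (26 * q + 26 * Polynomial.X) + p' + (26 * q' + 26 * q) + 1,
    ⟨queryFree_dupTree, hP, queryFree_swapTrees, hP', queryFree_swapTrees, trivial⟩,
    fun a r0 r2 r3 => ?_⟩
  have h1 := hf a (code a ++ r0) r2 r3
  have h2 := hg a (code (f a) ++ r0) r2 r3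
  refine ((runsWithin_dupTree _ _ _ _).seq (h1.seq ((runsWithin_swapTrees _ _ _ _ _).seq
    (h2.seq ((runsWithin_swapTrees _ _ _ _ _).seq (.push ?_)))))).mono ?_
  · rw [code_prod]
    simp [code]
  · have := hq a
    have := hq' a
    simp only [sz, code] at *
    simp
    omega

@[fun_prop]
theorem PT.fst' : PT (fun a : α × β => a.1) := by
  refine ⟨.seq (.pop 0) nipTree, 27 * Polynomial.X, ⟨trivial, queryFree_nipTree⟩,
    fun a r0 r2 r3 => ?_⟩
  refine ((RunsWithin.pop (τ := st (code a.1 ++ (code a.2 ++ r0)) [] r2 r3) ?_).seq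
    (runsWithin_nipTree _ _ _ _ _)).mono ?_
  · obtain ⟨a, b⟩ := a
    simp [code_prod]
  · obtain ⟨a, b⟩ := a
    have := sz_prod a b
    simp only [sz, code] at this
    simp [sz, code, this]
    omega

@[fun_prop]
theorem PT.snd' : PT (fun a : α × β => a.2) := by
  refine ⟨.seq (.pop 0) dropTree, 27 * Polynomial.X, ⟨trivial, queryFree_dropTree⟩,
    fun a r0 r2 r3 => ?_⟩
  refine ((RunsWithin.pop (τ := st (code a.1 ++ (code a.2 ++ r0)) [] r2 r3) ?_).seq
    (runsWithin_dropTree _ _ _ _)).mono ?_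
  · obtain ⟨a, b⟩ := a
    simp [code_prod]
  · obtain ⟨a, b⟩ := a
    have := sz_prod a b
    simp only [sz, code] at this
    simp [sz, code, this]
    omega

@[fun_prop]
theorem PT.fst {f : γ → α × β} (hf : PT f) : PT (fun c => (f c).1) := PT.fst'.comp hf

@[fun_prop]
theorem PT.snd {f : γ → α × β} (hf : PT f) : PT (fun c => (f c).2) := PT.snd'.comp hf

/-- Case distinction on whether a tree is a leaf. -/
theorem PT.cases {f : γ → δ} {o : γ → Option ε} {g : γ → β} {h : γ × ε → β} (hf : PT f)
    (hg : PT g) (hh : PT h)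
    (ho : ∀ c, (o c = none ∧ Rep.rep (f c) = .leaf) ∨
      ∃ e a b, o c = some e ∧ Rep.rep (f c) = Rep.rep e ∧ Rep.rep e = .node a b) :
    PT (fun c => (o c).elim (g c) fun e => h (c, e)) := by
  obtain ⟨Pg, pg, hPg, hg⟩ := hg
  obtain ⟨Ph, ph, hPh, hh⟩ := hh
  obtain ⟨q, hq⟩ := hf.exists_sz_le
  obtain ⟨Pf, pf, hPf, hf⟩ := hf
  -- In the node case the tree of `f c` is at the same time the tree of `e`, so after a swap one
  -- node bit on top completes the code of `(c, e)`. In the leaf case the single bit is discarded.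
  refine ⟨.seq dupTree (.seq Pf (.branch 0 .skip (.seq (.pop 0) Pg)
      (.seq swapTrees (.seq (.push 0 true) Ph)))),
    44 * Polynomial.X + pf + 1 + ((1 + pg) + (26 * q + 26 * Polynomial.X) + 1 +
      ph.comp (1 + Polynomial.X + q)),
    ⟨queryFree_dupTree, hPf, trivial, ⟨trivial, hPg⟩, queryFree_swapTrees, trivial, hPh⟩,
    fun c r0 r2 r3 => ?_⟩
  have h1 := hf c (code c ++ r0) r2 r3
  refine ((runsWithin_dupTree _ _ _ _).seq (h1.seq (T' := 1 + ((1 + pg.eval (sz c)) +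
      (26 * q.eval (sz c) + 26 * sz c) + 1 + ph.eval (1 + sz c + q.eval (sz c)))) ?_)).mono ?_
  · rcases ho c with ⟨h0, h2⟩ | ⟨e, a, b, h0, h2, h3⟩
    · simp only [h0, Option.elim]
      refine (RunsWithin.branchFalse (by simp [code, h2, Sexp.enc])
        ((RunsWithin.pop (τ := st (code c ++ r0) [] r2 r3) ?_).seq (hg c r0 r2 r3))).mono ?_
      · simp [code, h2, Sexp.enc]
      · omega
    · have h4 := hh (c, e) r0 r2 r3
      have h5 : code (f c) = code e := by simp [code, h2]
      simp only [h0, h5, Option.elim]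
      refine (RunsWithin.branchTrue (by simp [h3, Sexp.enc])
        ((runsWithin_swapTrees _ _ _ _ _).seq ((RunsWithin.push rfl).seq
          (T' := ph.eval (1 + sz c + q.eval (sz c))) ?_))).mono ?_
      · have h6 := hq c
        rw [sz, h5] at h6
        refine (RunsWithin.mono (T := ph.eval (sz (c, e))) ?_ (eval_mono ph ?_))
        · rw [code_prod] at h4
          simpa [code] using h4
        · rw [sz_prod, sz]
          simp only [sz] at *
          omega
      · have := hq c
        simp only [sz, code, h2] at *
        omega
  · simp [sz, code]
    omega

/-! ### Basic types -/

instance : Rep Unit := ⟨fun _ => .leaf, fun _ _ _ => rfl⟩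

instance : Rep Bool :=
  ⟨fun b => bif b then .node .leaf .leaf else .leaf, fun a b h => by
    cases a <;> cases b <;> simp_all⟩

/-- Unary numerals. -/
def natRep : ℕ → Sexp
  | 0 => .leaf
  | n + 1 => .node .leaf (natRep n)

instance : Rep ℕ :=
  ⟨natRep, fun a b h => by
    induction a generalizing b with
    | zero => cases b <;> simp_all [natRep]
    | succ a ih => 
      cases b with
      | zero => simp [natRep] at h
      | succ b => rw [ih (b := b) (by simpa [natRep] using h)]⟩

/-- Lists as trees. -/
def listRep : List α → Sexp
  | [] => .leaf
  | a :: l => .node (Rep.rep a) (listRep l)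

instance : Rep (List α) :=
  ⟨listRep, fun a b h => by
    induction a generalizing b with
    | nil => cases b <;> simp_all [listRep]
    | cons a l ih =>
      cases b with
      | nil => simp [listRep] at h
      | cons b m =>
        simp only [listRep, Sexp.node.injEq] at h
        rw [Rep.inj h.1, ih _ h.2]⟩

instance : Rep (Option α) :=
  ⟨fun o => o.elim .leaf fun a => .node .leaf (Rep.rep a), fun a b h => by
    cases a <;> cases b <;> simp_all
    exact Rep.inj h⟩

@[fun_prop]
theorem PT.ite' {b : γ → Bool} {f g : γ → β} (hb : PT b) (hf : PT f) (hg : PT g) :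
    PT (fun c => if b c = true then f c else g c) := by
  have := PT.cases (ε := Unit × Unit) (o := fun c => if b c then some ((), ()) else none) hb hg
    (h := fun c => f c.1) (by fun_prop) (fun c => by
      cases h : b c <;> simp
      · rfl
      · exact ⟨(), (), rfl, _, _, rfl⟩)
  convert this using 2 with c
  cases b c <;> rfl

theorem PT.natCases {n : γ → ℕ} {f : γ → β} {g : γ × ℕ → β} (hn : PT n) (hf : PT f) (hg : PT g) :
    PT (fun c => Nat.casesOn (motive := fun _ => β) (n c) (f c) fun m => g (c, m)) := by
  have := PT.cases (ε := Unit × ℕ)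
    (o := fun c => Nat.casesOn (motive := fun _ => _) (n c) none fun m => some ((), m)) hn hf
    (h := fun c => g (c.1, c.2.2)) (by fun_prop) (fun c => by
      cases h : n c <;> simp
      · rfl
      · exact ⟨rfl, _, _, rfl⟩)
  convert this using 2 with c
  cases n c <;> rfl

theorem PT.listCases {l : γ → List α} {f : γ → β} {g : γ × α × List α → β} (hl : PT l)
    (hf : PT f) (hg : PT g) :
    PT (fun c => List.casesOn (motive := fun _ => β) (l c) (f c) fun a m => g (c, a, m)) := by
  have := PT.cases (ε := α × List α)
    (o := fun c => List.casesOn (motive := fun _ => _) (l c) none fun a m => some (a, m)) hl hf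
    (h := g) (by fun_prop) (fun c => by
      cases h : l c <;> simp
      · rfl
      · exact ⟨rfl, _, _, rfl⟩)
  convert this using 2 with c
  cases l c <;> rfl

theorem PT.optionElim {o : γ → Option α} {f : γ → β} {g : γ × α → β} (ho : PT o)
    (hf : PT f) (hg : PT g) : PT (fun c => (o c).elim (f c) fun a => g (c, a)) := by
  have := PT.cases (ε := Unit × α)
    (o := fun c => (o c).map fun a => ((), a)) ho hf
    (h := fun c => g (c.1, c.2.2)) (by fun_prop) (fun c => by
      cases h : o c <;> simp
      · rfl
      · exact ⟨rfl, _, _, rfl⟩)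
  convert this using 2 with c
  cases o c <;> rfl

@[fun_prop]
theorem PT.succ {n : γ → ℕ} (hn : PT n) : PT (fun c => n c + 1) :=
  PT.congr_rep (f := fun c => ((), n c)) (by fun_prop) fun _ => rfl

@[fun_prop]
theorem PT.cons {a : γ → α} {l : γ → List α} (ha : PT a) (hl : PT l) :
    PT (fun c => a c :: l c) :=
  PT.congr_rep (f := fun c => (a c, l c)) (by fun_prop) fun _ => rfl

@[fun_prop]
theorem PT.someOf {a : γ → α} (ha : PT a) : PT (fun c => some (a c)) :=
  PT.congr_rep (f := fun c => ((), a c)) (by fun_prop) fun _ => rfl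

/-- Numerals are unary, so a bound on the size of a number bounds its value, and with it the number
of rounds of an iteration. -/
theorem sz_nat (n : ℕ) : sz n = 2 * n + 1 := by
  induction n with
  | zero => rfl
  | succ n ih =>
    have : sz (n + 1) = 1 + sz () + sz n := sz_prod () n
    rw [this, ih]
    have : sz () = 1 := rfl
    omega

theorem sz_nil : sz ([] : List α) = 1 := rfl

theorem sz_cons (a : α) (l : List α) : sz (a :: l) = 1 + sz a + sz l := sz_prod a l

theorem sz_pos (a : α) : 0 < sz a := Sexp.enc_length_pos _

/-! ### Iteration -/

/-- Iterates `P` on the second tree of stack `0` as often as the numeral on top says. -/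
def iterBody (P : Prog) : Prog :=
  .seq (.pop 1) (.branch 0 .skip (.pop 0)
    (.seq (.pop 0) (.seq (.pop 0) (.seq toTwo (.seq P (.seq ofTwo (.push 1 true)))))))

/-- Each round strips the successor bits `true`, `false` from the numeral and parks the rest on
stack `2` while `P` runs. The time bound on `P` is assumed only along the orbit, because the sizes
of the iterates are under control only there. -/
theorem runsWithin_iter {P : Prog} {f : α → α} {T : ℕ} (n : ℕ) (a : α)
    (hP : ∀ i < n, Transforms P (code (f^[i] a)) (code (f^[i + 1] a)) T) (r0 r2 r3 : List Bool) :
    RunsWithin (.loop 1 (iterBody P)) (st (code n ++ (code a ++ r0)) [true] r2 r3)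
      (st (code (f^[n] a) ++ r0) [] r2 r3) ((6 + 26 * sz n + T) * n + 5) := by
  induction n generalizing a with
  | zero =>
    refine (RunsWithin.loopStep (τ := st (code a ++ r0) [] r2 r3) (by simp)
      ((RunsWithin.pop rfl).seq (.branchFalse (by simp [code, Rep.rep, natRep, Sexp.enc])
        (.pop (by simp [code, Rep.rep, natRep, Sexp.enc]))))
      (.loopStop rfl)).mono (by simp)
  | succ n ih =>
    have hc : code (n + 1) = true :: false :: code n := rfl
    have h := ih (f a) (fun i hi => by simpa using hP (i + 1) (by omega))
    refine (RunsWithin.loopStep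
      (τ := st (code n ++ (code (f a) ++ r0)) [true] r2 r3)
      (T := 1 + (1 + (1 + (1 + (11 * sz n + (T + (15 * sz n + 1))))))) (by simp) ?_ ?_).mono
      (T := 1 + (1 + (1 + (1 + (1 + (11 * sz n + (T + (15 * sz n + 1))))))) +
        ((6 + 26 * sz n + T) * n + 5)) ?_
    · refine (RunsWithin.pop rfl).seq (.branchTrue (by simp [hc]) ((RunsWithin.pop rfl).seq
        ((RunsWithin.pop (τ := st (code n ++ (code a ++ r0)) [] r2 r3) ?_).seq
        ((runsWithin_toTwo _ _ _ _).seq ((hP 0 (by omega) r0 _ _).seq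
        ((runsWithin_ofTwo _ _ _ _).seq (.push ?_)))))))
      · simp [hc]
      · simp [code]
    · simpa using h
    · rw [sz_nat, sz_nat]
      ring_nf
      omega

/-- Iteration, as long as the values stay polynomially bounded. -/
theorem PT.iterate {f : α → α} {n : γ → ℕ} {i : γ → α} (hf : PT f) (hn : PT n) (hi : PT i)
    (q : Polynomial ℕ) (hq : ∀ c, ∀ j ≤ n c, sz (f^[j] (i c)) ≤ q.eval (sz c)) :
    PT (fun c => f^[n c] (i c)) := by
  obtain ⟨P, p, hP, hf⟩ := hf
  obtain ⟨P', p', hP', hni⟩ := hn.prodMk hi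
  obtain ⟨qn, hqn⟩ := hn.exists_sz_le
  refine ⟨.seq P' (.seq (.pop 0) (.seq (.push 1 true) (.loop 1 (iterBody P)))),
    p' + (1 + (1 + ((6 + 26 * qn + p.comp q) * qn + 5))), ⟨hP', trivial, trivial, ?_⟩,
    fun c r0 r2 r3 => ?_⟩
  · simp [iterBody, Prog.QueryFree, hP, queryFree_toTwo, queryFree_ofTwo]
  · have h1 := runsWithin_iter (f := f) (T := p.eval (q.eval (sz c))) (n c) (i c)
      (fun j hj => by
        have := hf (f^[j] (i c))
        rw [← Function.iterate_succ_apply' f] at this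
        exact this.mono (eval_mono p (hq c j hj.le))) r0 r2 r3
    refine ((hni c r0 r2 r3).seq ((RunsWithin.pop rfl).seq ((RunsWithin.push rfl).seq
      (RunsWithin.mono (T := (6 + 26 * sz (n c) + p.eval (q.eval (sz c))) * n c + 5) ?_ ?_)))).mono (T := p'.eval (sz c) + (1 + (1 +
        ((6 + 26 * qn.eval (sz c) + p.eval (q.eval (sz c))) * qn.eval (sz c) + 5)))) ?_
    · simpa [code_prod] using h1
    · have h2 := hqn c
      have h3 : n c ≤ qn.eval (sz c) := by rw [sz_nat] at h2; omega
      gcongr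
    · simp

/-! ### Size and quotation -/

/-- Unwinding with a modified push. -/
theorem runsWithin_unwind_two {B : Bool → Prog} {g : Bool → List Bool → List Bool} {k : ℕ}
    (hB : ∀ b r0 r1 r2 r3, RunsWithin (B b) (st r0 r1 r2 r3) (st (g b r0) r1 r2 r3) k)
    (l r0 r2 r3 : List Bool) :
    RunsWithin (unwind 2 B) (st r0 [] (frame l r2) r3)
      (st (l.foldl (fun r b => g b r) r0) [] r2 r3) ((k + 8) * l.length + 6) :=
  (RunsWithin.seq (RunsWithin.push rfl) (by simpa using unwind_loop_two hB l r0 r2 r3)).mono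
    (by omega)

-- Every bit of the code is replaced by one successor. The size in unary is the first available
-- upper bound on lengths; folds use it as their number of rounds.
@[fun_prop]
theorem PT.szOf {a : γ → α} (ha : PT a) : PT (fun c => sz (a c)) := by
  refine PT.comp (f := fun a : α => sz a) ?_ ha
  refine ⟨.seq toTwo (.seq (.push 0 false)
    (unwind 2 fun _ => .seq (.push 0 false) (.push 0 true))), 28 * Polynomial.X,
    ⟨queryFree_toTwo, trivial, ?_⟩, fun a r0 r2 r3 => ?_⟩
  · simp [unwind, unwindBody, Prog.QueryFree]
  · have h : ∀ (l r : List Bool) (m : ℕ), l.foldl (fun r _ => true :: false :: r) (code m ++ r) =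
        code (l.length + m) ++ r := by
      intro l r
      induction l with
      | nil => simp
      | cons b l ih =>
        intro m
        have := ih (m + 1)
        rw [List.length_cons, show l.length + 1 + m = l.length + (m + 1) by omega, ← this]
        rfl
    have h1 := runsWithin_unwind_two (B := fun _ => .seq (.push 0 false) (.push 0 true))
      (g := fun _ r => true :: false :: r) (k := 2)
      (fun _ _ _ _ _ => (RunsWithin.push rfl).seq (.push (by simp))) (code a).reverse
      (code 0 ++ r0) r2 r3
    have := (Rep.rep a).enc_length_pos
    rw [h] at h1
    refine ((runsWithin_toTwo _ _ _ _).seq ((RunsWithin.push (τ := st (code 0 ++ r0) []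
      (frame (code a).reverse r2) r3) ?_).seq (T' := 10 * sz a + 6) ?_)).mono
      (T := 11 * sz a + (1 + (10 * sz a + 6))) ?_
    · simp [code, Rep.rep, natRep, Sexp.enc]
    · simpa [sz] using h1
    · simp [code, sz]
      omega

/-- The code of an object, as a list of bits. -/
@[fun_prop]
theorem PT.codeOf {a : γ → α} (ha : PT a) : PT (fun c => code (a c)) := by
  refine PT.comp (f := fun a : α => code a) ?_ ha
  refine ⟨.seq toTwo (.seq (.push 0 false) (unwind 2 fun b => pushAll (true :: code b))),
    31 * Polynomial.X, ⟨queryFree_toTwo, trivial, ?_⟩, fun a r0 r2 r3 => ?_⟩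
  · simp [unwind, unwindBody, Prog.QueryFree, queryFree_pushAll]
  · have h : ∀ (l r : List Bool) (m : List Bool),
        l.foldl (fun r b => (true :: code b) ++ r) (code m ++ r) =
        code (l.reverse ++ m) ++ r := by
      intro l r
      induction l with
      | nil => simp
      | cons b l ih =>
        intro m
        have := ih (b :: m)
        rw [List.reverse_cons, List.append_assoc, List.singleton_append, ← this]
        simp [code, Rep.rep, listRep, Sexp.enc]
    have h1 := runsWithin_unwind_two (B := fun b => pushAll (true :: code b))
      (g := fun b r => (true :: code b) ++ r) (k := 5)
      (fun b r0 r1 r2 r3 => by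
        have hp : ∀ l r0, RunsWithin (pushAll l) (st r0 r1 r2 r3) (st (l ++ r0) r1 r2 r3)
            (l.length + 1) := by
          intro l r0
          induction l with
          | nil => exact RunsWithin.skip
          | cons b l ih => exact (ih.seq (.push (by simp))).mono (by simp)
        exact (hp _ _).mono (by cases b <;> simp [code, Rep.rep, Sexp.enc]))
      (code a).reverse (code ([] : List Bool) ++ r0) r2 r3
    have := (Rep.rep a).enc_length_pos
    rw [h] at h1
    refine ((runsWithin_toTwo _ _ _ _).seq ((RunsWithin.push
      (τ := st (code ([] : List Bool) ++ r0) []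
      (frame (code a).reverse r2) r3) ?_).seq
      (T' := 13 * sz a + 6) ?_)).mono
      (T := 11 * sz a + (1 + (13 * sz a + 6))) ?_
    · simp [code, Rep.rep, listRep, Sexp.enc]
    · simpa [sz] using h1
    · simp [code, sz]
      omega

end TotalSearch

/-! ### Passage between raw strings and codes. -/

namespace TotalSearch

variable {α β γ δ ε : Type} [Rep α] [Rep β] [Rep γ] [Rep δ] [Rep ε]

/-! ## Raw strings -/

/-- Runs `B b` for each bit `b` of stack `r`, from the top. -/
def eachBit (r : ℕ) (B : Bool → Prog) : Prog :=
  .loop r (.branch r .skip (.seq (.pop r) (B false)) (.seq (.pop r) (B true)))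

theorem runsWithin_eachBit {r : ℕ} {B : Bool → Prog} {k : ℕ} (s : List Bool → List Bool → Store)
    (g : Bool → List Bool → List Bool) (hr : ∀ l a, s l a r = l)
    (hB : ∀ b l a, ∃ τ, Function.update (s (b :: l) a) r l = τ ∧ RunsWithin (B b) τ (s l (g b a)) k)
    (l a : List Bool) :
    RunsWithin (eachBit r B) (s l a) (s [] (l.foldl (fun a b => g b a) a))
      ((k + 3) * l.length + 1) := by
  induction l generalizing a with
  | nil => exact (RunsWithin.loopStop (hr _ _)).mono (by simp)
  | cons b l ih =>
    obtain ⟨τ, h1, h2⟩ := hB b l a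
    refine (RunsWithin.loopStep (T := 1 + (1 + k)) (by simp [hr]) ?_ (ih (g b a))).mono
      (by simp only [List.length_cons]; ring_nf; omega)
    cases b
    · exact .branchFalse (by simp [hr]) ((RunsWithin.pop (by simpa [hr] using h1)).seq h2)
    · exact .branchTrue (by simp [hr]) ((RunsWithin.pop (by simpa [hr] using h1)).seq h2)

/-- Two raw strings on stacks `0` and `1` are replaced by the code of the pair on stack `0`. -/
def packRaw : Prog :=
  .seq (eachBit 0 fun b => .push 3 b) (.seq (eachBit 1 fun b => .push 2 b)
    (.seq (.push 0 false) (.seq (eachBit 2 fun b => pushAll (true :: code b))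
      (.seq (.push 0 false) (.seq (eachBit 3 fun b => pushAll (true :: code b)) (.push 0 true))))))

/-- The code of a list of bits on stack `0` is replaced by the raw string. -/
def unpackBody : Prog :=
  .seq (.pop 1) (.branch 0 .skip (.pop 0) (.seq (.pop 0) (.branch 0 .skip
    (.seq (.pop 0) (.seq (.push 2 false) (.push 1 true)))
    (.seq (.pop 0) (.seq (.pop 0) (.seq (.pop 0) (.seq (.push 2 true) (.push 1 true))))))))

/-- See `unpackBody`. -/
def unpackRaw : Prog :=
  .seq (.seq (.push 1 true) (.loop 1 unpackBody)) (eachBit 2 fun b => .push 0 b)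

theorem runsWithin_pushAll' (l r0 r1 r2 r3 : List Bool) :
    RunsWithin (pushAll l) (st r0 r1 r2 r3) (st (l ++ r0) r1 r2 r3) (l.length + 1) := by
  induction l with
  | nil => exact RunsWithin.skip
  | cons b l ih => exact (ih.seq (.push (by simp))).mono (by simp)

theorem foldl_cons_bits (l a : List Bool) : l.foldl (fun a b => b :: a) a = l.reverse ++ a := by
  induction l generalizing a with
  | nil => rfl
  | cons b l ih => simp [ih]

theorem foldl_code_bits (l m r : List Bool) :
    l.foldl (fun r b => (true :: code b) ++ r) (code m ++ r) = code (l.reverse ++ m) ++ r := by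
  induction l generalizing m with
  | nil => simp
  | cons b l ih =>
    have := ih (b :: m)
    rw [List.reverse_cons, List.append_assoc, List.singleton_append, ← this]
    simp [code, Rep.rep, listRep, Sexp.enc]

theorem code_bit_length_le (b : Bool) : (true :: code b).length + 1 ≤ 5 := by
  cases b <;> simp [code, Rep.rep, Sexp.enc]

theorem runsWithin_packRaw (x y : List Bool) :
    RunsWithin packRaw (st x y [] []) (st (code (x, y)) [] [] []) (20 * (x.length + y.length) + 10)
    := by
  have h1 := runsWithin_eachBit (r := 0) (B := fun b => .push 3 b) (k := 1)
    (fun l a => st l y [] a) (fun b a => b :: a) (fun _ _ => rfl)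
    (fun b l a => ⟨_, rfl, .push (by simp)⟩) x []
  have h2 := runsWithin_eachBit (r := 1) (B := fun b => .push 2 b) (k := 1)
    (fun l a => st [] l a x.reverse) (fun b a => b :: a) (fun _ _ => rfl)
    (fun b l a => ⟨_, rfl, .push (by simp)⟩) y []
  have h3 := runsWithin_eachBit (r := 2) (B := fun b => pushAll (true :: code b)) (k := 5)
    (fun l a => st a [] l x.reverse) (fun b a => (true :: code b) ++ a) (fun _ _ => rfl)
    (fun b l a => ⟨_, rfl, by
      rw [update_st_two]
      exact (runsWithin_pushAll' _ _ _ _ _).mono (code_bit_length_le b)⟩) y.reverse [false]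
  have h4 := runsWithin_eachBit (r := 3) (B := fun b => pushAll (true :: code b)) (k := 5)
    (fun l a => st a [] [] l) (fun b a => (true :: code b) ++ a) (fun _ _ => rfl)
    (fun b l a => ⟨_, rfl, by
      rw [update_st_three]
      exact (runsWithin_pushAll' _ _ _ _ _).mono (code_bit_length_le b)⟩) x.reverse
      (code ([] : List Bool) ++ code y)
  have h5 := foldl_code_bits y.reverse [] []
  rw [foldl_code_bits] at h4
  simp only [List.append_nil, List.reverse_reverse, List.length_reverse, foldl_cons_bits]
    at h1 h2 h3 h4 h5
  have h6 : code ([] : List Bool) = [false] := rfl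
  rw [h6] at h4 h5
  rw [h5] at h3
  refine (h1.seq (h2.seq ((RunsWithin.push (by simp)).seq (h3.seq ((RunsWithin.push (by simp)).seq
    (h4.seq (RunsWithin.push ?_))))))).mono (by omega)
  simp [code_prod]

theorem runsWithin_unpack_loop (l a : List Bool) :
    RunsWithin (.loop 1 unpackBody) (st (code l) [true] a []) (st [] [] (l.reverse ++ a) [])
      (10 * l.length + 5) := by
  induction l generalizing a with
  | nil =>
    exact (RunsWithin.loopStep (τ := st [] [] a []) (by simp) ((RunsWithin.pop rfl).seq
      (.branchFalse (by simp [code, Rep.rep, listRep, Sexp.enc])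
        (.pop (by simp [code, Rep.rep, listRep, Sexp.enc])))) (.loopStop rfl)).mono (by simp)
  | cons b l ih =>
    have h := ih (b :: a)
    refine (RunsWithin.loopStep (τ := st (code l) [true] (b :: a) []) (T := 9) (by simp) ?_ ?_).mono
      (T := 1 + 9 + (10 * l.length + 5)) (by simp; omega)
    · refine ((RunsWithin.pop rfl).seq (.branchTrue
        (by simp [code, Rep.rep, listRep, Sexp.enc]) ((RunsWithin.pop rfl).seq
          (T' := 6) ?_))).mono (by omega)
      cases b
      · refine RunsWithin.mono (.branchFalse (by simp [code, Rep.rep, listRep, Sexp.enc])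
          ((RunsWithin.pop rfl).seq ((RunsWithin.push rfl).seq (.push ?_)))) (by omega)
        simp [code, Rep.rep, listRep, Sexp.enc]
      · refine RunsWithin.mono (.branchTrue (by simp [code, Rep.rep, listRep, Sexp.enc])
          ((RunsWithin.pop rfl).seq ((RunsWithin.pop rfl).seq ((RunsWithin.pop rfl).seq
            ((RunsWithin.push rfl).seq (.push ?_)))))) (by omega)
        simp [code, Rep.rep, listRep, Sexp.enc]
    · simpa using h

theorem runsWithin_unpackRaw (l : List Bool) :
    RunsWithin unpackRaw (st (code l) [] [] []) (st l [] [] []) (14 * l.length + 7) := by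
  have h1 := runsWithin_unpack_loop l []
  have h2 := runsWithin_eachBit (r := 2) (B := fun b => .push 0 b) (k := 1)
    (fun l a => st a [] l []) (fun b a => b :: a) (fun _ _ => rfl)
    (fun b l a => ⟨_, rfl, .push (by simp)⟩) l.reverse []
  simp only [List.append_nil, List.reverse_reverse, List.length_reverse, foldl_cons_bits] at h1 h2
  exact (((RunsWithin.push (by simp)).seq h1).seq h2).mono (by omega)

theorem sz_bits_le (l : List Bool) : sz l ≤ 4 * l.length + 1 := by
  induction l with
  | nil => simp [sz_nil]
  | cons b l ih =>
    have : sz b ≤ 3 := by cases b <;> simp [sz, code, Rep.rep, Sexp.enc]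
    rw [sz_cons, List.length_cons]
    omega

theorem length_le_sz (l : List α) : l.length ≤ sz l := by
  induction l with
  | nil => simp
  | cons a l ih => rw [sz_cons, List.length_cons]; omega

/-- Functions of two strings that are computed by query-free programs in polynomial time. -/
def FP2 (f : List Bool → List Bool → List Bool) : Prop :=
  ∃ (P : Prog) (p : Polynomial ℕ), P.QueryFree ∧
    ∀ x y, P.Computes noOracle [x, y] (f x y) (p.eval (x.length + y.length))

/-- The bridge from the calculus to the machine model: the raw inputs are packed into the code of a
pair, and the code of the value is unpacked. -/
theorem PT.fp2 {f : List Bool × List Bool → List Bool} (hf : PT f) : FP2 fun x y => f (x, y) := by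
  obtain ⟨q, hq⟩ := hf.exists_sz_le
  obtain ⟨P, p, hP, hf⟩ := hf
  -- `4 * X + 3` bounds the size of the pair: at most four per bit, one for each end of list, one
  -- for the pair itself.
  refine ⟨.seq packRaw (.seq P unpackRaw), 20 * Polynomial.X + 10 +
    (p.comp (4 * Polynomial.X + 3) + (14 * (q.comp (4 * Polynomial.X + 3)) + 7)),
    ⟨?_, hP, ?_⟩, fun x y => ?_⟩
  · simp [packRaw, eachBit, Prog.QueryFree, queryFree_pushAll]
  · simp [unpackRaw, eachBit, unpackBody, Prog.QueryFree]
  · have h1 := hf (x, y) [] [] []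
    simp only [List.append_nil] at h1
    have hs : sz (x, y) ≤ 4 * (x.length + y.length) + 3 := by
      have h2 := sz_bits_le x
      have h3 := sz_bits_le y
      rw [sz_prod]
      omega
    have h2 := (length_le_sz (f (x, y))).trans ((hq (x, y)).trans (eval_mono q hs))
    have h3 := eval_mono p hs
    obtain ⟨t, ht, h⟩ := (runsWithin_packRaw x y).seq (h1.seq (runsWithin_unpackRaw (f (x, y))))
    refine ⟨st (f (x, y)) [] [] [], t, ?_, ht.trans ?_, rfl⟩
    · convert h using 1
      funext i
      rcases i with _ | _ | _ | _ | i <;> simp [st]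
    · simp
      omega

theorem PT.fp {f : List Bool → List Bool} (hf : PT f) : FP f := by
  obtain ⟨P, p, hP, h⟩ := (PT.comp hf PT.fst' : PT fun a : List Bool × List Bool => f a.1).fp2
  refine ⟨P, p, hP, fun x => ?_⟩
  obtain ⟨σ, t, h1, h2, h3⟩ := h x []
  refine ⟨σ, t, ?_, by simpa using h2, h3⟩
  convert h1 using 1
  funext i
  rcases i with _ | _ | i <;> simp

end TotalSearch

/-! ### Library: folds, arithmetic, decisions, list functions. -/

namespace TotalSearch

variable {α β γ δ ε σ : Type} [Rep α] [Rep β] [Rep γ] [Rep δ] [Rep ε] [Rep σ]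

/-! ## Library of polynomial-time functions -/

@[fun_prop]
theorem PT.tail {l : γ → List α} (hl : PT l) : PT (fun c => (l c).tail) := by
  have := PT.listCases (f := fun _ => ([] : List α)) (g := fun x : γ × α × List α => x.2.2) hl
    (by fun_prop) (by fun_prop)
  convert this using 2 with c
  cases l c <;> rfl

@[fun_prop]
theorem PT.head? {l : γ → List α} (hl : PT l) : PT (fun c => (l c).head?) := by
  have := PT.listCases (f := fun _ => (none : Option α))
    (g := fun x : γ × α × List α => some x.2.1) hl (by fun_prop) (by fun_prop)
  convert this using 2 with c
  cases l c <;> rfl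

@[fun_prop]
theorem PT.getD_option {o : γ → Option α} {d : γ → α} (ho : PT o) (hd : PT d) :
    PT (fun c => (o c).getD (d c)) := by
  have := PT.optionElim (f := d) (g := fun x : γ × α => x.2) ho hd (by fun_prop)
  convert this using 2 with c
  cases o c <;> rfl

@[fun_prop]
theorem PT.headD {l : γ → List α} {d : γ → α} (hl : PT l) (hd : PT d) :
    PT (fun c => (l c).headD (d c)) := by
  have : PT fun c => (l c).head?.getD (d c) := by fun_prop
  convert this using 2 with c
  cases l c <;> rfl

@[fun_prop]
theorem PT.pred {n : γ → ℕ} (hn : PT n) : PT (fun c => n c - 1) := by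
  have := PT.natCases (f := fun _ => 0) (g := fun x : γ × ℕ => x.2) hn (by fun_prop) (by fun_prop)
  convert this using 2 with c
  cases n c <;> rfl

/-! ### Folds -/

theorem sz_mem_le {a : α} {l : List α} (h : a ∈ l) : sz a ≤ sz l := by
  induction l with
  | nil => simp at h
  | cons b l ih =>
    rw [sz_cons]
    rcases List.mem_cons.1 h with rfl | h
    · omega
    · have := ih h
      omega

theorem sz_drop_le (l : List α) (n : ℕ) : sz (l.drop n) ≤ sz l := by
  induction l generalizing n with
  | nil => simp
  | cons b l ih =>
    cases n with
    | zero => simp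
    | succ n =>
      have := ih n
      rw [List.drop_succ_cons, sz_cons]
      omega

theorem PT.foldl_of_bound {l : γ → List α} {i : γ → σ} {F : γ × σ × α → σ} (hl : PT l) (hi : PT i)
    (hF : PT F) (q : Polynomial ℕ)
    (hq : ∀ c, ∀ l', l' <+: l c → sz (l'.foldl (fun s a => F (c, s, a)) (i c)) ≤ q.eval (sz c)) :
    PT (fun c => (l c).foldl (fun s a => F (c, s, a)) (i c)) := by
  let step : γ × List α × σ → γ × List α × σ := fun x =>
    List.casesOn (motive := fun _ => _) x.2.1 x fun a m => (x.1, m, F (x.1, x.2.2, a))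
  have hstep : PT step :=
    PT.listCases (l := fun x : γ × List α × σ => x.2.1) (f := fun x => x)
      (g := fun x : (γ × List α × σ) × α × List α =>
        (x.1.1, x.2.2, F (x.1.1, x.1.2.2, x.2.1))) (by fun_prop) (by fun_prop) (by fun_prop)
  have hiter : ∀ c l s j, step^[j] (c, l, s) =
      (c, l.drop j, (l.take j).foldl (fun s a => F (c, s, a)) s) := by
    intro c l s j
    induction j generalizing l s with
    | zero => simp
    | succ j ih =>
      rw [Function.iterate_succ_apply]
      cases l with
      | nil => simpa [step] using ih [] s
      | cons a l => simpa [step] using ih l (F (c, s, a))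
  obtain ⟨ql, hql⟩ := hl.exists_sz_le
  -- The number of rounds is the size of the list, not its length, which becomes computable only
  -- through folds. The surplus rounds do nothing, since `step` fixes states with an empty list.
  have := PT.iterate (n := fun c => sz (l c)) (i := fun c => (c, l c, i c)) hstep (by fun_prop)
    (by fun_prop) (2 + Polynomial.X + ql + q) (fun c j _ => by
      rw [hiter, sz_prod, sz_prod]
      have h1 := hq c ((l c).take j) (List.take_prefix _ _)
      have h2 := hql c
      have h3 := sz_drop_le (l c) j
      simp
      omega)
  have h2 : PT fun c => (step^[sz (l c)] (c, l c, i c)).2.2 := by fun_prop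
  convert h2 using 2 with c
  rw [hiter, List.take_of_length_le (length_le_sz _)]

omit [Rep α] in
theorem sz_foldl_le {F : σ → α → σ} (l : List α) (s : σ) (k : ℕ)
    (h : ∀ s, ∀ a ∈ l, sz (F s a) ≤ sz s + k) : sz (l.foldl F s) ≤ sz s + l.length * k := by
  induction l generalizing s with
  | nil => simp
  | cons a l ih =>
    have h1 := ih (F s a) fun s b hb => h s b (by simp [hb])
    have h2 := h s a (by simp)
    rw [List.foldl_cons, List.length_cons]
    nlinarith

/-- Folds with additive growth. -/
theorem PT.foldl {l : γ → List α} {i : γ → σ} {F : γ × σ × α → σ} (hl : PT l) (hi : PT i)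
    (hF : PT F) (q : Polynomial ℕ)
    (hq : ∀ c s, ∀ a ∈ l c, sz (F (c, s, a)) ≤ sz s + q.eval (sz c + sz a)) :
    PT (fun c => (l c).foldl (fun s a => F (c, s, a)) (i c)) := by
  obtain ⟨ql, hql⟩ := hl.exists_sz_le
  obtain ⟨qi, hqi⟩ := hi.exists_sz_le
  refine PT.foldl_of_bound hl hi hF (qi + ql * q.comp (Polynomial.X + ql)) fun c l' hl' => ?_
  have h1 := sz_foldl_le (F := fun s a => F (c, s, a)) l' (i c)
    (q.eval (sz c + ql.eval (sz c))) (fun s a ha => (hq c s a (hl'.subset ha)).trans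
      (Nat.add_le_add_left (eval_mono q (Nat.add_le_add_left
        ((sz_mem_le (hl'.subset ha)).trans (hql c)) _)) _))
  have h2 := (hl'.length_le.trans (length_le_sz _)).trans (hql c)
  have h3 := hqi c
  have h4 := Nat.mul_le_mul_right (q.eval (sz c + ql.eval (sz c))) h2
  simp
  omega

@[fun_prop]
theorem PT.reverse {l : γ → List α} (hl : PT l) : PT (fun c => (l c).reverse) := by
  have := PT.foldl (i := fun _ => ([] : List α)) (F := fun x : γ × List α × α => x.2.2 :: x.2.1) hl
    (by fun_prop) (by fun_prop) (1 + Polynomial.X) (fun c s a _ => by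
      simp [sz_cons]; omega)
  convert this using 2 with c
  simp

@[fun_prop]
theorem PT.append {l m : γ → List α} (hl : PT l) (hm : PT m) : PT (fun c => l c ++ m c) := by
  have := PT.foldl (l := fun c => (l c).reverse) (i := m)
    (F := fun x : γ × List α × α => x.2.2 :: x.2.1) (by fun_prop)
    hm (by fun_prop) (1 + Polynomial.X) (fun c s a _ => by
      simp [sz_cons]; omega)
  convert this using 2 with c
  simp

theorem sz_append_le (l m : List α) : sz (l ++ m) ≤ sz l + sz m := by
  induction l with
  | nil => simp
  | cons a l ih => rw [List.cons_append, sz_cons, sz_cons]; omega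

theorem PT.map {l : γ → List α} {F : γ × α → β} (hl : PT l) (hF : PT F) :
    PT (fun c => (l c).map fun a => F (c, a)) := by
  obtain ⟨q, hq⟩ := hF.exists_sz_le
  have := (PT.foldl (i := fun _ => ([] : List β))
    (F := fun x : γ × List β × α => F (x.1, x.2.2) :: x.2.1) hl
    (by fun_prop) (by fun_prop) (1 + q.comp (1 + Polynomial.X)) (fun c s a _ => by
      have := hq (c, a)
      rw [sz_prod, add_assoc] at this
      simp [sz_cons]; omega)).reverse
  convert this using 2 with c
  have h : ∀ (l : List α) (s : List β), l.foldl (fun s a => F (c, a) :: s) s =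
      (l.map fun a => F (c, a)).reverse ++ s := by
    intro l
    induction l with
    | nil => simp
    | cons a l ih => intro s; simp [ih]
  rw [h]
  simp

theorem PT.flatMap {l : γ → List α} {F : γ × α → List β} (hl : PT l) (hF : PT F) :
    PT (fun c => (l c).flatMap fun a => F (c, a)) := by
  obtain ⟨q, hq⟩ := hF.exists_sz_le
  have := (PT.foldl (i := fun _ => ([] : List β))
    (F := fun x : γ × List β × α => x.2.1 ++ F (x.1, x.2.2)) hl
    (by fun_prop) (by fun_prop) (1 + q.comp (1 + Polynomial.X)) (fun c s a _ => by
      have := hq (c, a)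
      have h := sz_append_le s (F (c, a))
      rw [sz_prod, add_assoc] at this
      simp; omega))
  convert this using 2 with c
  have h : ∀ (l : List α) (s : List β), l.foldl (fun s a => s ++ F (c, a)) s =
      s ++ (l.flatMap fun a => F (c, a)) := by
    intro l
    induction l with
    | nil => simp
    | cons a l ih => intro s; simp [ih]
  rw [h]
  simp

@[fun_prop]
theorem PT.length {l : γ → List α} (hl : PT l) : PT (fun c => (l c).length) := by
  have := PT.foldl (i := fun _ => 0) (F := fun x : γ × ℕ × α => x.2.1 + 1) hl
    (by fun_prop) (by fun_prop) 2 (fun c s a _ => by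
      simp [sz_nat]; omega)
  convert this using 2 with c
  have h : ∀ (l : List α) (n : ℕ), l.foldl (fun s _ => s + 1) n = n + l.length := by
    intro l
    induction l with
    | nil => simp
    | cons a l ih => intro s; simp [ih]; omega
  rw [h]
  simp

/-! ### Arithmetic -/

@[fun_prop]
theorem PT.add {m n : γ → ℕ} (hm : PT m) (hn : PT n) : PT (fun c => m c + n c) := by
  obtain ⟨q, hq⟩ := hn.exists_sz_le
  obtain ⟨q', hq'⟩ := hm.exists_sz_le
  have h : ∀ m j : ℕ, (fun k => k + 1)^[j] m = m + j := by
    intro m j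
    induction j with
    | zero => rfl
    | succ j ih => rw [Function.iterate_succ_apply', ih]; rfl
  have := PT.iterate (f := fun k : ℕ => k + 1) (by fun_prop) hn hm (q + q') (fun c j hj => by
    have h1 := hq c
    have h2 := hq' c
    rw [h, sz_nat]
    rw [sz_nat] at h1 h2
    simp
    omega)
  convert this using 2 with c
  rw [h]

@[fun_prop]
theorem PT.sub {m n : γ → ℕ} (hm : PT m) (hn : PT n) : PT (fun c => m c - n c) := by
  obtain ⟨q', hq'⟩ := hm.exists_sz_le
  have h : ∀ m j : ℕ, (fun k => k - 1)^[j] m = m - j := by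
    intro m j
    induction j with
    | zero => rfl
    | succ j ih => rw [Function.iterate_succ_apply', ih]; rfl
  have := PT.iterate (f := fun k : ℕ => k - 1) (by fun_prop) hn hm q' (fun c j hj => by
    have h2 := hq' c
    rw [h, sz_nat]
    rw [sz_nat] at h2
    omega)
  convert this using 2 with c
  rw [h]

@[fun_prop]
theorem PT.mul {m n : γ → ℕ} (hm : PT m) (hn : PT n) : PT (fun c => m c * n c) := by
  obtain ⟨q, hq⟩ := hn.exists_sz_le
  obtain ⟨q', hq'⟩ := hm.exists_sz_le
  have h : ∀ m k j : ℕ, (fun x : ℕ × ℕ => (x.1, x.2 + x.1))^[j] (m, k) = (m, k + m * j) := by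
    intro m k j
    induction j with
    | zero => rfl
    | succ j ih => rw [Function.iterate_succ_apply', ih]; simp; ring
  have := (PT.iterate (f := fun x : ℕ × ℕ => (x.1, x.2 + x.1)) (i := fun c => (m c, 0))
    (by fun_prop) hn (by fun_prop) (q' + 2 + 2 * q' * q) (fun c j hj => by
    have h1 := hq c
    have h2 := hq' c
    rw [h, sz_prod, sz_nat, sz_nat]
    rw [sz_nat] at h1 h2
    have h3 : m c * j ≤ q'.eval (sz c) * q.eval (sz c) := Nat.mul_le_mul (by omega) (by omega)
    simp
    nlinarith)).snd
  convert this using 2 with c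
  rw [h]
  simp

@[fun_prop]
theorem PT.polyEval (p : Polynomial ℕ) {n : γ → ℕ} (hn : PT n) : PT (fun c => p.eval (n c)) := by
  induction p using Polynomial.induction_on' with
  | add p q hp hq =>
    simp only [Polynomial.eval_add]
    fun_prop
  | monomial k a =>
    simp only [Polynomial.eval_monomial]
    have : PT fun c => n c ^ k := by
      induction k with
      | zero => simpa using PT.const 1
      | succ k ih => simp only [pow_succ]; fun_prop
    fun_prop

/-! ### Boolean functions and decisions -/

@[fun_prop]
theorem PT.not {b : γ → Bool} (hb : PT b) : PT (fun c => !b c) := by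
  have : PT fun c => if b c = true then false else true := by fun_prop
  convert this using 2 with c
  cases b c <;> rfl

@[fun_prop]
theorem PT.and {a b : γ → Bool} (ha : PT a) (hb : PT b) : PT (fun c => a c && b c) := by
  have : PT fun c => if a c = true then b c else false := by fun_prop
  convert this using 2 with c
  cases a c <;> rfl

@[fun_prop]
theorem PT.or {a b : γ → Bool} (ha : PT a) (hb : PT b) : PT (fun c => a c || b c) := by
  have : PT fun c => if a c = true then true else b c := by fun_prop
  convert this using 2 with c
  cases a c <;> rfl

@[fun_prop]
theorem PT.ite {p : γ → Prop} [h : ∀ c, Decidable (p c)] {f g : γ → β}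
    (hp : PT fun c => decide (p c)) (hf : PT f) (hg : PT g) :
    PT (fun c => if p c then f c else g c) := by
  have : PT fun c => if decide (p c) = true then f c else g c := by fun_prop
  simpa using this

@[fun_prop]
theorem PT.decide_bool {b : γ → Bool} {h : ∀ c, Decidable (b c = true)} (hb : PT b) :
    PT (fun c => decide (b c = true)) := by
  convert hb using 2 with c
  simp

/-- A leaf is the only tree whose code has one bit, so the test is whether the size minus one
vanishes. -/
theorem PT.isLeaf {f : γ → α} (hf : PT f) {d : γ → Bool}
    (h : ∀ c, d c = true ↔ Rep.rep (f c) = .leaf) : PT d := by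
  have h2 : PT fun c => sz (f c) - 1 := by fun_prop
  have := PT.natCases (f := fun _ => true) (g := fun _ => false) h2 (by fun_prop) (by fun_prop)
  convert this using 2 with c
  have h3 := h c
  have h4 : sz (f c) - 1 = 0 ↔ Rep.rep (f c) = .leaf := by
    rw [sz, code]
    cases Rep.rep (f c) with
    | leaf => simp [Sexp.enc]
    | node a b =>
      have := a.enc_length_pos
      simp only [Sexp.enc, List.length_cons, List.length_append, reduceCtorEq, iff_false]
      omega
  rw [← h4] at h3
  cases h5 : d c <;> cases h6 : sz (f c) - 1 <;> simp_all

@[fun_prop]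
theorem PT.decide_nil {l : γ → List α} {h : ∀ c, Decidable (l c = [])} (hl : PT l) :
    PT (fun c => decide (l c = [])) :=
  PT.isLeaf hl fun c => by
    rw [decide_eq_true_iff]
    cases l c <;> simp [Rep.rep, listRep]

@[fun_prop]
theorem PT.decide_zero {n : γ → ℕ} {h : ∀ c, Decidable (n c = 0)} (hn : PT n) :
    PT (fun c => decide (n c = 0)) :=
  PT.isLeaf hn fun c => by
    rw [decide_eq_true_iff]
    cases n c <;> simp [Rep.rep, natRep]

@[fun_prop]
theorem PT.decide_le {m n : γ → ℕ} {h : ∀ c, Decidable (m c ≤ n c)} (hm : PT m) (hn : PT n) :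
    PT (fun c => decide (m c ≤ n c)) := by
  have : PT fun c => decide (m c - n c = 0) := by fun_prop
  convert this using 2 with c
  simp [Nat.sub_eq_zero_iff_le]

@[fun_prop]
theorem PT.decide_lt {m n : γ → ℕ} {h : ∀ c, Decidable (m c < n c)} (hm : PT m) (hn : PT n) :
    PT (fun c => decide (m c < n c)) := by
  have : PT fun c => decide (m c + 1 ≤ n c) := by fun_prop
  convert this using 2 with c
  rw [decide_eq_decide, Nat.lt_iff_add_one_le]

/-- Equality of bits. -/
theorem PT.beqBool : PT fun x : Bool × Bool => x.1 == x.2 := by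
  have : PT fun x : Bool × Bool => if x.1 then x.2 else !x.2 := by fun_prop
  convert this using 2 with x
  obtain ⟨a, b⟩ := x
  cases a <;> cases b <;> rfl

/-- Equality of lists of bits. -/
theorem PT.beqBits : PT fun x : List Bool × List Bool => decide (x.1 = x.2) := by
  have h1 := PT.beqBool
  have := PT.foldl (γ := List Bool × List Bool) (l := fun x => x.1) (i := fun x => (x.2, true))
    (F := fun x : (List Bool × List Bool) × (List Bool × Bool) × Bool =>
      (x.2.1.1.tail, x.2.1.2 && (!(decide (x.2.1.1 = [])) && (x.2.1.1.headD false == x.2.2))))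
    (by fun_prop) (by fun_prop)
    (PT.prodMk (by fun_prop) (PT.and (by fun_prop) (PT.and (by fun_prop)
      (PT.comp (f := fun x : Bool × Bool => x.1 == x.2)
        (g := fun x : (List Bool × List Bool) × (List Bool × Bool) × Bool =>
          (x.2.1.1.headD false, x.2.2)) h1 (by fun_prop))))) 4 (fun c s a _ => by
      rw [sz_prod, sz_prod]
      have h2 := sz_drop_le s.1 1
      have h3 : ∀ b : Bool, sz b ≤ 3 := by intro b; cases b <;> simp [sz, code, Rep.rep, Sexp.enc]
      have h4 := h3 (s.2 && (!(decide (s.1 = [])) && (s.1.headD false == a)))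
      simp only [List.drop_one] at h2
      simp only [Polynomial.eval_ofNat]
      omega)
  have h2 := PT.and this.snd (PT.decide_nil (h := fun _ => inferInstance) this.fst)
  convert h2 using 2 with x
  obtain ⟨l, m⟩ := x
  simp only
  suffices ∀ (l m : List Bool) (b : Bool), (b && decide (l = m)) =
      ((List.foldl (fun (s : List Bool × Bool) a =>
        (s.1.tail, s.2 && (!(decide (s.1 = [])) && (s.1.headD false == a)))) (m, b) l).2 &&
      decide ((List.foldl (fun (s : List Bool × Bool) a =>
        (s.1.tail, s.2 && (!(decide (s.1 = [])) && (s.1.headD false == a)))) (m, b) l).1 = [])) by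
    simpa using this l m true
  intro l
  induction l with
  | nil => intro m b; cases m <;> simp
  | cons a l ih =>
    intro m b
    rw [List.foldl_cons, ← ih]
    cases m with
    | nil => simp
    | cons a' m =>
      rw [Bool.eq_iff_iff]
      cases a <;> cases a' <;> simp <;> exact fun _ => decide_eq_true_iff.symm

-- Codes are injective, so equality on any represented type reduces to equality of bit strings.
@[fun_prop]
theorem PT.decide_eq {f g : γ → α} {h : ∀ c, Decidable (f c = g c)} (hf : PT f) (hg : PT g) :
    PT (fun c => decide (f c = g c)) := by
  have : PT fun c => decide (code (f c) = code (g c)) :=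
    PT.beqBits.comp (g := fun c => (code (f c), code (g c))) (by fun_prop)
  convert this using 2 with c
  rw [decide_eq_decide]
  exact ⟨fun h => by rw [h], fun h => Rep.inj (Sexp.enc_injective h)⟩

theorem PT.all {l : γ → List α} {F : γ × α → Bool} (hl : PT l) (hF : PT F) :
    PT (fun c => (l c).all fun a => F (c, a)) := by
  have h := PT.map hl (PT.not hF)
  -- The state of the fold is a list of units that stays empty as long as no element fails.
  have h2 : PT fun c => decide (((l c).map fun a => !F (c, a)).foldl
      (fun s a => if a = true then [()] else s) [] = []) := by
    refine PT.decide_nil (PT.foldl (F := fun x : γ × List Unit × Bool =>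
      if x.2.2 = true then [()] else x.2.1) h (PT.const []) (by fun_prop) 3 (fun c s a _ => ?_))
    have := sz_pos s
    split <;> simp [sz_cons, sz_nil, show sz () = 1 from rfl]
  convert h2 using 2 with c
  have h3 : ∀ (l : List α) (s : List Unit), decide ((l.map fun a => !F (c, a)).foldl
      (fun s a => if a = true then [()] else s) s = []) =
      ((l.all fun a => F (c, a)) && decide (s = [])) := by
    intro l
    induction l with
    | nil => simp
    | cons a l ih =>
      intro s
      rw [List.map_cons, List.foldl_cons, ih]
      cases h4 : F (c, a) <;> simp [h4]
  rw [h3]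
  simp

/-! ### More list functions -/

@[fun_prop]
theorem PT.drop {l : γ → List α} {n : γ → ℕ} (hl : PT l) (hn : PT n) :
    PT (fun c => (l c).drop (n c)) := by
  obtain ⟨q, hq⟩ := hl.exists_sz_le
  have h : ∀ (l : List α) (j : ℕ), (fun m : List α => m.tail)^[j] l = l.drop j := by
    intro l j
    induction j with
    | zero => rfl
    | succ j ih => rw [Function.iterate_succ_apply', ih]; simp
  have := PT.iterate (f := fun m : List α => m.tail) (by fun_prop) hn hl q (fun c j hj => by
    rw [h]
    exact (sz_drop_le _ _).trans (hq c))
  convert this using 2 with c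
  rw [h]

theorem sz_reverse (l : List α) : sz l.reverse = sz l := by
  have h : ∀ l m : List α, sz (l ++ m) + 1 = sz l + sz m := by
    intro l
    induction l with
    | nil => intro m; simp [sz_nil]; omega
    | cons a l ih => intro m; have := ih m; rw [List.cons_append, sz_cons, sz_cons]; omega
  induction l with
  | nil => rfl
  | cons a l ih =>
    have := h l.reverse [a]
    rw [sz_cons, sz_nil] at this
    rw [List.reverse_cons, sz_cons]
    omega

@[fun_prop]
theorem PT.take {l : γ → List α} {n : γ → ℕ} (hl : PT l) (hn : PT n) :
    PT (fun c => (l c).take (n c)) := by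
  have : PT fun c => ((l c).reverse.drop ((l c).length - n c)).reverse := by fun_prop
  convert this using 2 with c
  rw [List.drop_reverse]
  simp only [List.reverse_reverse]
  by_cases h : n c ≤ (l c).length
  · congr 1
    omega
  · rw [List.take_of_length_le (by omega), List.take_of_length_le (by omega)]

@[fun_prop]
theorem PT.getD {l : γ → List α} {n : γ → ℕ} {d : γ → α} (hl : PT l) (hn : PT n) (hd : PT d) :
    PT (fun c => (l c).getD (n c) (d c)) := by
  have : PT fun c => ((l c).drop (n c)).headD (d c) := by fun_prop
  convert this using 2 with c
  simp [List.getD_eq_getElem?_getD, List.headD_eq_head?_getD]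

@[fun_prop]
theorem PT.replicate {n : γ → ℕ} {a : γ → α} (hn : PT n) (ha : PT a) :
    PT (fun c => List.replicate (n c) (a c)) := by
  obtain ⟨q, hq⟩ := hn.exists_sz_le
  obtain ⟨q', hq'⟩ := ha.exists_sz_le
  have h : ∀ (a : α) (j : ℕ), (fun x : α × List α => (x.1, x.1 :: x.2))^[j] (a, []) =
      (a, List.replicate j a) := by
    intro l j
    induction j with
    | zero => rfl
    | succ j ih => rw [Function.iterate_succ_apply', ih]; simp [List.replicate_succ]
  have h' : ∀ (a : α) (j : ℕ), sz (List.replicate j a) = 1 + j * (sz a + 1) := by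
    intro a j
    induction j with
    | zero => simp [sz_nil]
    | succ j ih => rw [List.replicate_succ, sz_cons, ih]; ring
  have := (PT.iterate (f := fun x : α × List α => (x.1, x.1 :: x.2)) (i := fun c => (a c, []))
    (by fun_prop) hn (by fun_prop) (q' + 2 + q * (q' + 1)) (fun c j hj => by
    have h1 := hq c
    have h2 := hq' c
    rw [h, sz_prod, h']
    rw [sz_nat] at h1
    have h3 : j * (sz (a c) + 1) ≤ q.eval (sz c) * (q'.eval (sz c) + 1) :=
      Nat.mul_le_mul (by omega) (by omega)
    simp
    omega)).snd
  convert this using 2 with c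
  rw [h]

@[fun_prop]
theorem PT.range {n : γ → ℕ} (hn : PT n) : PT (fun c => List.range (n c)) := by
  have := PT.foldl (l := fun c => List.replicate (n c) ()) (i := fun _ => ([] : List ℕ))
    (F := fun x : γ × List ℕ × Unit => x.2.1.length :: x.2.1) (by fun_prop) (by fun_prop)
    (by fun_prop)
  obtain ⟨q, hq⟩ := hn.exists_sz_le
  have h : ∀ j : ℕ, (List.replicate j ()).foldl (fun s _ => s.length :: s) [] =
      (List.range j).reverse := by
    intro j
    induction j with
    | zero => rfl
    | succ j ih => rw [List.replicate_succ', List.foldl_append, ih, List.range_succ]; simp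
  have h' : ∀ j : ℕ, sz (List.range j) ≤ 1 + j * (2 * j + 2) := by
    intro j
    induction j with
    | zero => simp [sz_nil]
    | succ j ih =>
      have := sz_append_le (List.range j) [j]
      rw [sz_cons, sz_nil, sz_nat] at this
      rw [List.range_succ]
      nlinarith
  have := (PT.foldl_of_bound (l := fun c => List.replicate (n c) ()) (i := fun _ => ([] : List ℕ))
    (F := fun x : γ × List ℕ × Unit => x.2.1.length :: x.2.1) (by fun_prop) (by fun_prop)
    (by fun_prop) (1 + q * (2 * q + 2)) (fun c l' hl' => by
      obtain ⟨k, hk⟩ : ∃ k, l' = List.replicate k () := ⟨l'.length, by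
        exact List.eq_replicate_iff.2 ⟨rfl, fun _ _ => rfl⟩⟩
      have h1 : k ≤ n c := by simpa [hk] using hl'.length_le
      have h2 := hq c
      rw [sz_nat] at h2
      rw [hk]
      simp only
      rw [h, sz_reverse]
      refine (h' k).trans ?_
      have h3 : k * (2 * k + 2) ≤ q.eval (sz c) * (2 * q.eval (sz c) + 2) :=
        Nat.mul_le_mul (by omega) (by omega)
      simpa using h3)).reverse
  convert this using 2 with c
  simp [h]

end TotalSearch

/-! ### Circuits as data: parsing, evaluation, and checking of Sink-of-DAG solutions. -/

namespace TotalSearch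

variable {α β γ δ ε σ : Type} [Rep α] [Rep β] [Rep γ] [Rep δ] [Rep ε] [Rep σ]

/-! ## Circuits as data -/

/-- Gates as pairs of a tag and a list of wires. -/
def Gate.data : Gate → ℕ × List ℕ
  | .const false => (0, [])
  | .const true => (1, [])
  | .nand i j => (2, [i, j])
  | .oracle ins => (3, ins)

theorem Gate.data_injective : Function.Injective Gate.data := by
  intro g h e
  rcases g with (_ | _) | ⟨i, j⟩ | ins <;> rcases h with (_ | _) | ⟨i', j'⟩ | ins' <;>
    simp_all [Gate.data]

instance : Rep Gate := ⟨fun g => Rep.rep g.data, fun _ _ h => Gate.data_injective (Rep.inj h)⟩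

instance : Rep Circuit :=
  ⟨fun C => Rep.rep (C.inputs, C.gates, C.outputs), fun C D h => by
    have := Rep.inj h
    cases C
    cases D
    simp_all⟩

@[fun_prop]
theorem PT.gateData {g : γ → Gate} (hg : PT g) : PT (fun c => (g c).data) :=
  hg.congr_rep fun _ => rfl

@[fun_prop]
theorem PT.gateNand {i j : γ → ℕ} (hi : PT i) (hj : PT j) : PT (fun c => Gate.nand (i c) (j c)) :=
  PT.congr_rep (f := fun c => (2, [i c, j c])) (by fun_prop) fun _ => rfl

@[fun_prop]
theorem PT.gateOracle {l : γ → List ℕ} (hl : PT l) : PT (fun c => Gate.oracle (l c)) :=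
  PT.congr_rep (f := fun c => (3, l c)) (by fun_prop) fun _ => rfl

@[fun_prop]
theorem PT.circuitMk {n : γ → ℕ} {gs : γ → List Gate} {os : γ → List ℕ} (hn : PT n) (hg : PT gs)
    (ho : PT os) : PT (fun c => Circuit.mk (n c) (gs c) (os c)) :=
  PT.congr_rep (f := fun c => (n c, gs c, os c)) (by fun_prop) fun _ => rfl

theorem PT.circuitData : PT fun C : Circuit => (C.inputs, C.gates, C.outputs) :=
  PT.of_rep_eq fun _ => rfl

@[fun_prop]
theorem PT.inputs {C : γ → Circuit} (hC : PT C) : PT (fun c => (C c).inputs) :=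
  (PT.circuitData.comp hC).fst

@[fun_prop]
theorem PT.gates {C : γ → Circuit} (hC : PT C) : PT (fun c => (C c).gates) :=
  (PT.circuitData.comp hC).snd.fst

@[fun_prop]
theorem PT.outputs {C : γ → Circuit} (hC : PT C) : PT (fun c => (C c).outputs) :=
  (PT.circuitData.comp hC).snd.snd

@[fun_prop]
theorem PT.natCode {n : γ → ℕ} (hn : PT n) : PT (fun c => natCode (n c)) := by
  unfold TotalSearch.natCode
  fun_prop

theorem PT.listCode {e : α → List Bool} (he : PT e) {l : γ → List α} (hl : PT l) :
    PT (fun c => listCode e (l c)) :=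
  PT.append (by fun_prop) (PT.flatMap (F := fun x : γ × α => e x.2) hl (by fun_prop))

theorem Gate.encode_eq (g : Gate) : g.encode = TotalSearch.natCode g.data.1 ++
    (if g.data.1 = 3 then listCode TotalSearch.natCode g.data.2
      else g.data.2.flatMap TotalSearch.natCode) := by
  rcases g with (_ | _) | ⟨i, j⟩ | ins <;> simp [Gate.encode, Gate.data]

@[fun_prop]
theorem PT.gateEncode {g : γ → Gate} (hg : PT g) : PT (fun c => (g c).encode) := by
  simp only [Gate.encode_eq]
  have h1 : PT fun c => TotalSearch.listCode TotalSearch.natCode (g c).data.2 :=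
    PT.listCode (by fun_prop) (by fun_prop)
  have h2 : PT fun c => (g c).data.2.flatMap TotalSearch.natCode :=
    PT.flatMap (F := fun x : γ × ℕ => TotalSearch.natCode x.2) (by fun_prop) (by fun_prop)
  fun_prop

@[fun_prop]
theorem PT.circuitEncode {C : γ → Circuit} (hC : PT C) : PT (fun c => (C c).encode) := by
  unfold Circuit.encode
  have h1 : PT fun c => TotalSearch.listCode TotalSearch.natCode (C c).outputs :=
    PT.listCode (by fun_prop) (by fun_prop)
  have h2 : PT fun c => TotalSearch.listCode Gate.encode (C c).gates :=
    PT.listCode (by fun_prop) (by fun_prop)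
  fun_prop

/-! ### Parsing -/

/-- The numbers in a concatenation of codes of numbers. -/
def tokens (l : List Bool) : List ℕ :=
  (l.foldl (fun (s : ℕ × List ℕ) b => if b = true then (s.1 + 1, s.2) else (0, s.1 :: s.2))
    (0, [])).2.reverse

theorem foldl_natCode (n m : ℕ) (acc : List ℕ) :
    (natCode n).foldl (fun (s : ℕ × List ℕ) b => if b = true then (s.1 + 1, s.2) else (0, s.1 :: s.2))
      (m, acc) = (0, (m + n) :: acc) := by
  induction n generalizing m with
  | zero => simp [natCode]
  | succ n ih =>
    have := ih (m + 1)
    simp only [natCode, List.replicate_succ, List.cons_append, List.foldl_cons] at this ⊢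
    simp only [if_true, this]
    congr 2
    omega

theorem tokens_flatMap (l : List ℕ) : tokens (l.flatMap natCode) = l := by
  have : ∀ (l acc : List ℕ), (l.flatMap natCode).foldl
      (fun (s : ℕ × List ℕ) b => if b = true then (s.1 + 1, s.2) else (0, s.1 :: s.2)) (0, acc) =
      (0, l.reverse ++ acc) := by
    intro l
    induction l with
    | nil => simp
    | cons n l ih => intro acc; rw [List.flatMap_cons, List.foldl_append, foldl_natCode, ih]; simp
  rw [tokens, this]
  simp

@[fun_prop]
theorem PT.tokens {l : γ → List Bool} (hl : PT l) : PT (fun c => tokens (l c)) := by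
  refine PT.comp (f := TotalSearch.tokens) ?_ hl
  have := (PT.foldl (l := fun l : List Bool => l) (i := fun _ => ((0, []) : ℕ × List ℕ))
    (F := fun x : List Bool × (ℕ × List ℕ) × Bool =>
      if x.2.2 = true then (x.2.1.1 + 1, x.2.1.2) else (0, x.2.1.1 :: x.2.1.2))
    (by fun_prop) (by fun_prop) (by fun_prop) 4 (fun c s a _ => by
      obtain ⟨s, t⟩ := s
      cases a <;> simp [sz_prod, sz_nat, sz_cons] <;> omega)).snd.reverse
  exact this

/-- The numbers that describe a gate. -/
def Gate.tokens : Gate → List ℕ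
  | .const false => [0]
  | .const true => [1]
  | .nand i j => [2, i, j]
  | .oracle ins => 3 :: ins.length :: ins

theorem Gate.encode_eq_tokens (g : Gate) : g.encode = g.tokens.flatMap natCode := by
  rcases g with (_ | _) | ⟨i, j⟩ | ins <;> simp [Gate.encode, Gate.tokens, listCode]

/-- The description of a circuit is a flat sequence of unary numbers. Reading it thus splits into
cutting at the zeros (`tokens`) and grouping the numbers, whose grouping is determined by tags and
length prefixes. -/
theorem Circuit.encode_eq_tokens (C : Circuit) : C.encode =
    (C.inputs :: C.gates.length :: (C.gates.flatMap Gate.tokens ++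
      C.outputs.length :: C.outputs)).flatMap natCode := by
  have : C.gates.flatMap Gate.encode = (C.gates.flatMap Gate.tokens).flatMap natCode := by
    rw [List.flatMap_assoc]
    congr 1
    funext g
    exact g.encode_eq_tokens
  simp [Circuit.encode, listCode, this]

/-- Reads a gate from a list of numbers. -/
def parseGate (s : List ℕ × List Gate) : List ℕ × List Gate :=
  if s.1.headD 0 = 0 then (s.1.drop 1, .const false :: s.2)
  else if s.1.headD 0 = 1 then (s.1.drop 1, .const true :: s.2)
  else if s.1.headD 0 = 2 then (s.1.drop 3, .nand (s.1.getD 1 0) (s.1.getD 2 0) :: s.2)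
  else (s.1.drop (2 + s.1.getD 1 0), .oracle ((s.1.drop 2).take (s.1.getD 1 0)) :: s.2)

theorem parseGate_tokens (g : Gate) (l : List ℕ) (acc : List Gate) :
    parseGate (g.tokens ++ l, acc) = (l, g :: acc) := by
  rcases g with (_ | _) | ⟨i, j⟩ | ins <;> simp [Gate.tokens, parseGate, Nat.add_comm 2]

theorem parseGate_iterate (gs : List Gate) (l : List ℕ) (acc : List Gate) :
    parseGate^[gs.length] (gs.flatMap Gate.tokens ++ l, acc) = (l, gs.reverse ++ acc) := by
  induction gs generalizing acc with
  | nil => simp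
  | cons g gs ih =>
    rw [List.length_cons, Function.iterate_succ_apply, List.flatMap_cons, List.append_assoc,
      parseGate_tokens, ih]
    simp

theorem sz_take_le (l : List α) (n : ℕ) : sz (l.take n) ≤ sz l := by
  induction l generalizing n with
  | nil => simp
  | cons b l ih =>
    cases n with
    | zero => simp [sz_nil, sz_cons]; omega
    | succ n =>
      have := ih n
      rw [List.take_succ_cons, sz_cons, sz_cons]
      omega

theorem sz_gate (g : Gate) : sz g = 1 + sz g.data.1 + sz g.data.2 := sz_prod g.data.1 g.data.2

theorem sz_getD_le (l : List ℕ) (n : ℕ) : sz (l.getD n 0) ≤ sz l := by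
  by_cases h : n < l.length
  · rw [List.getD_eq_getElem _ _ h]
    exact sz_mem_le (List.getElem_mem h)
  · rw [List.getD_eq_default _ _ (by omega), sz_nat]
    exact sz_pos l

/-- The list of tokens never grows, so each gate adds an amount bounded in terms of the original
tokens, and iteration stays polynomial. -/
theorem sz_parseGate (s : List ℕ × List Gate) : sz (parseGate s).1 ≤ sz s.1 ∧
    sz (parseGate s).2 ≤ sz s.2 + (2 * sz s.1 + 20) := by
  obtain ⟨l, acc⟩ := s
  unfold parseGate
  have h1 := sz_drop_le l
  have h2 := sz_getD_le l 1
  have h3 := sz_getD_le l 2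
  have h4 := (sz_take_le (l.drop 2) (l.getD 1 0)).trans (h1 2)
  split_ifs
  all_goals
    refine ⟨h1 _, ?_⟩
    simp only [sz_cons, sz_gate, Gate.data, sz_nat, sz_nil] at *
    omega

@[fun_prop]
theorem PT.parseGates {n : γ → ℕ} {s : γ → List ℕ × List Gate} (hn : PT n) (hs : PT s) :
    PT (fun c => parseGate^[n c] (s c)) := by
  obtain ⟨q, hq⟩ := hs.exists_sz_le
  obtain ⟨q', hq'⟩ := hn.exists_sz_le
  refine PT.iterate (by unfold parseGate; fun_prop) hn hs (q + q + 1 + q' * (2 * q + 20))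
    fun c j hj => ?_
  have h : ∀ j, sz (parseGate^[j] (s c)).1 ≤ sz (s c).1 ∧
      sz (parseGate^[j] (s c)).2 ≤ sz (s c).2 + j * (2 * sz (s c).1 + 20) := by
    intro j
    induction j with
    | zero => simp
    | succ j ih =>
      rw [Function.iterate_succ_apply']
      have := sz_parseGate (parseGate^[j] (s c))
      constructor
      · omega
      · rw [add_mul]
        omega
  have h1 : sz (parseGate^[j] (s c)) = _ := sz_prod _ _
  have h2 : sz (s c) = _ := sz_prod _ _
  have h3 := h j
  have h4 := hq c
  have h5 := hq' c
  rw [sz_nat] at h5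
  have h6 : j * (2 * sz (s c).1 + 20) ≤ q'.eval (sz c) * (2 * q.eval (sz c) + 20) :=
    Nat.mul_le_mul (by omega) (by omega)
  simp
  omega

/-- Reads a circuit from its description; a string that is no description gives some circuit. -/
def parseCircuit (u : List Bool) : Circuit :=
  ⟨(tokens u).headD 0, (parseGate^[(tokens u).getD 1 0] ((tokens u).drop 2, [])).2.reverse,
    (parseGate^[(tokens u).getD 1 0] ((tokens u).drop 2, [])).1.tail⟩

theorem parseCircuit_encode (C : Circuit) : parseCircuit C.encode = C := by
  have h := parseGate_iterate C.gates (C.outputs.length :: C.outputs) []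
  rw [parseCircuit, Circuit.encode_eq_tokens C, tokens_flatMap]
  simp [h]

@[fun_prop]
theorem PT.parseCircuit {u : γ → List Bool} (hu : PT u) : PT (fun c => parseCircuit (u c)) := by
  unfold TotalSearch.parseCircuit
  fun_prop

/-- The parser returns some circuit on every string; encoding the result again exposes the strings
that describe none. -/
theorem exists_encode_iff (u : List Bool) (p : Circuit → Prop) :
    (∃ C : Circuit, p C ∧ u = C.encode) ↔ (parseCircuit u).encode = u ∧ p (parseCircuit u) := by
  constructor
  · rintro ⟨C, hC, rfl⟩
    rw [parseCircuit_encode]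
    exact ⟨rfl, hC⟩
  · rintro ⟨h1, h2⟩
    exact ⟨_, h2, h1.symm⟩

/-! ### Evaluation -/

/-- One gate of `runGates`. -/
def gateStep (s : List Bool × List Bool × List (List Bool × List Bool)) (g : Gate) :
    List Bool × List Bool × List (List Bool × List Bool) :=
  if g.data.1 = 0 then (s.1 ++ [false], s.2)
  else if g.data.1 = 1 then (s.1 ++ [true], s.2)
  else if g.data.1 = 2 then
    (s.1 ++ [!(s.1.getD (g.data.2.getD 0 0) false && s.1.getD (g.data.2.getD 1 0) false)], s.2)
  else (s.1 ++ s.2.1.take g.data.2.length, s.2.1.drop g.data.2.length, s.2.2 ++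
    [(g.data.2.map fun i => s.1.getD i false, s.2.1.take g.data.2.length)])

/-- The recursion `runGates` as a left fold with the trace as accumulator. Answer length equals
query length here because `sinkOfDAGBound` is the identity polynomial. -/
theorem foldl_gateStep (gs : List Gate) (vals w : List Bool) (tr : List (List Bool × List Bool)) :
    (gs.foldl gateStep (vals, w, tr)).1 = (runGates (fun k => k) gs vals w).1 ∧
    (gs.foldl gateStep (vals, w, tr)).2.2 = tr ++ (runGates (fun k => k) gs vals w).2 := by
  induction gs generalizing vals w tr with
  | nil => simp [runGates]
  | cons g gs ih =>
    rw [List.foldl_cons]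
    rcases g with (_ | _) | ⟨i, j⟩ | ins
    · simpa [gateStep, Gate.data, runGates] using ih _ _ _
    · simpa [gateStep, Gate.data, runGates] using ih _ _ _
    · simpa [gateStep, Gate.data, runGates, wire] using ih _ _ _
    · have := ih (vals ++ w.take ins.length) (w.drop ins.length)
        (tr ++ [(ins.map (wire vals), w.take ins.length)])
      rw [List.append_assoc] at this
      exact this

theorem PT.mapGetD {l : γ → List Bool} {is : γ → List ℕ} (hl : PT l) (hi : PT is) :
    PT (fun c => (is c).map fun i => (l c).getD i false) :=
  PT.map (F := fun x : γ × ℕ => (l x.1).getD x.2 false) hi (by fun_prop)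

theorem PT.gateStep : PT fun x : (List Bool × List Bool × List (List Bool × List Bool)) × Gate =>
    gateStep x.1 x.2 := by
  unfold TotalSearch.gateStep
  have h : PT fun x : (List Bool × List Bool × List (List Bool × List Bool)) × Gate =>
    x.2.data.2.map fun i => x.1.1.getD i false := PT.mapGetD (by fun_prop) (by fun_prop)
  fun_prop

theorem sz_gateStep (s : List Bool × List Bool × List (List Bool × List Bool)) (g : Gate) :
    sz (gateStep s g) ≤ sz s + 20 * sz g := by
  obtain ⟨v, w, tr⟩ := s
  have h1 := length_le_sz g.data.2
  have h2 := sz_gate g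
  unfold gateStep
  have h3 := sz_pos g
  have h4 : ∀ b : Bool, sz b ≤ 3 := by intro b; cases b <;> simp [sz, code, Rep.rep, Sexp.enc]
  have h5 : ∀ b : Bool, sz (v ++ [b]) ≤ sz v + 5 := by
    intro b
    have := sz_append_le v [b]
    rw [sz_cons, sz_nil] at this
    have := h4 b
    omega
  have h6 := h5 false
  have h7 := h5 true
  have h8 := h5 (!(v.getD (g.data.2.getD 0 0) false && v.getD (g.data.2.getD 1 0) false))
  split_ifs
  · simp only [sz_prod]; omega
  · simp only [sz_prod]; omega
  · simp only [sz_prod]; omega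
  · have h9 := sz_append_le v (w.take g.data.2.length)
    have h10 := sz_drop_le w g.data.2.length
    have h11 := sz_bits_le (w.take g.data.2.length)
    have h12 := sz_bits_le (g.data.2.map fun i => v.getD i false)
    have h13 : (w.take g.data.2.length).length ≤ g.data.2.length := List.length_take_le _ _
    rw [List.length_map] at h12
    have h14 := sz_append_le tr [(g.data.2.map fun i => v.getD i false, w.take g.data.2.length)]
    rw [sz_cons, sz_nil] at h14
    simp only [sz_prod] at *
    omega

/-- Evaluation of a circuit whose oracle gates have as many output bits as input bits. -/
theorem PT.run {C : γ → Circuit} {x w : γ → List Bool} (hC : PT C) (hx : PT x) (hw : PT w) :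
    PT (fun c => (C c).run (fun k => k) (x c) (w c)) := by
  have h := PT.foldl (l := fun c => (C c).gates)
    (i := fun c => (x c, w c, ([] : List (List Bool × List Bool))))
    (F := fun y : γ × (List Bool × List Bool × List (List Bool × List Bool)) × Gate =>
      TotalSearch.gateStep y.2.1 y.2.2) (by fun_prop) (by fun_prop)
    (PT.gateStep.comp (g := fun y : γ × (List Bool × List Bool × List (List Bool × List Bool)) × Gate
      => y.2) (by fun_prop)) (20 * Polynomial.X) (fun c s a _ => by
      have := sz_gateStep s a
      simp
      omega)
  have h2 : PT fun c => _ := PT.prodMk (PT.mapGetD h.fst (PT.outputs hC)) h.snd.snd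
  convert h2 using 2 with c
  have := foldl_gateStep (C c).gates (x c) (w c) []
  simp only [Circuit.run]
  rw [this.1, this.2]
  rfl

@[fun_prop]
theorem PT.run_fst {C : γ → Circuit} {x w : γ → List Bool} (hC : PT C) (hx : PT x) (hw : PT w) :
    PT (fun c => ((C c).run (fun k => k) (x c) (w c)).1) := (PT.run hC hx hw).fst

@[fun_prop]
theorem PT.run_snd {C : γ → Circuit} {x w : γ → List Bool} (hC : PT C) (hx : PT x) (hw : PT w) :
    PT (fun c => ((C c).run (fun k => k) (x c) (w c)).2) := (PT.run hC hx hw).snd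

theorem runGates_plain (p p' : ℕ → ℕ) (gs : List Gate) (h : ∀ g ∈ gs, g.Plain)
    (vals w w' : List Bool) : runGates p gs vals w = runGates p' gs vals w' := by
  induction gs generalizing vals with
  | nil => rfl
  | cons g gs ih =>
    have h1 := ih fun g hg => h g (by simp [hg])
    have h2 := h g (by simp)
    cases g with
    | const c => exact h1 _
    | nand i j => exact h1 _
    | oracle ins => exact absurd h2 id

theorem Circuit.Plain.run_eq {C : Circuit} (h : C.Plain) (p : ℕ → ℕ) (x w : List Bool) :
    (C.run p x w).1 = C.eval x := by
  simp only [Circuit.run, Circuit.eval]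
  rw [runGates_plain p (fun _ => 0) _ h x w []]

theorem Gate.plain_iff (g : Gate) : g.Plain ↔ g.data.1 ≠ 3 := by
  rcases g with (_ | _) | ⟨i, j⟩ | ins <;> simp [Gate.data, Gate.Plain]

/-- Decision whether a string encodes an instance of Sink-of-DAG. -/
def isInstance (u : List Bool) : Bool :=
  decide ((parseCircuit u).encode = u) && (((parseCircuit u).gates.all fun g => !decide (g.data.1 = 3))
    && decide ((parseCircuit u).outputs.length = 2 * (parseCircuit u).inputs))

@[fun_prop]
theorem PT.isInstance {u : γ → List Bool} (hu : PT u) : PT fun c => isInstance (u c) := by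
  unfold TotalSearch.isInstance
  have : PT fun c => (TotalSearch.parseCircuit (u c)).gates.all fun g => !decide (g.data.1 = 3) :=
    PT.all (F := fun x : γ × Gate => !decide (x.2.data.1 = 3)) (by fun_prop) (by fun_prop)
  fun_prop

theorem isInstance_iff (u : List Bool) : isInstance u = true ↔
    ∃ C : Circuit, (C.Plain ∧ C.outputs.length = 2 * C.inputs) ∧ u = C.encode := by
  rw [exists_encode_iff]
  simp [isInstance, Circuit.Plain, Gate.plain_iff]

/-! ### Comparison of binary numbers -/

/-- One bit of the comparison of two binary numbers. -/
def compareStep (s : List Bool × Bool × Bool) (a : Bool) : List Bool × Bool × Bool :=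
  (s.1.tail, s.2.1 || (!s.2.2 && (!a && s.1.headD false)),
    s.2.2 || (!s.2.1 && (a && !(s.1.headD false))))

/-- Comparison of binary numbers with equally many digits. -/
def leBits (l m : List Bool) : Bool := !(l.foldl compareStep (m, false, false)).2.2

/-- Digits arrive from the most significant one on. The flags `s` and `t` record which of the
prefixes, with values `A` and `B`, is smaller; the first difference decides, since $A<B$ gives
$2A+a<2B+b$ for all digits $a,b$. -/
theorem foldl_compareStep (l m : List Bool) (h : l.length = m.length) (A B : ℕ) (s t : Bool)
    (hs : s = true ↔ A < B) (ht : t = true ↔ B < A) :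
    (l.foldl compareStep (m, s, t)).2.2 = true ↔
      m.foldl (fun a c => 2 * a + c.toNat) B < l.foldl (fun a c => 2 * a + c.toNat) A := by
  induction l generalizing m A B s t with
  | nil =>
    cases m with
    | nil => simpa using ht
    | cons b m => simp at h
  | cons a l ih =>
    cases m with
    | nil => simp at h
    | cons b m =>
      rw [List.foldl_cons, List.foldl_cons, List.foldl_cons]
      have h1 : (s || (!t && (!a && b))) = true ↔ 2 * A + a.toNat < 2 * B + b.toNat := by
        cases s <;> cases t <;> simp at hs ht <;> cases a <;> cases b <;> simp <;> omega
      have h2 : (t || (!s && (a && !b))) = true ↔ 2 * B + b.toNat < 2 * A + a.toNat := by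
        cases s <;> cases t <;> simp at hs ht <;> cases a <;> cases b <;> simp <;> omega
      exact ih m (by simpa using h) _ _ _ _ h1 h2

theorem leBits_iff {l m : List Bool} (h : l.length = m.length) :
    leBits l m = true ↔ bitsToNat l ≤ bitsToNat m := by
  have := foldl_compareStep l m h 0 0 false false (by simp) (by simp)
  rw [leBits, bitsToNat, bitsToNat, ← not_lt, ← this]
  simp

@[fun_prop]
theorem PT.leBits {l m : γ → List Bool} (hl : PT l) (hm : PT m) :
    PT fun c => leBits (l c) (m c) := by
  have h := (PT.foldl (i := fun c => (m c, false, false))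
    (F := fun x : γ × (List Bool × Bool × Bool) × Bool => compareStep x.2.1 x.2.2) hl (by fun_prop)
    (by unfold compareStep; fun_prop) 6 (fun c s a _ => by
      have h4 : ∀ b : Bool, sz b ≤ 3 := by intro b; cases b <;> simp [sz, code, Rep.rep, Sexp.enc]
      have h5 := sz_drop_le s.1 1
      rw [List.drop_one] at h5
      simp only [compareStep]
      have h6 : sz s = _ := sz_prod _ _
      have h7 : sz s.2 = _ := sz_prod _ _
      have h8 := sz_pos s.2.1
      have h9 := sz_pos s.2.2
      rw [sz_prod, sz_prod, h6, h7]
      have h10 := h4 (s.2.1 || (!s.2.2 && (!a && s.1.headD false)))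
      have h11 := h4 (s.2.2 || (!s.2.1 && (a && !(s.1.headD false))))
      simp only [Polynomial.eval_ofNat]
      omega)).snd.snd.not
  exact h

/-! ### Checking solutions of Sink-of-DAG -/

/-- The successor of `v` in the instance `u` of Sink-of-DAG. -/
def succOf (u v : List Bool) : List Bool :=
  ((parseCircuit u).run (fun k => k) v []).1.take (parseCircuit u).inputs

/-- The value of `v` in the instance `u` of Sink-of-DAG. -/
def valueOf (u v : List Bool) : List Bool :=
  ((parseCircuit u).run (fun k => k) v []).1.drop (parseCircuit u).inputs

/-- Decision procedure for Sink-of-DAG. -/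
def isSolution (u v : List Bool) : Bool :=
  if isInstance u = true then decide (v.length = (parseCircuit u).inputs) &&
    ((!(decide (succOf u v = v)) && (decide (succOf u (succOf u v) = succOf u v) ||
      leBits (valueOf u (succOf u v)) (valueOf u v))) ||
    (decide (v = List.replicate (parseCircuit u).inputs false) &&
      decide (succOf u (List.replicate (parseCircuit u).inputs false) =
        List.replicate (parseCircuit u).inputs false)))
  else decide (v = [])

@[fun_prop]
theorem PT.succOf {u v : γ → List Bool} (hu : PT u) (hv : PT v) :
    PT fun c => succOf (u c) (v c) := by
  unfold TotalSearch.succOf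
  fun_prop

@[fun_prop]
theorem PT.valueOf {u v : γ → List Bool} (hu : PT u) (hv : PT v) :
    PT fun c => valueOf (u c) (v c) := by
  unfold TotalSearch.valueOf
  fun_prop

@[fun_prop]
theorem PT.isSolution {u v : γ → List Bool} (hu : PT u) (hv : PT v) :
    PT fun c => isSolution (u c) (v c) := by
  unfold TotalSearch.isSolution
  fun_prop

theorem run_length (C : Circuit) (p : ℕ → ℕ) (x w : List Bool) :
    (C.run p x w).1.length = C.outputs.length := by simp [Circuit.run]

theorem isSolution_iff (u v : List Bool) : isSolution u v = true ↔ SinkOfDAG u v := by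
  unfold isSolution SinkOfDAG ofCircuits
  by_cases h : isInstance u = true
  · rw [if_pos h]
    obtain ⟨C, hC, rfl⟩ := (isInstance_iff u).1 h
    have h1 : ∀ v, succOf C.encode v = (C.eval v).take C.inputs := by
      intro v
      rw [succOf, parseCircuit_encode, hC.1.run_eq]
    have h2 : ∀ v, valueOf C.encode v = (C.eval v).drop C.inputs := by
      intro v
      rw [valueOf, parseCircuit_encode, hC.1.run_eq]
    have h3 : ∀ v, (C.eval v).length = 2 * C.inputs := by
      intro v
      rw [← hC.2]
      exact run_length _ _ _ _
    rw [or_iff_left (fun h => h.1 ⟨C, hC, rfl⟩)]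
    simp only [h1, h2, parseCircuit_encode, Bool.and_eq_true, Bool.or_eq_true, decide_eq_true_iff,
      Bool.not_eq_true', decide_eq_false_iff_not]
    rw [leBits_iff (by simp [h3])]
    constructor
    · rintro ⟨h4, h5⟩
      exact ⟨C, hC, rfl, h4, h5⟩
    · rintro ⟨D, -, h4, h5⟩
      cases Circuit.encode_injective h4
      exact h5
  · rw [if_neg h]
    rw [isInstance_iff] at h
    constructor
    · intro h'
      exact Or.inr ⟨h, by simpa using h'⟩
    · rintro (⟨C, h1, h2, -⟩ | ⟨-, rfl⟩)
      · exact absurd ⟨C, h1, h2⟩ h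
      · simp

end TotalSearch

/-! ### Small-step semantics, and simulation of a fixed oracle program from a list of answers. -/

namespace TotalSearch

/-! ## Small-step semantics of programs -/

/-- The next control state, given the top of the stack that is inspected. A control state is the
list of the programs that are still to be run. -/
def nextCtl : List Prog → Option Bool → List Prog
  | [], _ => []
  | .seq P Q :: ks, _ => P :: Q :: ks
  | .branch _ P _ _ :: ks, none => P :: ks
  | .branch _ _ Q _ :: ks, some false => Q :: ks
  | .branch _ _ _ S :: ks, some true => S :: ks
  | .loop _ _ :: ks, none => ks
  | .loop r P :: ks, some _ => P :: .loop r P :: ks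
  | .skip :: ks, _ => ks
  | .push _ _ :: ks, _ => ks
  | .pop _ :: ks, _ => ks
  | .query _ _ :: ks, _ => ks

/-- The stack that the next instruction inspects. -/
def ctlReg : List Prog → ℕ
  | .branch r _ _ _ :: _ => r
  | .loop r _ :: _ => r
  | .push r _ :: _ => r
  | .pop r :: _ => r
  | .query r _ :: _ => r
  | _ => 0

/-- The effect of the next instruction on the store. -/
def storeStep (b : List Bool → List Bool) : List Prog → Store → Store
  | .push r c :: _, σ => Function.update σ r (c :: σ r)
  | .pop r :: _, σ => Function.update σ r (σ r).tail
  | .query r s :: _, σ => Function.update σ s (b (σ r))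
  | _, σ => σ

/-- One small step. -/
def smallStep (b : List Bool → List Bool) (x : List Prog × Store) : List Prog × Store :=
  (nextCtl x.1 (x.2 (ctlReg x.1)).head?, storeStep b x.1 x.2)

/-- Unfolding a sequence takes a small step that `Runs` does not charge. The slack of one in `n + 1
≤ 2 * t`, available from both components, pays for it. -/
theorem Runs.smallStep {b : List Bool → List Bool} {P : Prog} {σ τ : Store} {t : ℕ}
    (h : Runs b P σ τ t) (ks : List Prog) :
    ∃ n, n + 1 ≤ 2 * t ∧ (smallStep b)^[n] (P :: ks, σ) = (ks, τ) := by
  induction h generalizing ks with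
  | skip σ => exact ⟨1, le_rfl, rfl⟩
  | push σ r c => exact ⟨1, le_rfl, rfl⟩
  | pop σ r => exact ⟨1, le_rfl, rfl⟩
  | query σ r s => exact ⟨1, by omega, rfl⟩
  | @seq P Q σ τ υ t t' _ _ ih1 ih2 =>
    obtain ⟨n, hn, h1⟩ := ih1 (Q :: ks)
    obtain ⟨m, hm, h2⟩ := ih2 ks
    refine ⟨m + n + 1, by omega, ?_⟩
    rw [Function.iterate_succ_apply, Function.iterate_add_apply, TotalSearch.smallStep]
    simp only [nextCtl, storeStep, h1, h2]
  | branchEmpty h0 _ ih =>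
    obtain ⟨n, hn, h1⟩ := ih ks
    refine ⟨n + 1, by omega, ?_⟩
    rw [Function.iterate_succ_apply, TotalSearch.smallStep]
    simpa [nextCtl, storeStep, ctlReg, h0] using h1
  | branchFalse h0 _ ih =>
    obtain ⟨n, hn, h1⟩ := ih ks
    refine ⟨n + 1, by omega, ?_⟩
    rw [Function.iterate_succ_apply, TotalSearch.smallStep]
    simpa [nextCtl, storeStep, ctlReg, h0] using h1
  | branchTrue h0 _ ih =>
    obtain ⟨n, hn, h1⟩ := ih ks
    refine ⟨n + 1, by omega, ?_⟩
    rw [Function.iterate_succ_apply, TotalSearch.smallStep]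
    simpa [nextCtl, storeStep, ctlReg, h0] using h1
  | @loopStop r P σ h0 =>
    refine ⟨1, le_rfl, ?_⟩
    rw [Function.iterate_one, TotalSearch.smallStep]
    simp [nextCtl, storeStep, ctlReg, h0]
  | @loopStep r P σ τ υ t t' h0 _ _ ih1 ih2 =>
    obtain ⟨n, hn, h1⟩ := ih1 (.loop r P :: ks)
    obtain ⟨m, hm, h2⟩ := ih2 ks
    refine ⟨m + n + 1, by omega, ?_⟩
    rw [Function.iterate_succ_apply, Function.iterate_add_apply, TotalSearch.smallStep]
    obtain ⟨a, l, h3⟩ := List.exists_cons_of_ne_nil h0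
    simp only [nextCtl, storeStep, ctlReg, h3, List.head?_cons, h1, h2]

theorem smallStep_iterate_nil (b : List Bool → List Bool) (σ : Store) (n : ℕ) :
    (smallStep b)^[n] ([], σ) = ([], σ) := by
  induction n with
  | zero => rfl
  | succ n ih => rw [Function.iterate_succ_apply]; exact ih

theorem Runs.smallStep_of_le {b : List Bool → List Bool} {P : Prog} {σ τ : Store} {t n : ℕ}
    (h : Runs b P σ τ t) (hn : 2 * t ≤ n) : (TotalSearch.smallStep b)^[n] ([P], σ) = ([], τ) := by
  obtain ⟨m, hm, h1⟩ := h.smallStep []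
  obtain ⟨k, rfl⟩ : ∃ k, n = k + m := ⟨n - m, by omega⟩
  rw [Function.iterate_add_apply, h1, smallStep_iterate_nil]

/-! ### The finite control -/

/-- The control states that occur while `P` is run with `ks` still to come. -/
def ctls : Prog → List Prog → List (List Prog)
  | .seq P Q, ks => (.seq P Q :: ks) :: (ctls P (Q :: ks) ++ ctls Q ks)
  | .branch r P Q S, ks => (.branch r P Q S :: ks) :: (ctls P ks ++ ctls Q ks ++ ctls S ks)
  | .loop r P, ks => (.loop r P :: ks) :: ctls P (.loop r P :: ks)
  | P, ks => [P :: ks]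

theorem mem_ctls (P : Prog) (ks : List Prog) : P :: ks ∈ ctls P ks := by
  cases P <;> simp [ctls]

/-- A control state is a stack of programs, yet it is determined by a position in the program text:
a subprogram always meets the same continuation, and a loop puts itself back only after its test. So
`ctls` is closed until control passes to `ks`, and the control is finite. -/
theorem nextCtl_mem_ctls (P : Prog) (ks c : List Prog) (hc : c ∈ ctls P ks) (o : Option Bool) :
    nextCtl c o ∈ ctls P ks ∨ nextCtl c o = ks := by
  induction P generalizing ks with
  | skip => simp [ctls] at hc; subst hc; right; rfl
  | push r c => simp [ctls] at hc; subst hc; right; rfl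
  | pop r => simp [ctls] at hc; subst hc; right; rfl
  | query r s => simp [ctls] at hc; subst hc; right; rfl
  | seq P Q ihP ihQ =>
    simp only [ctls, List.mem_cons, List.mem_append] at hc ⊢
    rcases hc with rfl | hc | hc
    · exact Or.inl (Or.inr (Or.inl (mem_ctls P _)))
    · rcases ihP _ hc with h | h
      · exact Or.inl (Or.inr (Or.inl h))
      · rw [h]
        exact Or.inl (Or.inr (Or.inr (mem_ctls Q _)))
    · rcases ihQ _ hc with h | h
      · exact Or.inl (Or.inr (Or.inr h))
      · exact Or.inr h
  | branch r P Q S ihP ihQ ihS =>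
    simp only [ctls, List.mem_cons, List.mem_append] at hc ⊢
    rcases hc with rfl | (hc | hc) | hc
    · left; right
      rcases o with _ | _ | _
      · exact Or.inl (Or.inl (mem_ctls P _))
      · exact Or.inl (Or.inr (mem_ctls Q _))
      · exact Or.inr (mem_ctls S _)
    · rcases ihP _ hc with h | h
      · exact Or.inl (Or.inr (Or.inl (Or.inl h)))
      · exact Or.inr h
    · rcases ihQ _ hc with h | h
      · exact Or.inl (Or.inr (Or.inl (Or.inr h)))
      · exact Or.inr h
    · rcases ihS _ hc with h | h
      · exact Or.inl (Or.inr (Or.inr h))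
      · exact Or.inr h
  | loop r P ihP =>
    simp only [ctls, List.mem_cons] at hc ⊢
    rcases hc with rfl | hc
    · cases o with
      | none => exact Or.inr rfl
      | some b => exact Or.inl (Or.inr (mem_ctls P _))
    · rcases ihP _ hc with h | h
      · exact Or.inl (Or.inr h)
      · exact Or.inl (Or.inl h)

/-- The control states of a program. -/
def controls (P : Prog) : List (List Prog) := [] :: ctls P []

theorem mem_controls (P : Prog) : [P] ∈ controls P := List.mem_cons_of_mem _ (mem_ctls P [])

theorem nextCtl_mem_controls {P : Prog} {c : List Prog} (hc : c ∈ controls P) (o : Option Bool) :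
    nextCtl c o ∈ controls P := by
  rcases List.mem_cons.1 hc with rfl | hc
  · exact List.mem_cons_self
  · rcases nextCtl_mem_ctls P [] c hc o with h | h
    · exact List.mem_cons_of_mem _ h
    · rw [h]
      exact List.mem_cons_self

/-- A bound on the numbers of the stacks that a program uses. -/
def Prog.bound : Prog → ℕ
  | .skip => 1
  | .push r _ => r + 1
  | .pop r => r + 1
  | .query r s => max r s + 1
  | .seq P Q => max P.bound Q.bound
  | .branch r P Q S => max (r + 1) (max P.bound (max Q.bound S.bound))
  | .loop r P => max (r + 1) P.bound

theorem forall_ctls {p : Prog → Prop} (hseq : ∀ P Q, p (.seq P Q) → p P ∧ p Q)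
    (hbr : ∀ r P Q S, p (.branch r P Q S) → p P ∧ p Q ∧ p S) (hloop : ∀ r P, p (.loop r P) → p P)
    (P : Prog) (ks c : List Prog) (hc : c ∈ ctls P ks) (hP : p P) (hks : ∀ Q ∈ ks, p Q) :
    ∀ Q ∈ c, p Q := by
  have base : ∀ P, p P → ∀ ks : List Prog, (∀ Q ∈ ks, p Q) → ∀ Q ∈ P :: ks, p Q := by
    intro P hP ks hks Q hQ
    rcases List.mem_cons.1 hQ with rfl | h
    · exact hP
    · exact hks Q h
  induction P generalizing ks with
  | skip => simp [ctls] at hc; subst hc; exact base _ hP _ hks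
  | push r c => simp [ctls] at hc; subst hc; exact base _ hP _ hks
  | pop r => simp [ctls] at hc; subst hc; exact base _ hP _ hks
  | query r s => simp [ctls] at hc; subst hc; exact base _ hP _ hks
  | seq P Q ihP ihQ =>
    simp only [ctls, List.mem_cons, List.mem_append] at hc
    rcases hc with rfl | hc | hc
    · exact base _ hP _ hks
    · exact ihP _ hc (hseq P Q hP).1 (base _ (hseq P Q hP).2 _ hks)
    · exact ihQ _ hc (hseq P Q hP).2 hks
  | branch r P Q S ihP ihQ ihS =>
    simp only [ctls, List.mem_cons, List.mem_append] at hc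
    have h := hbr _ _ _ _ hP
    rcases hc with rfl | (hc | hc) | hc
    · exact base _ hP _ hks
    · exact ihP _ hc h.1 hks
    · exact ihQ _ hc h.2.1 hks
    · exact ihS _ hc h.2.2 hks
  | loop r P ihP =>
    simp only [ctls, List.mem_cons] at hc
    rcases hc with rfl | hc
    · exact base _ hP _ hks
    · exact ihP _ hc (hloop _ _ hP) (base _ hP _ hks)

theorem bound_of_mem_controls {P : Prog} {c : List Prog} (hc : c ∈ controls P) :
    ∀ Q ∈ c, Q.bound ≤ P.bound := by
  rcases List.mem_cons.1 hc with rfl | hc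
  · simp
  · refine forall_ctls (p := fun Q => Q.bound ≤ P.bound) ?_ ?_ ?_ P [] c hc le_rfl (by simp)
    · intro P Q h; simp only [Prog.bound] at h; omega
    · intro r P Q S h; simp only [Prog.bound] at h; omega
    · intro r P h; simp only [Prog.bound] at h; omega

open Classical in
/-- The number of a control state. -/
noncomputable def ctlIdx (P : Prog) (c : List Prog) : ℕ :=
  if h : ∃ i, (controls P)[i]? = some c then h.choose else 0

theorem getElem?_ctlIdx {P : Prog} {c : List Prog} (hc : c ∈ controls P) :
    (controls P)[ctlIdx P c]? = some c := by
  have h := List.mem_iff_getElem?.1 hc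
  rw [ctlIdx, dif_pos h]
  exact h.choose_spec

theorem getD_ctlIdx {P : Prog} {c : List Prog} (hc : c ∈ controls P) {α : Type}
    (f : List Prog → α) (d : α) : ((controls P).map f).getD (ctlIdx P c) d = f c := by
  rw [List.getD_eq_getElem?_getD, List.getElem?_map, getElem?_ctlIdx hc]
  rfl

theorem ctlIdx_lt {P : Prog} {c : List Prog} (hc : c ∈ controls P) :
    ctlIdx P c < (controls P).length := by
  have := getElem?_ctlIdx hc
  exact (List.getElem?_eq_some_iff.1 this).1

theorem ctlIdx_inj {P : Prog} {c d : List Prog} (hc : c ∈ controls P) (hd : d ∈ controls P)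
    (h : ctlIdx P c = ctlIdx P d) : c = d := by
  have h1 := getElem?_ctlIdx hc
  rw [h, getElem?_ctlIdx hd] at h1
  exact (Option.some.inj h1).symm

/-! ### Running a program with a list of answers -/

/-- Control state, store, list of all pairs (query, answer) so far, and remaining answers. -/
abbrev AnsweredConfig := List Prog × Store × List (List Bool × List Bool) × List (List Bool)

/-- A step in which queries are answered from a list. When the list is exhausted, nothing
happens. -/
def answeredStep : AnsweredConfig → AnsweredConfig
  | (.query r s :: ks, σ, log, []) => (.query r s :: ks, σ, log, [])
  | (.query r s :: ks, σ, log, a :: as) => (ks, Function.update σ s a, log ++ [(σ r, a)], as)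
  | (c, σ, log, as) => (nextCtl c (σ (ctlReg c)).head?, storeStep noOracle c σ, log, as)

/-- What is visible of a configuration: whether it has halted, the output or the query to be
answered, the pairs (query, answer), and the remaining answers. -/
def AnsweredConfig.view (x : AnsweredConfig) :
    Bool × List Bool × List (List Bool × List Bool) × List (List Bool) :=
  (x.1.isEmpty, x.2.1 (ctlReg x.1), x.2.2.1, x.2.2.2)

/-- The start of `P` on `x` with a list of answers. -/
def answeredStart (P : Prog) (x : List Bool) (as : List (List Bool)) : AnsweredConfig :=
  ([P], fun i => [x].getD i [], [], as)

/-- A configuration as data. -/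
abbrev ConfigData :=
  ℕ × List (List Bool) × List (List Bool × List Bool) × List (List Bool)

/-- Replaces the entry at position `r`. -/
def setAt (l : List (List Bool)) (r : ℕ) (v : List Bool) : List (List Bool) :=
  l.take r ++ v :: l.drop (r + 1)

/-- The instruction of a control state: the kind, two stacks, a bit, and the successors. -/
noncomputable def instrData (P : Prog) (c : List Prog) : ℕ × ℕ × ℕ × Bool × ℕ × ℕ × ℕ :=
  ((match c with | .push _ _ :: _ => 1 | .pop _ :: _ => 2 | .query _ _ :: _ => 3 | _ => 0),
    ctlReg c, (match c with | .query _ s :: _ => s | _ => 0),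
    (match c with | .push _ b :: _ => b | _ => false), ctlIdx P (nextCtl c none),
    ctlIdx P (nextCtl c (some false)), ctlIdx P (nextCtl c (some true)))

/-- The table of all instructions. -/
noncomputable def instrTable (P : Prog) : List (ℕ × ℕ × ℕ × Bool × ℕ × ℕ × ℕ) :=
  (controls P).map (instrData P)

/-- `answeredStep` for an instruction given as data. -/
def instrStep (I : ℕ × ℕ × ℕ × Bool × ℕ × ℕ × ℕ) (d : ConfigData) : ConfigData :=
  if I.1 = 3 then
    if d.2.2.2 = [] then d
    else (I.2.2.2.2.1, setAt d.2.1 I.2.2.1 (d.2.2.2.headD []),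
      d.2.2.1 ++ [(d.2.1.getD I.2.1 [], d.2.2.2.headD [])], d.2.2.2.tail)
  else
    ((if d.2.1.getD I.2.1 [] = [] then I.2.2.2.2.1
      else if (d.2.1.getD I.2.1 []).headD false = true then I.2.2.2.2.2.2 else I.2.2.2.2.2.1),
     (if I.1 = 1 then setAt d.2.1 I.2.1 (I.2.2.2.1 :: d.2.1.getD I.2.1 [])
      else if I.1 = 2 then setAt d.2.1 I.2.1 (d.2.1.getD I.2.1 []).tail else d.2.1),
     d.2.2)

/-- `answeredStep` on data. -/
noncomputable def dataStep (P : Prog) (d : ConfigData) : ConfigData :=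
  instrStep ((instrTable P).getD d.1 (0, 0, 0, false, 0, 0, 0)) d

@[fun_prop]
theorem PT.setAt {γ : Type} [Rep γ] {l : γ → List (List Bool)} {r : γ → ℕ} {v : γ → List Bool}
    (hl : PT l) (hr : PT r) (hv : PT v) : PT fun c => setAt (l c) (r c) (v c) := by
  unfold TotalSearch.setAt
  fun_prop

theorem PT.instrStep {γ : Type} [Rep γ] {I : γ → ℕ × ℕ × ℕ × Bool × ℕ × ℕ × ℕ}
    {d : γ → ConfigData} (hI : PT I) (hd : PT d) : PT fun c => instrStep (I c) (d c) := by
  have hk : PT fun c => (I c).1 := hI.fst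
  have hr : PT fun c => (I c).2.1 := hI.snd.fst
  have hs : PT fun c => (I c).2.2.1 := hI.snd.snd.fst
  have hb : PT fun c => (I c).2.2.2.1 := hI.snd.snd.snd.fst
  have h0 : PT fun c => (I c).2.2.2.2.1 := hI.snd.snd.snd.snd.fst
  have h1 : PT fun c => (I c).2.2.2.2.2.1 := hI.snd.snd.snd.snd.snd.fst
  have h2 : PT fun c => (I c).2.2.2.2.2.2 := hI.snd.snd.snd.snd.snd.snd
  have hst : PT fun c => (d c).2.1 := hd.snd.fst
  have hlog : PT fun c => (d c).2.2.1 := hd.snd.snd.fst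
  have has : PT fun c => (d c).2.2.2 := hd.snd.snd.snd
  have hg : PT fun c => (d c).2.1.getD (I c).2.1 [] := PT.getD hst hr (PT.const _)
  have hlog' : PT fun c => (d c).2.2.1 ++
      [((d c).2.1.getD (I c).2.1 [], (d c).2.2.2.headD [])] :=
    hlog.append ((hg.prodMk (has.headD (PT.const _))).cons (PT.const _))
  have h3 : ∀ k, PT fun c => decide ((I c).1 = k) := fun k => hk.decide_eq (PT.const k)
  exact PT.ite (h3 3) (PT.ite has.decide_nil hd (h0.prodMk
    ((hst.setAt hs (has.headD (PT.const _))).prodMk (hlog'.prodMk has.tail))))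
    ((PT.ite hg.decide_nil h0 (PT.ite ((hg.headD (PT.const _)).decide_bool) h2 h1)).prodMk
      ((PT.ite (h3 1) (hst.setAt hr (hb.cons hg))
        (PT.ite (h3 2) (hst.setAt hr hg.tail) hst)).prodMk hd.snd.snd))

theorem PT.dataStep (P : Prog) : PT (dataStep P) := by
  unfold TotalSearch.dataStep
  exact PT.instrStep (by fun_prop) (by fun_prop)

theorem sz_append_eq {α : Type} [Rep α] (l m : List α) : sz (l ++ m) + 1 = sz l + sz m := by
  induction l with
  | nil => simp [sz_nil]; omega
  | cons a l ih => rw [List.cons_append, sz_cons, sz_cons]; omega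

/-- The size of the old entry is kept on the left, so that a push costs a constant. A bound by `sz l
+ sz v` alone could double at every step. -/
theorem sz_setAt_le (l : List (List Bool)) (r : ℕ) (v : List Bool) :
    sz (setAt l r v) + sz (l.getD r []) ≤ sz l + sz v + 2 := by
  have h1 := sz_append_eq (l.take r) (v :: l.drop (r + 1))
  have h3 := sz_append_eq (l.take r) (l.drop r)
  rw [List.take_append_drop] at h3
  rw [sz_cons] at h1
  rw [setAt]
  by_cases h : r < l.length
  · rw [List.drop_eq_getElem_cons h, sz_cons] at h3
    rw [List.getD_eq_getElem _ _ h]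
    omega
  · rw [List.getD_eq_default _ _ (by omega), sz_nil]
    rw [List.drop_of_length_le (by omega)] at h1 h3 ⊢
    rw [sz_nil] at h1 h3
    omega

/-- A query moves an answer from the list to a stack, so these two are measured together and grow by
a constant. The log receives copies and grows by an amount linear in that sum. -/
theorem sz_instrStep (I : ℕ × ℕ × ℕ × Bool × ℕ × ℕ × ℕ) (d : ConfigData) :
    sz (instrStep I d).2.1 + sz (instrStep I d).2.2.2 ≤ sz d.2.1 + sz d.2.2.2 + 10 ∧
    sz (instrStep I d).2.2.1 ≤ sz d.2.2.1 + (2 * (sz d.2.1 + sz d.2.2.2) + 10) ∧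
    sz (instrStep I d).1 ≤ sz d.1 + sz I := by
  obtain ⟨q, l, log, as⟩ := d
  obtain ⟨k, r, s, b, n0, n1, n2⟩ := I
  have hI : sz (k, r, s, b, n0, n1, n2) = 1 + sz k + (1 + sz r + (1 + sz s + (1 + sz b +
      (1 + sz n0 + (1 + sz n1 + sz n2))))) := by simp only [sz_prod]
  have hg : sz (l.getD r []) ≤ sz l + 1 := by
    by_cases h : r < l.length
    · rw [List.getD_eq_getElem _ _ h]
      have := sz_mem_le (List.getElem_mem h)
      omega
    · rw [List.getD_eq_default _ _ (by omega), sz_nil]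
      omega
  have hb : sz b ≤ 3 := by cases b <;> simp [sz, code, Rep.rep, Sexp.enc]
  unfold instrStep
  by_cases h3 : k = 3
  · rw [if_pos h3]
    cases as with
    | nil => simp
    | cons a as =>
      rw [if_neg (by simp)]
      have h1 := sz_setAt_le l s a
      have h4 := sz_append_eq log [(l.getD r [], a)]
      have h5 := sz_pos (l.getD s [])
      simp only [sz_cons, sz_prod, sz_nil, List.headD_cons, List.tail_cons] at *
      refine ⟨by omega, by omega, by omega⟩
  · rw [if_neg h3]
    refine ⟨?_, ?_, ?_⟩
    · have h1 := sz_setAt_le l r (b :: l.getD r [])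
      have h2 := sz_setAt_le l r (l.getD r []).tail
      have h4 := sz_drop_le (l.getD r []) 1
      rw [List.drop_one] at h4
      rw [sz_cons] at h1
      simp only
      split_ifs <;> omega
    · simp only
      omega
    · simp only
      rw [hI]
      split_ifs <;> omega

theorem PT.dataStep_iterate (P : Prog) {γ : Type} [Rep γ] {n : γ → ℕ} {d : γ → ConfigData}
    (hn : PT n) (hd : PT d) : PT fun c => (TotalSearch.dataStep P)^[n c] (d c) := by
  obtain ⟨q, hq⟩ := hd.exists_sz_le
  obtain ⟨q', hq'⟩ := hn.exists_sz_le
  -- A bound for every table entry and, by the summand 20, for the default instruction.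
  set k := sz (instrTable P) + 20 with hk
  refine PT.iterate (PT.dataStep P) hn hd
    (3 + q + Polynomial.C k * q' + q + 10 * q' + q +
      q' * (2 * (2 * q + 10 * q') + 10)) fun c j hj => ?_
  have h : ∀ j, sz ((TotalSearch.dataStep P)^[j] (d c)).2.1 +
        sz ((TotalSearch.dataStep P)^[j] (d c)).2.2.2 ≤ sz (d c).2.1 + sz (d c).2.2.2 + j * 10 ∧
      sz ((TotalSearch.dataStep P)^[j] (d c)).2.2.1 ≤ sz (d c).2.2.1 +
        j * (2 * (sz (d c).2.1 + sz (d c).2.2.2 + j * 10) + 10) ∧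
      sz ((TotalSearch.dataStep P)^[j] (d c)).1 ≤ sz (d c).1 + j * k := by
    intro j
    induction j with
    | zero => simp
    | succ j ih =>
      obtain ⟨h1, h2, h3⟩ := ih
      rw [Function.iterate_succ_apply']
      set e := (TotalSearch.dataStep P)^[j] (d c)
      have hI : sz ((instrTable P).getD e.1 (0, 0, 0, false, 0, 0, 0)) ≤ k := by
        by_cases h : e.1 < (instrTable P).length
        · rw [List.getD_eq_getElem _ _ h]
          have := sz_mem_le (List.getElem_mem h)
          omega
        · rw [List.getD_eq_default _ _ (by omega)]
          have : sz ((0, 0, 0, false, 0, 0, 0) : ℕ × ℕ × ℕ × Bool × ℕ × ℕ × ℕ) ≤ 20 := by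
            simp only [sz_prod, sz_nat, show sz false = 1 from rfl]
            norm_num
          omega
      obtain ⟨h4, h5, h6⟩ := sz_instrStep ((instrTable P).getD e.1 (0, 0, 0, false, 0, 0, 0)) e
      refine ⟨?_, ?_, ?_⟩
      · rw [TotalSearch.dataStep]; omega
      · rw [TotalSearch.dataStep]
        have : (j + 1) * (2 * (sz (d c).2.1 + sz (d c).2.2.2 + (j + 1) * 10) + 10) =
          j * (2 * (sz (d c).2.1 + sz (d c).2.2.2 + j * 10) + 10) + 20 * j +
          (2 * (sz (d c).2.1 + sz (d c).2.2.2 + (j + 1) * 10) + 10) := by ring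
        omega
      · rw [TotalSearch.dataStep, add_mul]; omega
  obtain ⟨h1, h2, h3⟩ := h j
  have h4 := hq c
  have h5 := hq' c
  rw [sz_nat] at h5
  have h6 : sz (d c) = 1 + sz (d c).1 + (1 + sz (d c).2.1 + (1 + sz (d c).2.2.1 + sz (d c).2.2.2)) :=
    by rw [← sz_prod, ← sz_prod, ← sz_prod]
  have h7 : sz ((TotalSearch.dataStep P)^[j] (d c)) = 1 + sz ((TotalSearch.dataStep P)^[j] (d c)).1 +
      (1 + sz ((TotalSearch.dataStep P)^[j] (d c)).2.1 +
        (1 + sz ((TotalSearch.dataStep P)^[j] (d c)).2.2.1 +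
          sz ((TotalSearch.dataStep P)^[j] (d c)).2.2.2)) :=
    by rw [← sz_prod, ← sz_prod, ← sz_prod]
  have h8 : j ≤ q'.eval (sz c) := by omega
  have h9 : j * k ≤ q'.eval (sz c) * k := Nat.mul_le_mul_right _ h8
  have h10 : j * (2 * (sz (d c).2.1 + sz (d c).2.2.2 + j * 10) + 10) ≤
      q'.eval (sz c) * (2 * (2 * q.eval (sz c) + 10 * q'.eval (sz c)) + 10) :=
    Nat.mul_le_mul h8 (by omega)
  simp only [Polynomial.eval_add, Polynomial.eval_mul, Polynomial.eval_C, Polynomial.eval_ofNat]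
  rw [mul_comm k]
  omega

/-- The data `d` describe the configuration `x` of the program `P`. -/
def Describes (P : Prog) (d : ConfigData) (x : AnsweredConfig) : Prop :=
  x.1 ∈ controls P ∧ d.1 = ctlIdx P x.1 ∧ P.bound ≤ d.2.1.length ∧
    (∀ i, x.2.1 i = d.2.1.getD i []) ∧ d.2.2 = x.2.2

theorem setAt_length {l : List (List Bool)} {r : ℕ} (h : r < l.length) (v : List Bool) :
    (setAt l r v).length = l.length := by
  simp [setAt]; omega

theorem setAt_getD {l : List (List Bool)} {r : ℕ} (h : r < l.length) (v : List Bool) (i : ℕ) :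
    (setAt l r v).getD i [] = if i = r then v else l.getD i [] := by
  have : setAt l r v = l.set r v := by rw [setAt, List.set_eq_take_append_cons_drop, if_pos h]
  rw [this, List.getD_eq_getElem?_getD, List.getElem?_set, List.getD_eq_getElem?_getD]
  by_cases hi : i = r
  · simp [hi, h]
  · rw [if_neg (fun h => hi h.symm), if_neg hi]

theorem update_eq_setAt {σ : Store} {l : List (List Bool)} (hσ : ∀ i, σ i = l.getD i []) {r : ℕ}
    (h : r < l.length) (v : List Bool) (i : ℕ) :
    Function.update σ r v i = (setAt l r v).getD i [] := by
  rw [setAt_getD h, Function.update_apply, hσ]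

theorem instrTable_getD {P : Prog} {c : List Prog} (hc : c ∈ controls P) :
    (instrTable P).getD (ctlIdx P c) (0, 0, 0, false, 0, 0, 0) = instrData P c :=
  getD_ctlIdx hc _ _

theorem head_cases (l : List Bool) (f : Option Bool → ℕ) :
    (if l = [] then f none else if l.headD false = true then f (some true) else f (some false)) =
      f l.head? := by
  rcases l with _ | ⟨_ | _, l⟩ <;> simp

theorem Describes.step {P : Prog} {d : ConfigData} {x : AnsweredConfig} (h : Describes P d x) :
    Describes P (dataStep P d) (answeredStep x) := by
  obtain ⟨q, l, log, as⟩ := d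
  obtain ⟨c, σ, log', as'⟩ := x
  obtain ⟨h1, h2, h3, h4, h5⟩ := h
  simp only [Prod.mk.injEq] at h1 h2 h3 h4 h5
  obtain ⟨rfl, rfl⟩ := h5
  have hI := instrTable_getD h1
  rw [dataStep, h2, hI]
  have hb := bound_of_mem_controls h1
  have hn := fun o => nextCtl_mem_controls h1 o
  have hh := head_cases (l.getD (ctlReg c) []) fun o => ctlIdx P (nextCtl c o)
  rw [← h4 (ctlReg c)] at hh
  rcases c with _ | ⟨Q, ks⟩
  · refine ⟨hn none, ?_, h3, h4, rfl⟩
    simp only [instrStep, instrData, ← h4]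
    exact hh
  · have hQ := hb Q (by simp)
    cases Q with
    | query r s =>
      have hs : s < l.length := by simp only [Prog.bound] at hQ; omega
      cases as with
      | nil => exact ⟨h1, by simp only [instrStep, instrData, if_true]; rfl,
          by simpa [instrStep, instrData] using h3,
          fun i => by simpa [instrStep, instrData, answeredStep] using h4 i,
          by simp [instrStep, instrData, answeredStep]⟩
      | cons a as =>
        refine ⟨hn none, by simp [instrStep, instrData]; rfl, ?_, ?_, ?_⟩
        · simpa [instrStep, instrData, setAt_length hs] using h3
        · intro i
          simpa [instrStep, instrData, answeredStep] using update_eq_setAt h4 hs a i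
        · simp only [instrStep, instrData, answeredStep, if_true, reduceCtorEq, if_false,
            List.headD_cons, List.tail_cons, h4, ctlReg]
    | skip =>
      refine ⟨hn none, ?_, h3, h4, rfl⟩
      simp only [instrStep, instrData, ← h4]
      exact hh
    | push r b =>
      have hr : r < l.length := by simp only [Prog.bound] at hQ; omega
      refine ⟨hn none, ?_, ?_, ?_, rfl⟩
      · simp only [instrStep, instrData, ← h4]
        exact hh
      · simpa [instrStep, instrData, ctlReg, setAt_length hr] using h3
      · intro i
        have := update_eq_setAt h4 hr (b :: σ r) i
        rw [h4 r] at this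
        simpa [instrStep, instrData, ctlReg, answeredStep, storeStep, h4 r] using this
    | pop r =>
      have hr : r < l.length := by simp only [Prog.bound] at hQ; omega
      refine ⟨hn none, ?_, ?_, ?_, rfl⟩
      · simp only [instrStep, instrData, ← h4]
        exact hh
      · simpa [instrStep, instrData, ctlReg, setAt_length hr] using h3
      · intro i
        have := update_eq_setAt h4 hr (σ r).tail i
        rw [h4 r] at this
        simpa [instrStep, instrData, ctlReg, answeredStep, storeStep, h4 r] using this
    | seq Q S =>
      refine ⟨hn none, ?_, h3, h4, rfl⟩
      simp only [instrStep, instrData, ← h4]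
      exact hh
    | branch r Q S T =>
      refine ⟨hn _, ?_, h3, h4, rfl⟩
      simp only [instrStep, instrData, ← h4]
      exact hh
    | loop r Q =>
      refine ⟨hn _, ?_, h3, h4, rfl⟩
      simp only [instrStep, instrData, ← h4]
      exact hh

/-- Running a program with a list of answers is possible in polynomial time. -/
theorem PT.answered (P : Prog) {γ : Type} [Rep γ] {n : γ → ℕ} {x : γ → List Bool}
    {as : γ → List (List Bool)} (hn : PT n) (hx : PT x) (has : PT as) :
    PT fun c => (answeredStep^[n c] (answeredStart P (x c) (as c))).view := by
  let d : γ → ConfigData := fun c =>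
    (ctlIdx P [P], x c :: List.replicate P.bound [], [], as c)
  let e : γ → ConfigData := fun c => (TotalSearch.dataStep P)^[n c] (d c)
  have he : PT e := PT.dataStep_iterate P hn (by fun_prop)
  have hd : ∀ c, Describes P (d c) (answeredStart P (x c) (as c)) := by
    intro c
    refine ⟨mem_controls P, rfl, by simp [d], fun i => ?_, rfl⟩
    rcases i with _ | i
    · simp [answeredStart, d]
    · simp [answeredStart, d, List.getElem?_replicate]
      split_ifs <;> rfl
  have h : ∀ c, Describes P (e c) (answeredStep^[n c] (answeredStart P (x c) (as c))) := by
    intro c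
    have : ∀ j, Describes P ((TotalSearch.dataStep P)^[j] (d c))
        (answeredStep^[j] (answeredStart P (x c) (as c))) := by
      intro j
      induction j with
      | zero => exact hd c
      | succ j ih =>
        rw [Function.iterate_succ_apply', Function.iterate_succ_apply']
        exact ih.step
    exact this _
  have : PT fun c => (((controls P).map List.isEmpty).getD (e c).1 false,
      (e c).2.1.getD (((controls P).map ctlReg).getD (e c).1 0) [], (e c).2.2.1, (e c).2.2.2) := by
    fun_prop
  convert this using 2 with c
  obtain ⟨h1, h2, h3, h4, h5⟩ := h c
  rw [AnsweredConfig.view, h2, h4, h5, getD_ctlIdx h1, getD_ctlIdx h1]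

end TotalSearch

/-! ### Compilation of formulas and of cellular automata into circuits. -/

namespace TotalSearch

/-! ## Formulas and their compilation -/

/-- Formulas over the connective nand. -/
inductive Formula : Type
  | var (w : ℕ) : Formula
  | nand (A B : Formula) : Formula

/-- The value of a formula. -/
def Formula.eval (ρ : ℕ → Bool) : Formula → Bool
  | .var w => ρ w
  | .nand A B => !(A.eval ρ && B.eval ρ)

/-- Functional completeness of nand, by Shannon expansion in the last variable. As there are no
constants, `true` is obtained as $\neg(x\wedge\neg x)$. -/
theorem Formula.exists_eval_eq (n : ℕ) (f : (ℕ → Bool) → Bool)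
    (hf : ∀ ρ ρ' : ℕ → Bool, (∀ i < n, ρ i = ρ' i) → f ρ = f ρ') :
    ∃ A : Formula, ∀ ρ, A.eval ρ = f ρ := by
  induction n generalizing f with
  | zero =>
    have h : ∀ ρ, f ρ = f fun _ => false := fun ρ => hf _ _ (by simp)
    cases h0 : f fun _ => false
    · let A : Formula := .nand (.var 0) (.nand (.var 0) (.var 0))
      refine ⟨.nand A A, fun ρ => ?_⟩
      rw [h, h0]
      simp only [A, Formula.eval]
      cases ρ 0 <;> rfl
    · refine ⟨.nand (.var 0) (.nand (.var 0) (.var 0)), fun ρ => ?_⟩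
      rw [h, h0]
      simp only [Formula.eval]
      cases ρ 0 <;> rfl
  | succ n ih =>
    have key : ∀ b, ∃ A : Formula, ∀ ρ, A.eval ρ = f (Function.update ρ n b) := by
      intro b
      refine ih _ fun ρ ρ' h => hf _ _ fun i hi => ?_
      by_cases hin : i = n
      · subst hin; simp
      · rw [Function.update_of_ne hin, Function.update_of_ne hin]
        exact h i (by omega)
    obtain ⟨A0, h0⟩ := key false
    obtain ⟨A1, h1⟩ := key true
    -- The multiplexer $(x_n\wedge A_1)\vee(\neg x_n\wedge A_0)$.
    refine ⟨.nand (.nand (.var n) A1) (.nand (.nand (.var n) (.var n)) A0), fun ρ => ?_⟩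
    simp only [Formula.eval, h0, h1]
    cases h : ρ n
    · rw [show f ρ = f (Function.update ρ n false) by rw [← h, Function.update_eq_self]]
      simp
    · rw [show f ρ = f (Function.update ρ n true) by rw [← h, Function.update_eq_self]]
      simp

/-- The number of connectives. -/
def Formula.size : Formula → ℕ
  | .var _ => 0
  | .nand A B => A.size + B.size + 1

/-- The output wire when the gates of the formula are placed behind the first `b` wires and the
variable `w` is connected to the wire `θ w`. -/
def Formula.out (θ : ℕ → ℕ) (b : ℕ) : Formula → ℕ
  | .var w => θ w
  | .nand A B => b + A.size + B.size

/-- The gates that compute a formula. -/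
def Formula.gates (θ : ℕ → ℕ) : ℕ → Formula → List Gate
  | _, .var _ => []
  | b, .nand A B => A.gates θ b ++ B.gates θ (b + A.size) ++
      [.nand (A.out θ b) (B.out θ (b + A.size))]

/-- The values of all wires after the evaluation of gates none of which is an oracle gate. -/
def plainVals (gs : List Gate) (vals : List Bool) : List Bool := (runGates (fun _ => 0) gs vals []).1

theorem plainVals_append (gs hs : List Gate) (vals : List Bool) :
    plainVals (gs ++ hs) vals = plainVals hs (plainVals gs vals) := by
  induction gs generalizing vals with
  | nil => rfl
  | cons g gs ih => cases g <;> simp [plainVals, runGates] at ih ⊢ <;> rw [ih]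

theorem wire_append {vals : List Bool} {i : ℕ} (h : i < vals.length) (ext : List Bool) :
    wire (vals ++ ext) i = wire vals i := by
  simp [wire, List.getElem?_append_left h]

theorem wire_concat (l : List Bool) (b : Bool) : wire (l ++ [b]) l.length = b := by
  rw [wire, List.getD_append_right _ _ _ _ le_rfl]
  simp

theorem Formula.out_lt (A : Formula) {θ : ℕ → ℕ} {b : ℕ} (hθ : ∀ w, θ w < b) :
    A.out θ b < b + A.size := by
  cases A with
  | var w => exact (hθ w).trans_le (by simp [Formula.size])
  | nand A B => simp only [Formula.out, Formula.size]; omega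

theorem Formula.plainVals_gates (A : Formula) {θ : ℕ → ℕ} {ρ : ℕ → Bool} {vals : List Bool}
    (hθ : ∀ w, θ w < vals.length) (hρ : ∀ w, wire vals (θ w) = ρ w) :
    ∃ ext, plainVals (A.gates θ vals.length) vals = vals ++ ext ∧ ext.length = A.size ∧
      wire (vals ++ ext) (A.out θ vals.length) = A.eval ρ := by
  induction A generalizing vals with
  | var w => exact ⟨[], by simp [Formula.gates, plainVals, runGates], rfl, by
      simpa [Formula.out, Formula.eval] using hρ w⟩
  | nand A B ihA ihB =>
    obtain ⟨e, h1, h2, h3⟩ := ihA hθ hρ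
    obtain ⟨e', h4, h5, h6⟩ := ihB (vals := vals ++ e)
      (fun w => (hθ w).trans_le (by simp)) (fun w => by rw [wire_append (hθ w), hρ])
    rw [List.length_append, h2] at h4 h6
    refine ⟨e ++ e' ++ [!(A.eval ρ && B.eval ρ)], ?_, by simp [h2, h5, Formula.size, add_assoc], ?_⟩
    · rw [Formula.gates, plainVals_append, plainVals_append, h1, h4, plainVals, runGates, runGates,
        h6, wire_append, h3]
      · simp
      · rw [List.length_append, h2]
        exact A.out_lt hθ
    · have := wire_concat (vals ++ e ++ e') (!(A.eval ρ && B.eval ρ))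
      rw [List.length_append, List.length_append, h2, h5] at this
      rwa [Formula.out, Formula.eval, ← List.append_assoc, ← List.append_assoc]

theorem Formula.plain_gates (A : Formula) (θ : ℕ → ℕ) (b : ℕ) : ∀ g ∈ A.gates θ b, g.Plain := by
  induction A generalizing b with
  | var w => simp [Formula.gates]
  | nand A B ihA ihB =>
    intro g hg
    simp only [Formula.gates, List.mem_append, List.mem_singleton] at hg
    rcases hg with (hg | hg) | rfl
    · exact ihA _ g hg
    · exact ihB _ g hg
    · trivial

theorem PT.formulaOut (A : Formula) {γ : Type} [Rep γ] {θ : γ → ℕ → ℕ} {b : γ → ℕ}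
    (hθ : ∀ w, PT fun c => θ c w) (hb : PT b) : PT fun c => A.out (θ c) (b c) := by
  cases A with
  | var w => exact hθ w
  | nand A B => unfold Formula.out; fun_prop

theorem PT.formulaGates (A : Formula) {γ : Type} [Rep γ] {θ : γ → ℕ → ℕ} {b : γ → ℕ}
    (hθ : ∀ w, PT fun c => θ c w) (hb : PT b) : PT fun c => A.gates (θ c) (b c) := by
  induction A generalizing b with
  | var w => exact PT.const _
  | nand A B ihA ihB =>
    have h1 := ihA hb
    have h2 := ihB (b := fun c => b c + A.size) (by fun_prop)
    have h3 := PT.formulaOut A hθ hb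
    have h4 := PT.formulaOut B (b := fun c => b c + A.size) hθ (by fun_prop)
    unfold Formula.gates
    fun_prop

/-! ### Lists of formulas -/

/-- The gates that compute a list of formulas. -/
def bankGates (θ : ℕ → ℕ) : ℕ → List Formula → List Gate
  | _, [] => []
  | b, A :: As => A.gates θ b ++ bankGates θ (b + A.size) As

/-- The output wires of a list of formulas, none of which is a variable. -/
def bankOuts : ℕ → List Formula → List ℕ
  | _, [] => []
  | b, A :: As => (b + A.size - 1) :: bankOuts (b + A.size) As

/-- The number of gates of a list of formulas. -/
def bankSize (As : List Formula) : ℕ := (As.map Formula.size).sum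

theorem bankOuts_lt {As : List Formula} (hA : ∀ A ∈ As, A.size ≠ 0) (b : ℕ) :
    ∀ w ∈ bankOuts b As, w < b + bankSize As := by
  induction As generalizing b with
  | nil => simp [bankOuts]
  | cons A As ih =>
    intro w hw
    simp only [bankOuts, List.mem_cons] at hw
    have hs : bankSize (A :: As) = A.size + bankSize As := by simp [bankSize]
    rcases hw with rfl | hw
    · have := hA A (by simp)
      omega
    · have := ih (fun A h => hA A (by simp [h])) _ w hw
      omega

/-- A formula of nonzero size has its output on the last gate of its own block, at an address that
depends on sizes only. Wires in the big circuit can therefore be located by arithmetic. -/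
theorem plainVals_bankGates {As : List Formula} (hA : ∀ A ∈ As, A.size ≠ 0) {θ : ℕ → ℕ}
    {ρ : ℕ → Bool} {vals : List Bool} (hθ : ∀ w, θ w < vals.length)
    (hρ : ∀ w, wire vals (θ w) = ρ w) :
    ∃ ext, plainVals (bankGates θ vals.length As) vals = vals ++ ext ∧
      ext.length = bankSize As ∧
      (bankOuts vals.length As).map (wire (vals ++ ext)) = As.map (Formula.eval ρ) := by
  induction As generalizing vals with
  | nil => exact ⟨[], by simp [bankGates, plainVals, runGates], rfl, rfl⟩
  | cons A As ih =>
    obtain ⟨e, h1, h2, h3⟩ := A.plainVals_gates hθ hρ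
    obtain ⟨e', h4, h5, h6⟩ := ih (fun A h => hA A (by simp [h])) (vals := vals ++ e)
      (fun w => (hθ w).trans_le (by simp)) (fun w => by rw [wire_append (hθ w), hρ])
    rw [List.length_append, h2] at h4 h6
    refine ⟨e ++ e', ?_, by simp [h2, h5, bankSize], ?_⟩
    · rw [bankGates, plainVals_append, h1, h4, List.append_assoc]
    · have hA' := hA A (by simp)
      have hout : A.out θ vals.length = vals.length + A.size - 1 := by
        cases A with
        | var w => exact absurd rfl hA'
        | nand A B => simp only [Formula.out, Formula.size]; omega
      rw [bankOuts, List.map_cons, List.map_cons, ← List.append_assoc, h6, wire_append, ← hout, h3]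
      rw [List.length_append, h2]
      omega

theorem plain_bankGates (θ : ℕ → ℕ) (b : ℕ) (As : List Formula) :
    ∀ g ∈ bankGates θ b As, g.Plain := by
  induction As generalizing b with
  | nil => simp [bankGates]
  | cons A As ih =>
    intro g hg
    rcases List.mem_append.1 hg with hg | hg
    · exact A.plain_gates _ _ g hg
    · exact ih _ g hg

theorem PT.bankGates (As : List Formula) {γ : Type} [Rep γ] {θ : γ → ℕ → ℕ} {b : γ → ℕ}
    (hθ : ∀ w, PT fun c => θ c w) (hb : PT b) : PT fun c => bankGates (θ c) (b c) As := by
  induction As generalizing b with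
  | nil => exact PT.const _
  | cons A As ih => exact (PT.formulaGates A hθ hb).append (ih (by fun_prop))

@[fun_prop]
theorem PT.bankOuts (As : List Formula) {γ : Type} [Rep γ] {b : γ → ℕ} (hb : PT b) :
    PT fun c => bankOuts (b c) As := by
  induction As generalizing b with
  | nil => exact PT.const _
  | cons A As ih =>
    have := ih (b := fun c => b c + A.size) (by fun_prop)
    unfold TotalSearch.bankOuts
    fun_prop

/-! ### Cellular automata as circuits -/

/-- The neighbourhood of position `i` in a row of `W` cells: the cell at position `0`, the cell
itself and its neighbours. -/
def neighbours {α : Type} (cell : ℕ → List α) (W i : ℕ) : List α :=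
  cell 0 ++ cell (i - 1) ++ cell i ++ cell (min (i + 1) (W - 1))

/-- The gates that compute a row of cells from the preceding row; `z` is a wire with value `0`. -/
def rowGates (As : List Formula) (z W : ℕ) (prev : ℕ → List ℕ) (b : ℕ) : List Gate :=
  (List.range W).flatMap fun i =>
    bankGates (fun w => (neighbours prev W i).getD w z) (b + i * bankSize As) As

theorem plainVals_rowGates {As : List Formula} (hA : ∀ A ∈ As, A.size ≠ 0) {z W : ℕ}
    {prev : ℕ → List ℕ} {cell : ℕ → List Bool} {vals : List Bool} (hz : z < vals.length)
    (hz0 : wire vals z = false) (hp : ∀ i < W, ∀ w ∈ prev i, w < vals.length)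
    (hc : ∀ i < W, (prev i).map (wire vals) = cell i) :
    ∃ ext, plainVals (rowGates As z W prev vals.length) vals = vals ++ ext ∧
      ext.length = W * bankSize As ∧ ∀ i < W,
        (bankOuts (vals.length + i * bankSize As) As).map (wire (vals ++ ext)) =
          As.map (Formula.eval fun w => (neighbours cell W i).getD w false) := by
  suffices ∀ n ≤ W, ∃ ext, plainVals ((List.range n).flatMap fun i =>
      bankGates (fun w => (neighbours prev W i).getD w z) (vals.length + i * bankSize As) As)
        vals = vals ++ ext ∧ ext.length = n * bankSize As ∧ ∀ i < n,
        (bankOuts (vals.length + i * bankSize As) As).map (wire (vals ++ ext)) =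
          As.map (Formula.eval fun w => (neighbours cell W i).getD w false) from this W le_rfl
  intro n hn
  induction n with
  | zero => exact ⟨[], by simp [plainVals, runGates], by simp, by simp⟩
  | succ n ih =>
    obtain ⟨e, h1, h2, h3⟩ := ih (by omega)
    have hmem : ∀ w ∈ neighbours prev W n, w < vals.length := by
      intro w hw
      simp only [neighbours, List.mem_append] at hw
      rcases hw with ((hw | hw) | hw) | hw
      · exact hp _ (by omega) w hw
      · exact hp _ (by omega) w hw
      · exact hp _ (by omega) w hw
      · exact hp _ (by omega) w hw
    have hθ : ∀ w, (neighbours prev W n).getD w z < vals.length := by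
      intro w
      by_cases h : w < (neighbours prev W n).length
      · rw [List.getD_eq_getElem _ _ h]
        exact hmem _ (List.getElem_mem h)
      · rw [List.getD_eq_default _ _ (by omega)]
        exact hz
    have hn' : (neighbours prev W n).map (wire vals) = neighbours cell W n := by
      simp only [neighbours, List.map_append]
      rw [hc _ (by omega), hc _ (by omega), hc _ (by omega), hc _ (by omega)]
    obtain ⟨e', h4, h5, h6⟩ := plainVals_bankGates hA (vals := vals ++ e)
      (θ := fun w => (neighbours prev W n).getD w z)
      (ρ := fun w => (neighbours cell W n).getD w false)
      (fun w => (hθ w).trans_le (by simp)) (fun w => by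
        rw [wire_append (hθ w), ← hn', ← hz0, List.getD_map])
    rw [List.length_append, h2] at h4 h6
    refine ⟨e ++ e', ?_, by simp [h2, h5]; ring, fun i hi => ?_⟩
    · rw [List.range_succ, List.flatMap_append, plainVals_append, h1, ← List.append_assoc, ← h4]
      simp
    · rw [← List.append_assoc]
      rcases Nat.lt_succ_iff_lt_or_eq.1 hi with hi | rfl
      · rw [← h3 i hi]
        refine List.map_congr_left fun w hw => wire_append ?_ _
        have := bankOuts_lt hA _ w hw
        have h7 : (i + 1) * bankSize As ≤ n * bankSize As := Nat.mul_le_mul_right _ hi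
        rw [List.length_append, h2]
        rw [add_mul, one_mul] at h7
        omega
      · exact h6

/-- The wires of a cell at time `t` and position `i`. -/
def cellWires (As : List Formula) (W b : ℕ) (init : ℕ → List ℕ) (t i : ℕ) : List ℕ :=
  if t = 0 then init i else bankOuts (b + (t - 1) * (W * bankSize As) + i * bankSize As) As

/-- The gates of the first `T` rows. -/
def tableGates (As : List Formula) (z W b : ℕ) (init : ℕ → List ℕ) (T : ℕ) : List Gate :=
  (List.range T).flatMap fun t =>
    rowGates As z W (cellWires As W b init t) (b + t * (W * bankSize As))

/-- Rows are added by induction on time. That the wires of the last row already exist is part of the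
claim, because the next row has to be connected to them. -/
theorem plainVals_tableGates {As : List Formula} (hA : ∀ A ∈ As, A.size ≠ 0) {z W : ℕ}
    {init : ℕ → List ℕ} {cell : ℕ → ℕ → List Bool} {vals : List Bool} (hz : z < vals.length)
    (hz0 : wire vals z = false) (hi : ∀ i < W, ∀ w ∈ init i, w < vals.length)
    (h0 : ∀ i < W, (init i).map (wire vals) = cell 0 i) (T : ℕ)
    (hs : ∀ t < T, ∀ i < W, As.map (Formula.eval fun w => (neighbours (cell t) W i).getD w false) =
      cell (t + 1) i) :
    ∃ ext, plainVals (tableGates As z W vals.length init T) vals = vals ++ ext ∧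
      ext.length = T * (W * bankSize As) ∧
      (∀ i < W, ∀ w ∈ cellWires As W vals.length init T i, w < (vals ++ ext).length) ∧ ∀ i < W,
        (cellWires As W vals.length init T i).map (wire (vals ++ ext)) = cell T i := by
  induction T with
  | zero =>
    refine ⟨[], by simp [tableGates, plainVals, runGates], by simp, ?_, ?_⟩
    · simpa [cellWires] using hi
    · simpa [cellWires] using h0
  | succ T ih =>
    obtain ⟨e, h1, h2, h3, h4⟩ := ih fun t ht => hs t (by omega)
    obtain ⟨e', h5, h6, h7⟩ := plainVals_rowGates hA (vals := vals ++ e)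
      (hz.trans_le (by simp)) (by rw [wire_append hz, hz0]) h3 h4
    rw [List.length_append, h2] at h5 h7
    refine ⟨e ++ e', ?_, by simp [h2, h6]; ring, fun i hi w hw => ?_, fun i hi => ?_⟩
    · rw [tableGates, List.range_succ, List.flatMap_append, plainVals_append, ← tableGates, h1,
        ← List.append_assoc, ← h5]
      simp
    · rw [cellWires, if_neg (by omega)] at hw
      have := bankOuts_lt hA _ w hw
      have h8 : (i + 1) * bankSize As ≤ W * bankSize As := Nat.mul_le_mul_right _ hi
      rw [add_mul, one_mul] at h8
      rw [List.length_append, List.length_append, h2, h6]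
      simp only [Nat.add_sub_cancel] at this
      omega
    · rw [← List.append_assoc, cellWires, if_neg (by omega), ← hs T (by omega) i hi]
      exact h7 i hi

theorem plain_tableGates (As : List Formula) (z W b : ℕ) (init : ℕ → List ℕ) (T : ℕ) :
    ∀ g ∈ tableGates As z W b init T, g.Plain := by
  intro g hg
  simp only [tableGates, rowGates, List.mem_flatMap] at hg
  obtain ⟨t, -, i, -, hg⟩ := hg
  exact plain_bankGates _ _ _ g hg

theorem PT.cellWires (As : List Formula) {γ : Type} [Rep γ] {W b t i : γ → ℕ}
    {init : γ → ℕ → List ℕ} (hW : PT W) (hb : PT b) (ht : PT t) (hi : PT i)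
    (hinit : PT fun c : γ × ℕ => init c.1 c.2) :
    PT fun c => cellWires As (W c) (b c) (init c) (t c) (i c) := by
  unfold TotalSearch.cellWires
  have : PT fun c => init c (i c) :=
    PT.comp (f := fun c : γ × ℕ => init c.1 c.2) (g := fun c => (c, i c)) hinit (by fun_prop)
  fun_prop

theorem PT.tableGates (As : List Formula) {γ : Type} [Rep γ] {z W b T : γ → ℕ}
    {init : γ → ℕ → List ℕ} (hz : PT z) (hW : PT W) (hb : PT b) (hT : PT T)
    (hinit : PT fun c : γ × ℕ => init c.1 c.2) :
    PT fun c => tableGates As (z c) (W c) (b c) (init c) (T c) := by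
  have hc : ∀ j : (γ × ℕ) × ℕ → ℕ, PT j → PT fun c : (γ × ℕ) × ℕ =>
      TotalSearch.cellWires As (W c.1.1) (b c.1.1) (init c.1.1) c.1.2 (j c) := fun j hj =>
    PT.cellWires As (init := fun c : (γ × ℕ) × ℕ => init c.1.1) (by fun_prop) (by fun_prop)
      (by fun_prop) hj (PT.comp (f := fun c : γ × ℕ => init c.1 c.2)
        (g := fun c : ((γ × ℕ) × ℕ) × ℕ => (c.1.1.1, c.2)) hinit (by fun_prop))
  refine PT.flatMap (F := fun c : γ × ℕ => TotalSearch.rowGates As (z c.1) (W c.1)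
    (TotalSearch.cellWires As (W c.1) (b c.1) (init c.1) c.2)
    (b c.1 + c.2 * (W c.1 * bankSize As))) hT.range ?_
  refine PT.flatMap (F := fun c : (γ × ℕ) × ℕ => TotalSearch.bankGates (fun w => (neighbours
    (TotalSearch.cellWires As (W c.1.1) (b c.1.1) (init c.1.1) c.1.2) (W c.1.1) c.2).getD w
      (z c.1.1)) (b c.1.1 + c.1.2 * (W c.1.1 * bankSize As) + c.2 * bankSize As) As)
      (by fun_prop) ?_
  refine PT.bankGates As (fun w => ?_) (by fun_prop)
  have hmin : PT fun c : (γ × ℕ) × ℕ => min (c.2 + 1) (W c.1.1 - 1) := by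
    simp only [min_def]
    fun_prop
  have h1 := hc (fun _ => 0) (by fun_prop)
  have h2 := hc (fun c => c.2 - 1) (by fun_prop)
  have h3 := hc (fun c => c.2) (by fun_prop)
  have h4 := hc _ hmin
  unfold neighbours
  exact PT.getD (((h1.append h2).append h3).append h4) (PT.const _) (by fun_prop)

end TotalSearch

/-! ### Runs of programs as cellular automata; circuits for polynomial-time functions. -/

namespace TotalSearch

/-! ## Computations as cellular automata -/

/-- The cell at position `i` of a configuration: whether it is the first one, the control state,
and the entries of the stacks. -/
noncomputable def cellBits (P : Prog) (x : List Prog × Store) (i : ℕ) : List Bool :=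
  decide (i = 0) :: ((List.range (controls P).length).map (fun j => decide (ctlIdx P x.1 = j)) ++
    (List.range P.bound).flatMap fun r => [decide (i < (x.2 r).length), (x.2 r).getD i false])

/-- The number of bits in a cell. -/
def cellLength (P : Prog) : ℕ := 1 + ((controls P).length + P.bound * 2)

theorem cellBits_length (P : Prog) (x : List Prog × Store) (i : ℕ) :
    (cellBits P x i).length = cellLength P := by
  simp [cellBits, cellLength, List.length_flatMap]
  omega

/-- Two bits per stack entry, presence and value, distinguish a missing entry from the bit `false`.
-/
theorem cellBits_eq {P : Prog} {x y : List Prog × Store} {i j : ℕ}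
    (hx : x.1 ∈ controls P) (hy : y.1 ∈ controls P) (h : cellBits P x i = cellBits P y j) :
    (i = 0 ↔ j = 0) ∧ x.1 = y.1 ∧ ∀ r < P.bound, (x.2 r)[i]? = (y.2 r)[j]? := by
  simp only [cellBits, List.cons.injEq] at h
  obtain ⟨h1, h2⟩ := h
  obtain ⟨h3, h4⟩ := List.append_inj h2 (by simp)
  refine ⟨by simpa using h1, ?_, fun r hr => ?_⟩
  · have := List.map_inj_left.1 h3 (ctlIdx P x.1) (by simpa using ctlIdx_lt hx)
    simp only [decide_true, true_eq_decide_iff] at this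
    exact (ctlIdx_inj hy hx this).symm
  · have key : ∀ (n : ℕ) (f g : ℕ → List Bool), (∀ r, (f r).length = 2) → (∀ r, (g r).length = 2) →
        (List.range n).flatMap f = (List.range n).flatMap g → ∀ r < n, f r = g r := by
      intro n f g hf hg
      induction n with
      | zero => simp
      | succ n ih =>
        intro h r hr
        rw [List.range_succ, List.flatMap_append, List.flatMap_append] at h
        obtain ⟨h5, h6⟩ := List.append_inj h (by simp [List.length_flatMap, hf, hg])
        rcases Nat.lt_succ_iff_lt_or_eq.1 hr with hr | rfl
        · exact ih h5 r hr
        · simpa using h6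
    have h5 := key _ _ _ (by simp) (by simp) h4 r hr
    simp only [List.cons.injEq, decide_eq_decide, and_true] at h5
    by_cases hi : i < (x.2 r).length
    · have hj := h5.1.1 hi
      rw [List.getElem?_eq_getElem hi, List.getElem?_eq_getElem hj]
      rw [List.getD_eq_getElem _ _ hi, List.getD_eq_getElem _ _ hj] at h5
      rw [h5.2]
    · have hj : ¬ j < (y.2 r).length := fun hj => hi (h5.1.2 hj)
      rw [List.getElem?_eq_none (by omega), List.getElem?_eq_none (by omega)]

theorem cellBits_congr {P : Prog} {x y : List Prog × Store} {i j : ℕ} (h0 : i = 0 ↔ j = 0)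
    (h1 : x.1 = y.1) (h2 : ∀ r < P.bound, (x.2 r)[i]? = (y.2 r)[j]?) :
    cellBits P x i = cellBits P y j := by
  have h3 : ∀ r < P.bound, (i < (x.2 r).length ↔ j < (y.2 r).length) := by
    intro r hr
    have := h2 r hr
    rw [← not_iff_not, not_lt, not_lt, ← List.getElem?_eq_none_iff, ← List.getElem?_eq_none_iff,
      this]
  simp only [cellBits, h0, h1, List.cons.injEq, true_and, List.append_cancel_left_eq,
    List.flatMap]
  congr 1
  refine List.map_congr_left fun r hr => ?_
  have hr := List.mem_range.1 hr
  simp only [h3 r hr, List.getD_eq_getElem?_getD, h2 r hr]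

theorem Prog.bound_pos (P : Prog) : 0 < P.bound := by
  induction P <;> simp only [Prog.bound] <;> omega

/-- The four cells on which the next content of cell `i` depends. -/
noncomputable def neighbourhood (P : Prog) (x : List Prog × Store) (i : ℕ) : List Bool :=
  cellBits P x 0 ++ cellBits P x (i - 1) ++ cellBits P x i ++ cellBits P x (i + 1)

theorem getElem?_cons_sub {a : Bool} {l : List Bool} {i : ℕ} :
    (a :: l)[i]? = if i = 0 then some a else l[i - 1]? := by
  cases i <;> simp

/-- Locality of computation. A push or pop shifts a stack by one place, so entry `i` depends on its
neighbours; the new control state depends on the top of a stack, which lies in cell `0`, and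
therefore that cell belongs to every neighbourhood. The control state is repeated in every cell, and
the flag `i = 0` shows where a pushed bit appears. -/
theorem cellBits_smallStep {P : Prog} {x y : List Prog × Store} {i j : ℕ}
    (hx : x.1 ∈ controls P) (hy : y.1 ∈ controls P)
    (h : neighbourhood P x i = neighbourhood P y j) :
    cellBits P (smallStep noOracle x) i = cellBits P (smallStep noOracle y) j := by
  obtain ⟨h', h3⟩ := List.append_inj h (by simp [cellBits_length])
  obtain ⟨h', h2⟩ := List.append_inj h' (by simp [cellBits_length])
  obtain ⟨h0, h1⟩ := List.append_inj h' (by simp [cellBits_length])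
  replace h0 := (cellBits_eq hx hy h0).2.2
  replace h1 := (cellBits_eq hx hy h1).2.2
  replace h3 := (cellBits_eq hx hy h3).2.2
  obtain ⟨hij, hc, h2'⟩ := cellBits_eq hx hy h2
  clear h h' h2
  rename' h2' => h2
  obtain ⟨c, σ⟩ := x
  obtain ⟨d, τ⟩ := y
  simp only at hc hx hy h0 h1 h2 h3
  subst hc
  have hreg : ctlReg c < P.bound := by
    have hb := bound_of_mem_controls hx
    have := P.bound_pos
    cases c with
    | nil => simpa [ctlReg] using this
    | cons Q ks =>
      have := hb Q (by simp)
      cases Q <;> simp only [ctlReg, Prog.bound] at * <;> omega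
  refine cellBits_congr hij ?_ fun r hr => ?_
  · simp only [smallStep, List.head?_eq_getElem?, h0 _ hreg]
  · rcases c with _ | ⟨Q, ks⟩
    · exact h2 r hr
    · cases Q with
      | push s b =>
        simp only [smallStep, storeStep, Function.update_apply]
        split_ifs with hrs
        · subst hrs
          rw [getElem?_cons_sub, getElem?_cons_sub, h1 _ hr]
          simp only [hij]
        · exact h2 r hr
      | pop s =>
        simp only [smallStep, storeStep, Function.update_apply]
        split_ifs with hrs
        · subst hrs
          rw [List.getElem?_tail, List.getElem?_tail, h3 _ hr]
        · exact h2 r hr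
      | query r' s =>
        simp only [smallStep, storeStep, Function.update_apply, noOracle]
        split_ifs with hrs
        · simp
        · exact h2 r hr
      | skip => exact h2 r hr
      | seq Q S => exact h2 r hr
      | branch r' Q S T => exact h2 r hr
      | loop r' Q => exact h2 r hr

/-- By `cellBits_smallStep` each bit of the next cell is a well-defined Boolean function of the
finitely many bits of the neighbourhood, hence given by a formula. -/
theorem exists_local_rule (P : Prog) : ∃ As : List Formula, (∀ A ∈ As, A.size ≠ 0) ∧
    ∀ (x : List Prog × Store) (i : ℕ), x.1 ∈ controls P →
      As.map (Formula.eval fun w => (neighbourhood P x i).getD w false) =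
        cellBits P (smallStep noOracle x) i := by
  classical
  have hlen : ∀ x i, (neighbourhood P x i).length = 4 * cellLength P := by
    intro x i
    simp only [neighbourhood, List.length_append, cellBits_length]
    omega
  have key : ∀ e, ∃ A : Formula, A.size ≠ 0 ∧ ∀ (x : List Prog × Store) (i : ℕ),
      x.1 ∈ controls P → A.eval (fun w => (neighbourhood P x i).getD w false) =
        (cellBits P (smallStep noOracle x) i).getD e false := by
    intro e
    let p : (ℕ → Bool) → (List Prog × Store) × ℕ → Prop := fun ρ x =>
      x.1.1 ∈ controls P ∧ ∀ w < 4 * cellLength P, ρ w = (neighbourhood P x.1 x.2).getD w false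
    -- Any configuration with the given bits serves, since locality makes the result independent of
    -- the choice; bit patterns that do not occur get the value `false`.
    let f : (ℕ → Bool) → Bool := fun ρ =>
      if h : ∃ x, p ρ x then (cellBits P (smallStep noOracle h.choose.1) h.choose.2).getD e false
      else false
    have hp : ∀ ρ ρ' : ℕ → Bool, (∀ w < 4 * cellLength P, ρ w = ρ' w) → p ρ = p ρ' := by
      intro ρ ρ' h
      funext x
      exact propext (and_congr_right fun _ => forall₂_congr fun w hw => by rw [h w hw])
    obtain ⟨A, hA⟩ := Formula.exists_eval_eq (4 * cellLength P) f fun ρ ρ' h => by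
      simp only [f, hp ρ ρ' h]
    -- A double negation, to exclude a bare variable and make the size nonzero.
    refine ⟨.nand (.nand A A) (.nand A A), by simp [Formula.size], fun x i hx => ?_⟩
    have h : ∃ y, p (fun w => (neighbourhood P x i).getD w false) y := ⟨(x, i), hx, fun w _ => rfl⟩
    have h1 := h.choose_spec
    simp only [Formula.eval, Bool.and_self, Bool.not_not, hA]
    simp only [f, dif_pos h]
    rw [cellBits_smallStep h1.1 hx]
    refine List.ext_getElem (by rw [hlen, hlen]) fun w hw hw' => ?_
    have := h1.2 w (by rwa [hlen] at hw)
    simp only at this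
    rw [← List.getD_eq_getElem _ false hw, ← this, List.getD_eq_getElem _ _ hw']
  choose A hA using key
  refine ⟨(List.range (cellLength P)).map A, by simpa using fun e _ => (hA e).1, fun x i hx => ?_⟩
  refine List.ext_getElem (by simp [cellBits_length]) fun e h1 h2 => ?_
  rw [List.getElem_map, List.getElem_map, List.getElem_range, (hA e).2 x i hx,
    List.getD_eq_getElem _ _ h2]

theorem smallStep_mem_controls {P : Prog} {b : List Bool → List Bool} {x : List Prog × Store}
    (hx : x.1 ∈ controls P) (n : ℕ) : ((smallStep b)^[n] x).1 ∈ controls P := by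
  induction n with
  | zero => exact hx
  | succ n ih =>
    rw [Function.iterate_succ_apply']
    exact nextCtl_mem_controls ih _

theorem length_smallStep_le (x : List Prog × Store) (r n : ℕ) :
    (((smallStep noOracle)^[n] x).2 r).length ≤ (x.2 r).length + n := by
  induction n with
  | zero => simp
  | succ n ih =>
    rw [Function.iterate_succ_apply']
    refine le_trans (?_ : _ ≤ (((smallStep noOracle)^[n] x).2 r).length + 1) (by omega)
    set y := (smallStep noOracle)^[n] x
    have hn : ∀ l, (noOracle l).length = 0 := fun _ => rfl
    rw [smallStep]
    unfold storeStep
    split <;> try simp only [Function.update_apply]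
    all_goals first | omega | (split_ifs with h <;> simp [hn, h] <;> omega)

/-- Polynomial-time computations as circuits. -/
theorem PT.exists_circuits {F : List Bool × List Bool → List Bool} (hF : PT F) (N : Polynomial ℕ)
    (hlen : ∀ x s, s.length = N.eval x.length → (F (x, s)).length = 2 * N.eval x.length) :
    ∃ gen : List Bool → Circuit, PT gen ∧ ∀ x, (gen x).Plain ∧
      (gen x).inputs = N.eval x.length ∧ (gen x).outputs.length = 2 * N.eval x.length ∧
      ∀ s, s.length = N.eval x.length → (gen x).eval s = F (x, s) := by
  obtain ⟨P, p, -, hP⟩ := hF.fp2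
  obtain ⟨As, hA, hrule⟩ := exists_local_rule P
  let n : List Bool → ℕ := fun x => N.eval x.length
  -- The factor two converts program steps into small steps. The width then exceeds the length of
  -- every stack during `T x` steps and leaves room for the `2 * n x` output cells.
  let T : List Bool → ℕ := fun x => 2 * p.eval (x.length + n x)
  let W : List Bool → ℕ := fun x => x.length + n x + T x + 2 + 2 * n x
  -- Wires `n x` and `n x + 1` carry the constants `0` and `1`. The string `x` on stack `0` is
  -- hard-wired by them; stack `1` is connected to the circuit inputs.
  let init : List Bool → ℕ → List ℕ := fun x i =>
    (if i = 0 then n x + 1 else n x) ::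
      ((List.range (controls P).length).map (fun j => if ctlIdx P [P] = j then n x + 1 else n x) ++
        (List.range P.bound).flatMap fun r =>
          [if r = 0 then (if i < x.length then n x + 1 else n x) else
            if r = 1 then (if i < n x then n x + 1 else n x) else n x,
          if r = 0 then (if x.getD i false = true then n x + 1 else n x) else
            if r = 1 then (if i < n x then i else n x) else n x])
  let gen : List Bool → Circuit := fun x =>
    ⟨n x, .const false :: .const true :: TotalSearch.tableGates As (n x) (W x) (n x + 2) (init x) (T x),
      (List.range (2 * n x)).map fun j =>
        -- The value bit of stack `0` within a cell: it comes after the position flag, the control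
        -- bits and the presence bit.
        (TotalSearch.cellWires As (W x) (n x + 2) (init x) (T x) j).getD (1 + (controls P).length + 1) 0⟩
  have hn : PT n := by fun_prop
  have hT : PT T := by fun_prop
  have hW : PT W := by fun_prop
  have hinit : PT fun c : List Bool × ℕ => init c.1 c.2 := by
    have h1 : PT fun c : List Bool × ℕ => (List.range (controls P).length).map
        (fun j => if ctlIdx P [P] = j then n c.1 + 1 else n c.1) :=
      PT.map (F := fun c : (List Bool × ℕ) × ℕ => if ctlIdx P [P] = c.2 then n c.1.1 + 1 else n c.1.1)
        (by fun_prop) (by fun_prop)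
    have h2 := PT.flatMap (γ := List Bool × ℕ) (l := fun _ => List.range P.bound)
      (F := fun c : (List Bool × ℕ) × ℕ =>
        [if c.2 = 0 then (if c.1.2 < c.1.1.length then n c.1.1 + 1 else n c.1.1) else
            if c.2 = 1 then (if c.1.2 < n c.1.1 then n c.1.1 + 1 else n c.1.1) else n c.1.1,
          if c.2 = 0 then (if c.1.1.getD c.1.2 false = true then n c.1.1 + 1 else n c.1.1) else
            if c.2 = 1 then (if c.1.2 < n c.1.1 then c.1.2 else n c.1.1) else n c.1.1])
        (by fun_prop) (by fun_prop)
    fun_prop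
  have hinit' : ∀ {δ : Type} [Rep δ] {g : δ → List Bool} {j : δ → ℕ}, PT g → PT j →
      PT fun c => init (g c) (j c) := fun {δ _ g j} hg hj =>
    PT.comp (f := fun c : List Bool × ℕ => init c.1 c.2) (g := fun c => (g c, j c)) hinit
      (by fun_prop)
  refine ⟨gen, ?_, fun x => ⟨?_, rfl, by simp [gen, n], fun s hs => ?_⟩⟩
  · have h1 : PT fun x => TotalSearch.tableGates As (n x) (W x) (n x + 2) (init x) (T x) :=
      PT.tableGates As (by fun_prop) (by fun_prop) (by fun_prop) (by fun_prop) hinit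
    have h2 : PT fun c : List Bool × ℕ =>
        TotalSearch.cellWires As (W c.1) (n c.1 + 2) (init c.1) (T c.1) c.2 :=
      PT.cellWires As (init := fun c : List Bool × ℕ => init c.1) (by fun_prop) (by fun_prop)
        (by fun_prop) (by fun_prop) (hinit' (by fun_prop) (by fun_prop))
    have h3 := PT.map (l := fun x => List.range (2 * n x)) (F := fun c : List Bool × ℕ =>
        (TotalSearch.cellWires As (W c.1) (n c.1 + 2) (init c.1) (T c.1) c.2).getD
          (1 + (controls P).length + 1) 0) (by fun_prop) (by fun_prop)
    exact PT.circuitMk hn ((PT.const _).cons ((PT.const _).cons h1)) h3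
  · intro g hg
    simp only [gen, List.mem_cons] at hg
    rcases hg with rfl | rfl | hg
    · trivial
    · trivial
    · exact plain_tableGates _ _ _ _ _ _ g hg
  · obtain ⟨σ, t, hr, ht, hσ⟩ := hP x s
    have hsn : s.length = n x := hs
    rw [hsn] at ht
    have hend := hr.smallStep_of_le (n := T x) (Nat.mul_le_mul_left 2 ht)
    let y : ℕ → List Prog × Store := fun t =>
      (TotalSearch.smallStep noOracle)^[t] ([P], fun i => [x, s].getD i [])
    have hy : ∀ t, (y t).1 ∈ controls P := fun t => smallStep_mem_controls (mem_controls P) t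
    have hvl : (s ++ [false, true]).length = n x + 2 := by simp [hsn]
    have hf : wire (s ++ [false, true]) (n x) = false := by
      rw [wire, List.getD_append_right _ _ _ _ hsn.le, hsn]; simp
    have htr : wire (s ++ [false, true]) (n x + 1) = true := by
      rw [wire, List.getD_append_right _ _ _ _ (by omega), hsn]; simp
    have hs' : ∀ i < n x, wire (s ++ [false, true]) i = s.getD i false := by
      intro i hi
      rw [wire_append (by omega)]
      rfl
    have hk : ∀ p : Prop, ∀ [Decidable p], wire (s ++ [false, true]) (if p then n x + 1 else n x) =
        decide p := by
      intro p _
      split_ifs with h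
      · simp [htr, h]
      · simp [hf, h]
    obtain ⟨ext, h1, h2, h3, h4⟩ := plainVals_tableGates hA (z := n x) (W := W x) (init := init x)
      (cell := fun t i => cellBits P (y t) i) (vals := s ++ [false, true]) (by omega) hf
      (by
        intro i hi w hw
        rw [hvl]
        simp only [init, List.mem_cons, List.mem_append, List.mem_map, List.mem_flatMap,
          List.not_mem_nil, or_false] at hw
        rcases hw with rfl | ⟨j, -, rfl⟩ | ⟨r, -, rfl | rfl⟩ <;> split_ifs <;> omega)
      (by
        intro i hi
        simp only [init, cellBits, y, Function.iterate_zero, _root_.id, List.map_cons,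
          List.map_append, List.map_map, List.map_flatMap, hk, Function.comp_def, List.map_nil]
        congr 2
        simp only [List.flatMap]
        congr 1
        refine List.map_congr_left fun r _ => ?_
        rcases r with _ | _ | r
        · simp [hk]
        · simp only [List.getD_cons_succ, List.getD_cons_zero, Nat.zero_add, if_true,
            one_ne_zero, if_false, hk, hsn]
          congr 2
          split_ifs with hi'
          · exact hs' i hi'
          · rw [hf, List.getD_eq_default _ _ (by omega)]
        · simp [hf])
      (T x) (by
        intro t ht i hi
        have := hrule (y t) i (hy t)
        have hstep : TotalSearch.smallStep noOracle (y t) = y (t + 1) := by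
          simp only [y, Function.iterate_succ_apply']
        rw [hstep] at this
        rw [← this]
        congr 2
        funext w
        congr 1
        rw [neighbours, neighbourhood]
        congr 1
        -- At the right border a cell stands in for its missing neighbour. This is harmless because
        -- no stack reaches that far, so both cells have the same content.
        by_cases hiW : i + 1 ≤ W x - 1
        · rw [min_eq_left hiW]
        · rw [min_eq_right (by omega)]
          have hl : ∀ r, ((y t).2 r).length ≤ W x - 1 := by
            intro r
            have := length_smallStep_le ([P], fun i => [x, s].getD i []) r t
            have h5 : ([x, s].getD r []).length ≤ x.length + n x := by
              rcases r with _ | _ | r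
              · simp
              · simp [hsn]
              · simp
            simp only [W]
            simp only at this
            change ((y t).2 r).length ≤ _ at this
            omega
          have hW2 : 2 ≤ W x := by simp only [W]; omega
          refine cellBits_congr (by omega) rfl fun r _ => ?_
          rw [List.getElem?_eq_none (hl r), List.getElem?_eq_none ((hl r).trans (by omega))])
    rw [hvl] at h1 h4
    have hev : (gen x).eval s = (gen x).outputs.map (wire (s ++ [false, true] ++ ext)) := by
      rw [← h1]
      simp [Circuit.eval, Circuit.run, gen, plainVals, runGates]
    have hFl : (F (x, s)).length = 2 * n x := hlen x s hs
    rw [hev]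
    refine List.ext_getElem (by simp [gen, hFl]) fun j hj hj' => ?_
    simp only [gen, List.map_map, List.length_map, List.length_range] at hj
    have hjW : j < W x := by simp only [W]; omega
    simp only [gen, List.map_map, List.getElem_map, List.getElem_range, Function.comp]
    have h5 := h4 j hjW
    have hyT : y (T x) = ([], σ) := hend
    simp only [hyT] at h5
    have h6 : (cellBits P ([], σ) j)[1 + (controls P).length + 1]? = some ((F (x, s))[j]) := by
      have hb := P.bound_pos
      obtain ⟨m, hm⟩ : ∃ m, P.bound = m + 1 := ⟨P.bound - 1, by omega⟩
      rw [cellBits, show 1 + (controls P).length + 1 = ((controls P).length + 1) + 1 by omega,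
        List.getElem?_cons_succ, List.getElem?_append_right (by simp)]
      rw [hm, List.range_succ_eq_map, List.flatMap_cons]
      simp [hσ, hj']
    rw [← h5, List.getElem?_map, Option.map_eq_some_iff] at h6
    obtain ⟨w, h7, h8⟩ := h6
    rw [List.getD_eq_getElem?_getD, h7, Option.getD_some, h8]

end TotalSearch

/-! ### Ordinary polynomial-time local search as Sink-of-DAG. -/

namespace TotalSearch

/-! ## Local search -/

/-- Adds zeros on the right, or cuts off digits, to get length `n`. -/
def padRight (n : ℕ) (l : List Bool) : List Bool := (l ++ zeros n).take n

/-- Adds zeros on the left, or cuts off digits, to get length `n`. -/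
def padLeft (n : ℕ) (l : List Bool) : List Bool := (padRight n l.reverse).reverse

theorem padRight_length (n : ℕ) (l : List Bool) : (padRight n l).length = n := by
  simp [padRight, zeros]

theorem padLeft_length (n : ℕ) (l : List Bool) : (padLeft n l).length = n := by
  simp [padLeft, padRight_length]

theorem padRight_of_le {n : ℕ} {l : List Bool} (h : l.length ≤ n) :
    padRight n l = l ++ zeros (n - l.length) := by
  rw [padRight, List.take_append, List.take_of_length_le h]
  simp [zeros]

theorem padLeft_of_le {n : ℕ} {l : List Bool} (h : l.length ≤ n) :
    padLeft n l = zeros (n - l.length) ++ l := by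
  rw [padLeft, padRight_of_le (by simpa using h)]
  simp [zeros]

theorem bitsToNat_append (l m : List Bool) :
    bitsToNat (l ++ m) = bitsToNat l * 2 ^ m.length + bitsToNat m := by
  have h : ∀ (m : List Bool) (k : ℕ), m.foldl (fun a c => 2 * a + c.toNat) k =
      k * 2 ^ m.length + m.foldl (fun a c => 2 * a + c.toNat) 0 := by
    intro m
    induction m with
    | nil => simp
    | cons b m ih =>
      intro k
      rw [List.foldl_cons, ih, List.foldl_cons, ih (2 * 0 + _), List.length_cons, pow_succ]
      ring
  rw [bitsToNat, List.foldl_append, h]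
  rfl

theorem bitsToNat_zeros (n : ℕ) : bitsToNat (zeros n) = 0 := by
  induction n with
  | zero => rfl
  | succ n ih =>
    rw [zeros, List.replicate_succ', bitsToNat_append, ← zeros, ih]
    rfl

theorem bitsToNat_lt (l : List Bool) : bitsToNat l < 2 ^ l.length := by
  induction l using List.reverseRecOn with
  | nil => simp [bitsToNat]
  | append_singleton l b ih =>
    rw [bitsToNat_append, List.length_append, pow_add]
    have : bitsToNat [b] < 2 := by cases b <;> simp [bitsToNat]
    simp only [List.length_singleton, pow_one]
    omega

theorem bitsToNat_padLeft {n : ℕ} {l : List Bool} (h : l.length ≤ n) :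
    bitsToNat (padLeft n l) = bitsToNat l := by
  rw [padLeft_of_le h, bitsToNat_append, bitsToNat_zeros]
  simp

theorem bitsToNat_replicate_true (n : ℕ) : bitsToNat (List.replicate n true) + 1 = 2 ^ n := by
  induction n with
  | zero => rfl
  | succ n ih =>
    rw [List.replicate_succ', bitsToNat_append, pow_succ, ← ih]
    simp [bitsToNat]
    ring

theorem bitsToNat_append_lt {k l m n : List Bool} (h : bitsToNat k < bitsToNat m)
    (h' : l.length = n.length) : bitsToNat (k ++ l) < bitsToNat (m ++ n) := by
  rw [bitsToNat_append, bitsToNat_append, h']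
  have h1 := bitsToNat_lt l
  rw [h'] at h1
  have h2 : (bitsToNat k + 1) * 2 ^ n.length ≤ bitsToNat m * 2 ^ n.length :=
    Nat.mul_le_mul_right _ h
  rw [add_mul] at h2
  omega

@[fun_prop]
theorem PT.zeros {γ : Type} [Rep γ] {n : γ → ℕ} (hn : PT n) : PT fun c => zeros (n c) := by
  unfold TotalSearch.zeros
  fun_prop

@[fun_prop]
theorem PT.padRight {γ : Type} [Rep γ] {n : γ → ℕ} {l : γ → List Bool} (hn : PT n) (hl : PT l) :
    PT fun c => padRight (n c) (l c) := by
  unfold TotalSearch.padRight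
  fun_prop

@[fun_prop]
theorem PT.padLeft {γ : Type} [Rep γ] {n : γ → ℕ} {l : γ → List Bool} (hn : PT n) (hl : PT l) :
    PT fun c => padLeft (n c) (l c) := by
  unfold TotalSearch.padLeft
  fun_prop

/-! ### Lists of strings as padded strings -/

/-- A code for lists of strings: pairs of digits, `1b` for the bit `b`, `01` for the end of a
string. -/
def packList (a : List (List Bool)) : List Bool :=
  a.flatMap fun l => (l.flatMap fun b => [true, b]) ++ [false, true]

/-- One step of `unpackList`. -/
def unpackStep (s : Option Bool × List Bool × List (List Bool)) (b : Bool) :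
    Option Bool × List Bool × List (List Bool) :=
  if s.1 = none then (some b, s.2) else
    (none, if s.1.getD false = true then (b :: s.2.1, s.2.2) else
      if b = true then ([], s.2.1.reverse :: s.2.2) else s.2)

/-- The inverse of `packList`; zeros behind the code are ignored. -/
def unpackList (l : List Bool) : List (List Bool) := (l.foldl unpackStep (none, [], [])).2.2.reverse

theorem unpackList_packList (a : List (List Bool)) (n : ℕ) :
    unpackList (packList a ++ zeros n) = a := by
  have h1 : ∀ (l c : List Bool) (acc : List (List Bool)),
      (l.flatMap fun b => [true, b]).foldl unpackStep (none, c, acc) = (none, l.reverse ++ c, acc) := by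
    intro l
    induction l with
    | nil => simp
    | cons b l ih => intro c acc; simp [unpackStep, ih]
  have h2 : ∀ (a : List (List Bool)) (acc : List (List Bool)),
      (packList a).foldl unpackStep (none, [], acc) = (none, [], a.reverse ++ acc) := by
    intro a
    induction a with
    | nil => simp [packList]
    | cons l a ih =>
      intro acc
      rw [packList, List.flatMap_cons, List.foldl_append, List.foldl_append, h1, ← packList]
      simp [unpackStep, ih]
  -- The pair `00` has no meaning in the code and changes nothing; an odd number of zeros just
  -- leaves a pair half read.
  have h3 : ∀ (n : ℕ) (o : Option Bool) (acc : List (List Bool)), o ≠ some true →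
      ((zeros n).foldl unpackStep (o, [], acc)).2.2 = acc := by
    intro n
    induction n with
    | zero => simp [zeros]
    | succ n ih =>
      intro o acc ho
      rw [zeros, List.replicate_succ, List.foldl_cons, ← zeros]
      rcases o with _ | _ | _
      · exact ih _ _ (by simp)
      · exact ih _ _ (by simp)
      · exact absurd rfl ho
  rw [unpackList, List.foldl_append, h2, h3 _ _ _ (by simp)]
  simp

theorem packList_length_le (a : List (List Bool)) : (packList a).length ≤ 2 * sz a := by
  have h : ∀ l : List Bool, 2 * l.length + 1 ≤ 2 * sz l := by
    intro l
    have := length_le_sz l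
    have := sz_pos l
    induction l with
    | nil => simp [sz_nil]
    | cons b l ih =>
      have h1 := sz_pos b
      have h2 := length_le_sz l
      have h3 := sz_pos l
      rw [sz_cons, List.length_cons]
      omega
  induction a with
  | nil => simp [packList]
  | cons l a ih =>
    rw [packList, List.flatMap_cons, ← packList, sz_cons]
    have := h l
    simp only [List.length_append, List.length_flatMap, List.length_cons, List.length_nil,
      List.map_const', List.sum_replicate, smul_eq_mul]
    omega

@[fun_prop]
theorem PT.packList {γ : Type} [Rep γ] {a : γ → List (List Bool)} (ha : PT a) :
    PT fun c => packList (a c) := by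
  have h : PT fun x : γ × List Bool => x.2.flatMap fun b => [true, b] :=
    PT.flatMap (F := fun y : (γ × List Bool) × Bool => [true, y.2]) (by fun_prop) (by fun_prop)
  exact PT.flatMap (F := fun x : γ × List Bool => (x.2.flatMap fun b => [true, b]) ++ [false, true])
    ha (by fun_prop)

@[fun_prop]
theorem PT.unpackList {γ : Type} [Rep γ] {l : γ → List Bool} (hl : PT l) :
    PT fun c => unpackList (l c) := by
  have := PT.foldl (i := fun _ => ((none, [], []) : Option Bool × List Bool × List (List Bool)))
    (F := fun x : γ × (Option Bool × List Bool × List (List Bool)) × Bool => unpackStep x.2.1 x.2.2)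
    hl (by fun_prop) (by unfold unpackStep; fun_prop) (Polynomial.X + 20) (fun c s b _ => by
      obtain ⟨o, l, acc⟩ := s
      have h1 := sz_pos o
      have h2 := sz_pos l
      have h3 := sz_pos b
      have h4 : sz (some b) = 1 + 1 + sz b := by
        simp [sz, code, Rep.rep, Sexp.enc]; omega
      have h5 : sz (none : Option Bool) = 1 := rfl
      have h6 : sz ([] : List Bool) = 1 := rfl
      unfold unpackStep
      split_ifs <;> simp only [sz_prod, sz_cons, h4, h5, h6, sz_reverse, Polynomial.eval_add,
        Polynomial.eval_X, Polynomial.eval_ofNat] <;> omega)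
  unfold TotalSearch.unpackList
  fun_prop

/-! ### Local search reduces to Sink-of-DAG -/

theorem succOf_encode {C : Circuit} (hC : C.Plain) (v : List Bool) :
    succOf C.encode v = (C.eval v).take C.inputs := by
  rw [succOf, parseCircuit_encode, hC.run_eq]

theorem valueOf_encode {C : Circuit} (hC : C.Plain) (v : List Bool) :
    valueOf C.encode v = (C.eval v).drop C.inputs := by
  rw [valueOf, parseCircuit_encode, hC.run_eq]

theorem sinkOfDAG_encode_iff {C : Circuit} (hC : C.Plain) (h : C.outputs.length = 2 * C.inputs)
    (v : List Bool) : SinkOfDAG C.encode v ↔ v.length = C.inputs ∧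
      IsSinkOfDAGSolution C.inputs (succOf C.encode) (valueOf C.encode) v := by
  have h1 : succOf C.encode = fun v => (C.eval v).take C.inputs := funext (succOf_encode hC)
  have h2 : valueOf C.encode = fun v => (C.eval v).drop C.inputs := funext (valueOf_encode hC)
  rw [h1, h2]
  constructor
  · rintro (⟨D, -, h3, h4⟩ | ⟨h3, -⟩)
    · cases Circuit.encode_injective h3
      exact h4
    · exact absurd ⟨C, ⟨hC, h⟩, rfl⟩ h3
  · exact fun h3 => Or.inl ⟨C, ⟨hC, h⟩, rfl, h3⟩

/-- Search problems that are solved by a polynomial-time local search on lists of strings reduce to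
Sink-of-DAG. -/
theorem reducible_of_localSearch {R : SearchProblem}
    {valid final : List Bool × List (List Bool) → Bool}
    {next : List Bool × List (List Bool) → List (List Bool)}
    {val : List Bool × List (List Bool) → List Bool} {init : List Bool → List (List Bool)}
    {out : List (List Bool) → List Bool} (hvalid : PT valid) (hfinal : PT final) (hnext : PT next)
    (hval : PT val) (hinit : PT init) (hout : PT out) (q : Polynomial ℕ)
    (h_sz : ∀ x a, valid (x, a) = true → sz a ≤ q.eval x.length)
    (h_init : ∀ x, valid (x, init x) = true)
    (h_next : ∀ x a, valid (x, a) = true → final (x, a) = false →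
      valid (x, next (x, a)) = true ∧ bitsToNat (val (x, a)) < bitsToNat (val (x, next (x, a))))
    (h_out : ∀ x a, valid (x, a) = true → final (x, a) = true → R x (out a)) :
    ManyOneReducible R SinkOfDAG := by
  obtain ⟨qv, hqv⟩ := hval.exists_sz_le
  -- Room for a state and for a value, each with one leading digit; `4 * X + 2 + q` bounds the size
  -- of the pair of `x` and a valid state.
  let N : Polynomial ℕ := 1 + 2 * q + 1 + qv.comp (4 * Polynomial.X + 2 + q)
  let n : List Bool → ℕ := fun x => N.eval x.length
  have hn1 : ∀ x, 1 ≤ n x := by intro x; simp [n, N]; omega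
  have hn2 : ∀ x a, valid (x, a) = true → (true :: packList a).length ≤ n x := by
    intro x a h
    have h1 := packList_length_le a
    have h2 := h_sz x a h
    simp [n, N]
    omega
  have hn3 : ∀ x a, valid (x, a) = true → (true :: val (x, a)).length ≤ n x := by
    intro x a h
    have h1 := (length_le_sz _).trans (hqv (x, a))
    have h2 := h_sz x a h
    have h3 := sz_bits_le x
    have h4 : sz (x, a) ≤ 4 * x.length + 2 + q.eval x.length := by rw [sz_prod]; omega
    have h5 := h1.trans (eval_mono qv h4)
    simp [n, N]
    omega
  -- The leading digit keeps states apart from $0^n$, which is reserved as the source.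
  let str : List Bool → List (List Bool) → List Bool := fun x a =>
    padRight (n x) (true :: packList a)
  let dec : List Bool → List (List Bool) := fun s => unpackList s.tail
  let wf : List Bool × List Bool → Bool := fun c =>
    decide (c.2 = str c.1 (dec c.2)) && valid (c.1, dec c.2)
  -- The source leads to the initial state, a final state back to the source, and a string that
  -- represents no valid state is a fixed point and so never a solution. Valid states have a leading
  -- `1` in their value while the source has value zero. So the arc into the source does not
  -- increase the value, which makes final states solutions, and every other arc out of the source
  -- or a valid state increases it. Only the canonical string of a state counts as well-formed.
  let S : List Bool × List Bool → List Bool := fun c =>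
    if c.2 = zeros (n c.1) then str c.1 (init c.1) else
    if wf c = true then (if final (c.1, dec c.2) = true then zeros (n c.1) else
      str c.1 (next (c.1, dec c.2))) else c.2
  let V : List Bool × List Bool → List Bool := fun c =>
    if c.2 = zeros (n c.1) then zeros (n c.1) else
    if wf c = true then true :: padLeft (n c.1 - 1) (val (c.1, dec c.2)) else zeros (n c.1)
  have hPT : PT fun c => S c ++ V c := by
    simp only [S, V, wf, str, dec, n]
    fun_prop
  have hSlen : ∀ x s, s.length = n x → (S (x, s)).length = n x := by
    intro x s hs
    simp only [S]
    split_ifs <;> simp [str, padRight_length, zeros, hs]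
  have hVlen : ∀ x s, (V (x, s)).length = n x := by
    intro x s
    have := hn1 x
    simp only [V]
    split_ifs <;> simp [padLeft_length, zeros]
    omega
  obtain ⟨gen, hgen, hspec⟩ := PT.exists_circuits hPT N fun x s hs => by
    rw [List.length_append, hSlen x s hs, hVlen]
    simp only [n]
    omega
  have hdec : ∀ x a, valid (x, a) = true → dec (str x a) = a := by
    intro x a h
    simp only [dec, str]
    rw [padRight_of_le (hn2 x a h), List.cons_append, List.tail_cons, unpackList_packList]
  have hstr0 : ∀ x a, str x a ≠ zeros (n x) := by
    intro x a h
    obtain ⟨m, hm⟩ : ∃ m, n x = m + 1 := ⟨n x - 1, by have := hn1 x; omega⟩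
    simp only [str, hm, padRight, zeros, List.replicate_succ, List.cons_append,
      List.take_succ_cons, List.cons.injEq] at h
    exact absurd h.1 (by simp)
  have hwf : ∀ x a, valid (x, a) = true → wf (x, str x a) = true := by
    intro x a h
    simp [wf, hdec x a h, h]
  have hSV : ∀ x s, s.length = n x → succOf (gen x).encode s = S (x, s) ∧
      valueOf (gen x).encode s = V (x, s) := by
    intro x s hs
    obtain ⟨h1, h2, -, h4⟩ := hspec x
    rw [succOf_encode h1, valueOf_encode h1, h4 s hs, h2]
    exact ⟨List.take_left' (hSlen x s hs), List.drop_left' (hSlen x s hs)⟩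
  refine ⟨fun x => (gen x).encode, fun y => out (dec y), (PT.circuitEncode hgen).fp,
    PT.fp (by simp only [dec]; fun_prop), fun x y hy => ?_⟩
  obtain ⟨h1, h2, h3, -⟩ := hspec x
  obtain ⟨hl, hy⟩ := (sinkOfDAG_encode_iff h1 (by rw [h3, h2]) y).1 hy
  have hl : y.length = n x := hl.trans h2
  have hz : (zeros (n x)).length = n x := by simp [zeros]
  have hS0 : S (x, zeros (n x)) = str x (init x) := by simp [S]
  have hV0 : V (x, zeros (n x)) = zeros (n x) := by simp [V]
  have hVa : ∀ a, valid (x, a) = true →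
      bitsToNat (V (x, str x a)) = 2 ^ (n x - 1) + bitsToNat (val (x, a)) := by
    intro a ha
    have := hn3 x a ha
    simp only [V, if_neg (hstr0 x a), hwf x a ha, if_true, hdec x a ha]
    rw [← List.singleton_append, bitsToNat_append, bitsToNat_padLeft, padLeft_length]
    · simp [bitsToNat]
    · rw [List.length_cons] at this
      omega
  have hSa : ∀ a, valid (x, a) = true → S (x, str x a) =
      if final (x, a) = true then zeros (n x) else str x (next (x, a)) := by
    intro a ha
    simp only [S, if_neg (hstr0 x a), hwf x a ha, if_true, hdec x a ha]
  have hVpos : ∀ a, valid (x, a) = true → 0 < bitsToNat (V (x, str x a)) := by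
    intro a ha
    rw [hVa a ha]
    positivity
  have hneq : ∀ a, valid (x, a) = true → S (x, str x a) ≠ str x a := by
    intro a ha
    rw [hSa a ha]
    split_ifs with hf
    · exact (hstr0 x a).symm
    · obtain ⟨hv, hlt⟩ := h_next x a ha (by simpa using hf)
      intro h
      have := congrArg dec h
      rw [hdec x _ hv, hdec x _ ha] at this
      rw [this] at hlt
      exact lt_irrefl _ hlt
  rw [IsSinkOfDAGSolution, h2] at hy
  change (_ ∧ _) ∨ (y = zeros (n x) ∧ succOf _ (zeros (n x)) = zeros (n x)) at hy
  rw [(hSV x _ hl).1, (hSV x _ hl).2, (hSV x _ (hSlen x y hl)).1, (hSV x _ (hSlen x y hl)).2,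
    (hSV x _ hz).1] at hy
  by_cases hy0 : y = zeros (n x)
  · subst hy0
    rw [hS0, hV0, bitsToNat_zeros] at hy
    rcases hy with ⟨-, h | h⟩ | ⟨-, h⟩
    · exact absurd h (hneq _ (h_init x))
    · exact absurd h (not_le.2 (hVpos _ (h_init x)))
    · exact absurd h (hstr0 _ _)
  · rcases hy with ⟨hne, hy⟩ | ⟨h, -⟩
    swap
    · exact absurd h hy0
    by_cases hw : wf (x, y) = true
    swap
    · exact absurd (by simp only [S, if_neg hy0, if_neg hw]) hne
    simp only [wf, Bool.and_eq_true, decide_eq_true_iff] at hw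
    obtain ⟨hw, ha⟩ := hw
    by_cases hf : final (x, dec y) = true
    · exact h_out x _ ha hf
    · exfalso
      obtain ⟨hv, hlt⟩ := h_next x _ ha (by simpa using hf)
      have hSy : S (x, y) = str x (next (x, dec y)) := by
        conv_lhs => rw [hw]
        rw [hSa _ ha, if_neg hf]
      rw [hSy] at hy
      rcases hy with h | h
      · exact hneq _ hv h
      · rw [hVa _ hv] at h
        conv_rhs at h => rw [hw]
        rw [hVa _ ha] at h
        omega

end TotalSearch

/-! ### Local search with queries to Sink-of-DAG; composition of programs. -/

namespace TotalSearch

/-! ## Local search with queries to Sink-of-DAG -/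

/-- The start of the local search for a solution of `u`. -/
def startPoint (u : List Bool) : List Bool :=
  if isInstance u = true then zeros (parseCircuit u).inputs else []

/-- The points that may occur in the local search for a solution of `u`. -/
def isPoint (u v : List Bool) : Bool :=
  if isInstance u = true then decide (v.length = (parseCircuit u).inputs) &&
    (decide (v = zeros (parseCircuit u).inputs) || !decide (succOf u v = v)) else decide (v = [])

@[fun_prop]
theorem PT.startPoint {γ : Type} [Rep γ] {u : γ → List Bool} (hu : PT u) :
    PT fun c => startPoint (u c) := by
  unfold TotalSearch.startPoint
  fun_prop

@[fun_prop]
theorem PT.isPoint {γ : Type} [Rep γ] {u v : γ → List Bool} (hu : PT u) (hv : PT v) :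
    PT fun c => isPoint (u c) (v c) := by
  unfold TotalSearch.isPoint
  fun_prop

theorem isPoint_startPoint (u : List Bool) : isPoint u (startPoint u) = true := by
  unfold isPoint startPoint
  split_ifs <;> simp [zeros]

theorem inputs_le_of_isInstance {u : List Bool} (h : isInstance u = true) :
    (parseCircuit u).inputs ≤ u.length := by
  obtain ⟨C, -, rfl⟩ := (isInstance_iff u).1 h
  rw [parseCircuit_encode]
  simp [Circuit.encode, natCode]

theorem length_le_of_isPoint {u v : List Bool} (h : isPoint u v = true) : v.length ≤ u.length := by
  unfold isPoint at h
  split_ifs at h with hi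
  · simp only [Bool.and_eq_true, decide_eq_true_iff] at h
    rw [h.1]
    exact inputs_le_of_isInstance hi
  · rw [decide_eq_true_iff] at h
    simp [h]

theorem valueOf_length {u : List Bool} (h : isInstance u = true) (v : List Bool) :
    (valueOf u v).length = (parseCircuit u).inputs := by
  obtain ⟨C, hC, rfl⟩ := (isInstance_iff u).1 h
  rw [valueOf, List.length_drop, run_length, parseCircuit_encode, hC.2]
  omega

theorem succOf_length {u : List Bool} (h : isInstance u = true) (v : List Bool) :
    (succOf u v).length = (parseCircuit u).inputs := by
  obtain ⟨C, hC, rfl⟩ := (isInstance_iff u).1 h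
  rw [succOf, List.length_take, run_length, parseCircuit_encode, hC.2]
  omega

/-- A point is $0^n$ or is not fixed by the successor, and if $0^n$ is fixed it is a solution. So a
point that is no solution has a successor which is again not fixed and has a larger value. -/
theorem isPoint_succOf {u v : List Bool} (h : isPoint u v = true) (hs : isSolution u v = false) :
    isPoint u (succOf u v) = true ∧
      bitsToNat (valueOf u v) < bitsToNat (valueOf u (succOf u v)) ∧
      (valueOf u v).length ≤ u.length ∧ (valueOf u (succOf u v)).length ≤ u.length := by
  unfold isPoint isSolution at *
  by_cases hi : isInstance u = true
  · have hl := inputs_le_of_isInstance hi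
    have h1 := valueOf_length hi
    rw [if_pos hi] at *
    simp only [Bool.and_eq_true, Bool.or_eq_true, decide_eq_true_iff, Bool.not_eq_true',
      decide_eq_false_iff_not, Bool.and_eq_false_iff, Bool.or_eq_false_iff,
      Bool.not_eq_false', succOf_length hi, true_and] at *
    obtain ⟨h2, h3⟩ := h
    obtain ⟨h4, h5⟩ := hs.resolve_left (fun h => h h2)
    have h6 : succOf u v ≠ v := by
      rcases h3 with rfl | h3
      · intro h6
        rcases h5 with h5 | h5
        · exact h5 rfl
        · exact h5 h6
      · exact h3
    obtain ⟨h7, h8⟩ := h4.resolve_left (fun h => h6 h)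
    refine ⟨Or.inr h7, ?_, (h1 _).trans_le hl, (h1 _).trans_le hl⟩
    rw [← not_le, ← leBits_iff (by rw [h1, h1]), h8]
    simp
  · rw [if_neg hi] at *
    simp_all

/-- Search problems that are solved by a polynomial-time local search each of whose steps may ask
for a solution of an instance of Sink-of-DAG reduce to Sink-of-DAG. -/
theorem reducible_of_querySearch {R : SearchProblem}
    {valid final : List Bool × List (List Bool) → Bool}
    {ask : List Bool × List (List Bool) → List Bool}
    {resume : (List Bool × List (List Bool)) × List Bool → List (List Bool)}
    {val : List Bool × List (List Bool) → List Bool} {init : List Bool → List (List Bool)}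
    {out : List (List Bool) → List Bool} (hvalid : PT valid) (hfinal : PT final) (hask : PT ask)
    (hresume : PT resume) (hval : PT val) (hinit : PT init) (hout : PT out) (q : Polynomial ℕ)
    (h_sz : ∀ x a, valid (x, a) = true → sz a ≤ q.eval x.length)
    (h_init : ∀ x, valid (x, init x) = true)
    (h_resume : ∀ x a v, valid (x, a) = true → final (x, a) = false → SinkOfDAG (ask (x, a)) v →
      valid (x, resume ((x, a), v)) = true ∧
        bitsToNat (val (x, a)) < bitsToNat (val (x, resume ((x, a), v))))
    (h_out : ∀ x a, valid (x, a) = true → final (x, a) = true → R x (out a)) :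
    ManyOneReducible R SinkOfDAG := by
  obtain ⟨qa, hqa⟩ := hask.exists_sz_le
  -- A common length for all inner values, whatever query is open, so that concatenated values
  -- compare lexicographically.
  let B : Polynomial ℕ := qa.comp (4 * Polynomial.X + 2 + q)
  have hB : ∀ x a, valid (x, a) = true → (ask (x, a)).length ≤ B.eval x.length := by
    intro x a h
    have h1 := (length_le_sz _).trans (hqa (x, a))
    have h2 := h_sz x a h
    have h3 := sz_bits_le x
    have h4 : sz (x, a) ≤ 4 * x.length + 2 + q.eval x.length := by rw [sz_prod]; omega
    have h5 := h1.trans (eval_mono qa h4)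
    simpa [B] using h5
  -- A combined state is an outer state with the current point of the inner search in front; at a
  -- final outer state there is no query, and the empty string fills the place.
  let enter : List Bool × List (List Bool) → List (List Bool) := fun c =>
    (if final c = true then [] else startPoint (ask c)) :: c.2
  let valid' : List Bool × List (List Bool) → Bool := fun c =>
    !decide (c.2 = []) && (valid (c.1, c.2.tail) &&
      (if final (c.1, c.2.tail) = true then decide (c.2.headD [] = []) else
        isPoint (ask (c.1, c.2.tail)) (c.2.headD [])))
  let next' : List Bool × List (List Bool) → List (List Bool) := fun c =>
    if isSolution (ask (c.1, c.2.tail)) (c.2.headD []) = true then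
      enter (c.1, resume ((c.1, c.2.tail), c.2.headD [])) else
      succOf (ask (c.1, c.2.tail)) (c.2.headD []) :: c.2.tail
  let val' : List Bool × List (List Bool) → List Bool := fun c =>
    val (c.1, c.2.tail) ++
      padLeft (B.eval c.1.length) (valueOf (ask (c.1, c.2.tail)) (c.2.headD []))
  have henter : PT enter := by fun_prop
  have hent : ∀ x a, valid (x, a) = true → valid' (x, enter (x, a)) = true := by
    intro x a h
    simp only [valid', enter, List.tail_cons, List.headD_cons, h, reduceCtorEq, decide_false,
      Bool.not_false, Bool.true_and]
    split_ifs
    · simp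
    · exact isPoint_startPoint _
  have hcons : ∀ x s, valid' (x, s) = true → ∃ v a, s = v :: a ∧ valid (x, a) = true ∧
      (if final (x, a) = true then v = [] else isPoint (ask (x, a)) v = true) := by
    intro x s h
    cases s with
    | nil => simp [valid'] at h
    | cons v a =>
      change (valid (x, a) && (if final (x, a) = true then decide (v = []) else
        isPoint (ask (x, a)) v)) = true at h
      rw [Bool.and_eq_true] at h
      refine ⟨v, a, rfl, h.1, ?_⟩
      have := h.2
      cases hf : final (x, a) <;> simpa [hf] using this
  refine reducible_of_localSearch (valid := valid') (final := fun c => final (c.1, c.2.tail))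
    (next := next') (val := val') (init := fun x => enter (x, init x)) (out := fun a => out a.tail)
    (by fun_prop) (by fun_prop) (by fun_prop) (by fun_prop) (by fun_prop) (by fun_prop)
    (2 + 4 * B + q) (fun x s h => ?_) (fun x => hent x _ (h_init x)) (fun x s h hf => ?_)
    (fun x s h hf => ?_)
  · obtain ⟨v, a, rfl, ha, hv⟩ := hcons x s h
    have h1 := h_sz x a ha
    have h2 := hB x a ha
    have h3 := sz_bits_le v
    have h4 : v.length ≤ (ask (x, a)).length := by
      split_ifs at hv
      · simp [hv]
      · exact length_le_of_isPoint hv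
    rw [sz_cons]
    simp
    omega
  · obtain ⟨v, a, rfl, ha, hv⟩ := hcons x s h
    simp only [List.tail_cons] at hf
    rw [hf, if_neg (by simp)] at hv
    rw [show next' (x, v :: a) = if isSolution (ask (x, a)) v = true then
      enter (x, resume ((x, a), v)) else succOf (ask (x, a)) v :: a from rfl]
    by_cases hs : isSolution (ask (x, a)) v = true
    swap
    · rw [if_neg hs]
      rw [Bool.not_eq_true] at hs
      obtain ⟨h1, h2, h3, h4⟩ := isPoint_succOf hv hs
      have h5 := hB x a ha
      refine ⟨by simp [valid', ha, hf, h1], ?_⟩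
      simp only [val', List.tail_cons, List.headD_cons]
      rw [bitsToNat_append, bitsToNat_append, bitsToNat_padLeft (h3.trans h5),
        bitsToNat_padLeft (h4.trans h5), padLeft_length, padLeft_length]
      omega
    · obtain ⟨h1, h2⟩ := h_resume x a v ha hf ((isSolution_iff _ _).1 hs)
      rw [if_pos hs]
      refine ⟨hent x _ h1, ?_⟩
      simp only [val', enter, List.tail_cons, List.headD_cons]
      -- The inner search for the next query starts afresh; its value may drop, but the outer value
      -- comes first.
      exact bitsToNat_append_lt h2 (by rw [padLeft_length, padLeft_length])
  · obtain ⟨v, a, rfl, ha, hv⟩ := hcons x s h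
    exact h_out x a ha hf

/-! ## Composition of programs -/

/-- Empties the stacks `1, …, k`. -/
def clear : ℕ → Prog
  | 0 => .skip
  | k + 1 => .seq (.loop (k + 1) (.pop (k + 1))) (clear k)

theorem queryFree_clear (k : ℕ) : (clear k).QueryFree := by
  induction k with
  | zero => trivial
  | succ k ih => exact ⟨trivial, ih⟩

theorem runs_popLoop (b : List Bool → List Bool) (r : ℕ) (l : List Bool) (σ : Store) (h : σ r = l) :
    Runs b (.loop r (.pop r)) σ (Function.update σ r []) (2 * l.length + 1) := by
  induction l generalizing σ with
  | nil =>
    rw [show Function.update σ r [] = σ by rw [← h, Function.update_eq_self]]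
    exact .loopStop h
  | cons a l ih =>
    have := ih (Function.update σ r (σ r).tail) (by simp [h])
    rw [Function.update_idem] at this
    have h2 := Runs.loopStep (by simp [h]) (.pop σ r) this
    convert h2 using 1
    simp
    ring

theorem runs_clear (b : List Bool → List Bool) (k m : ℕ) (σ : Store) (hm : ∀ r, (σ r).length ≤ m) :
    ∃ t, t ≤ k * (2 * m + 1) + 1 ∧
      Runs b (clear k) σ (fun r => if 1 ≤ r ∧ r ≤ k then [] else σ r) t := by
  induction k generalizing σ with
  | zero =>
    refine ⟨1, by simp, ?_⟩
    have : (fun r => if 1 ≤ r ∧ r ≤ 0 then [] else σ r) = σ :=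
      funext fun r => if_neg (by omega)
    rw [this]
    exact .skip σ
  | succ k ih =>
    obtain ⟨t, ht, h⟩ := ih (Function.update σ (k + 1) []) (fun r => by
      rw [Function.update_apply]
      split_ifs
      · simp
      · exact hm r)
    refine ⟨2 * (σ (k + 1)).length + 1 + t, ?_, (runs_popLoop b (k + 1) _ σ rfl).seq ?_⟩
    · have := hm (k + 1)
      rw [add_mul]
      omega
    · convert h using 1
      funext r
      rw [Function.update_apply]
      split_ifs <;> first | rfl | omega

/-- A program names finitely many stacks and leaves the others alone, so clearing a fixed number of
stacks prepares the store for a second program. -/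
theorem Runs.eq_of_bound_le {b : List Bool → List Bool} {P : Prog} {σ τ : Store} {t : ℕ}
    (h : Runs b P σ τ t) {r : ℕ} (hr : P.bound ≤ r) : τ r = σ r := by
  induction h with
  | skip => rfl
  | push σ s c =>
    simp only [Prog.bound] at hr
    rw [Function.update_of_ne (by omega)]
  | pop σ s =>
    simp only [Prog.bound] at hr
    rw [Function.update_of_ne (by omega)]
  | query σ s s' =>
    simp only [Prog.bound] at hr
    rw [Function.update_of_ne (by omega)]
  | seq _ _ ih1 ih2 =>
    simp only [Prog.bound] at hr
    rw [ih2 (by omega), ih1 (by omega)]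
  | branchEmpty _ _ ih => simp only [Prog.bound] at hr; exact ih (by omega)
  | branchFalse _ _ ih => simp only [Prog.bound] at hr; exact ih (by omega)
  | branchTrue _ _ ih => simp only [Prog.bound] at hr; exact ih (by omega)
  | loopStop => rfl
  | loopStep _ _ _ ih1 ih2 =>
    rw [ih2 hr]
    simp only [Prog.bound] at hr
    exact ih1 (by omega)

theorem Runs.of_queryFree {b b' : List Bool → List Bool} {P : Prog} {σ τ : Store} {t : ℕ}
    (h : Runs b P σ τ t) (hP : P.QueryFree) : Runs b' P σ τ t := by
  induction h with
  | skip => exact .skip _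
  | push => exact .push _ _ _
  | pop => exact .pop _ _
  | query => exact hP.elim
  | seq _ _ ih1 ih2 => exact .seq (ih1 hP.1) (ih2 hP.2)
  | branchEmpty h _ ih => exact .branchEmpty h (ih hP.1)
  | branchFalse h _ ih => exact .branchFalse h (ih hP.2.1)
  | branchTrue h _ ih => exact .branchTrue h (ih hP.2.2)
  | loopStop h => exact .loopStop h
  | loopStep h _ _ ih1 ih2 => exact .loopStep h (ih1 hP) (ih2 hP)

theorem Prog.Computes.length_le {b : List Bool → List Bool} {P : Prog} {x y : List Bool} {T : ℕ}
    (h : P.Computes b [x] y T) : y.length ≤ x.length + T := by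
  obtain ⟨σ, t, h1, h2, rfl⟩ := h
  have := h1.length_le 0
  simp only [List.getD_cons_zero] at this
  omega

/-- Runs one program after the other. -/
def Prog.andThen (P Q : Prog) : Prog := .seq P (.seq (clear P.bound) Q)

theorem Prog.Computes.andThen {b : List Bool → List Bool} {P Q : Prog} {x y z : List Bool}
    {T T' : ℕ} (h : P.Computes b [x] y T) (h' : Q.Computes b [y] z T') :
    (P.andThen Q).Computes b [x] z (T + (P.bound * (2 * (x.length + T) + 1) + 1 + T')) := by
  obtain ⟨σ, t, h1, h2, rfl⟩ := h
  obtain ⟨τ, t', h3, h4, rfl⟩ := h'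
  have hlen : ∀ r, (σ r).length ≤ x.length + T := by
    intro r
    have h5 := h1.length_le r
    have h6 : ([x].getD r []).length ≤ x.length := by rcases r with _ | r <;> simp
    omega
  obtain ⟨s, hs, h5⟩ := runs_clear b P.bound _ σ hlen
  refine ⟨τ, t + (s + t'), h1.seq (h5.seq ?_), by omega, rfl⟩
  convert h3 using 1
  funext r
  rcases r with _ | r
  · simp
  · by_cases hr : r + 1 ≤ P.bound
    · simp [hr]
    · simp [hr, h1.eq_of_bound_le (r := r + 1) (by omega)]

theorem FP.comp {f g : List Bool → List Bool} (hg : FP g) (hf : FP f) : FP fun x => g (f x) := by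
  obtain ⟨P, p, hP, h⟩ := hf
  obtain ⟨Q, q, hQ, h'⟩ := hg
  refine ⟨P.andThen Q, p + (Polynomial.C P.bound * (2 * (Polynomial.X + p) + 1) + 1 +
    q.comp (Polynomial.X + p)), ⟨hP, queryFree_clear _, hQ⟩, fun x => ?_⟩
  obtain ⟨σ, t, h1, h2, h3⟩ := (h x).andThen (h' (f x))
  refine ⟨σ, t, h1, h2.trans ?_, h3⟩
  have := eval_mono q (h x).length_le
  simp
  omega

theorem FPOracle.comp {B : SearchProblem} {f g : (List Bool → List Bool) → List Bool → List Bool}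
    (hg : FPOracle B g) (hf : FPOracle B f) : FPOracle B fun b x => g b (f b x) := by
  obtain ⟨P, p, h⟩ := hf
  obtain ⟨Q, q, h'⟩ := hg
  refine ⟨P.andThen Q, p + (Polynomial.C P.bound * (2 * (Polynomial.X + p) + 1) + 1 +
    q.comp (Polynomial.X + p)), fun b hb x => ?_⟩
  obtain ⟨σ, t, h1, h2, h3⟩ := (h b hb x).andThen (h' b hb (f b x))
  refine ⟨σ, t, h1, h2.trans ?_, h3⟩
  have := eval_mono q (h b hb x).length_le
  simp
  omega

theorem FP.fpOracle {f : List Bool → List Bool} (hf : FP f) (B : SearchProblem) :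
    FPOracle B fun _ => f := by
  obtain ⟨P, p, hP, h⟩ := hf
  refine ⟨P, p, fun b _ x => ?_⟩
  obtain ⟨σ, t, h1, h2⟩ := h x
  exact ⟨σ, t, h1.of_queryFree hP, h2⟩

theorem fpOracle_apply : FPOracle SinkOfDAG fun b x => b x := by
  refine ⟨.query 0 0, 1 + 2 * Polynomial.X, fun b hb x => ⟨_, _, .query _ 0 0, ?_, by simp⟩⟩
  have := SinkOfDAG.length_le (hb x)
  simp [sinkOfDAGBound] at this ⊢
  omega

end TotalSearch

/-! ### Problems solved by oracle programs reduce to Sink-of-DAG. -/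

namespace TotalSearch

/-! ## Runs with a list of answers -/

/-- The configuration is at a query and there is no answer. -/
def AnsweredConfig.Stuck (c : AnsweredConfig) : Prop :=
  (∃ r s ks, c.1 = .query r s :: ks) ∧ c.2.2.2 = []

theorem answeredStep_of_stuck {c : AnsweredConfig} (h : c.Stuck) : answeredStep c = c := by
  obtain ⟨ctl, σ, log, as⟩ := c
  obtain ⟨⟨r, s, ks, h1⟩, h2⟩ := h
  simp only at h1 h2
  subst h1 h2
  rfl

theorem answeredStep_agrees {b : List Bool → List Bool} {c : AnsweredConfig} (h : ¬ c.Stuck)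
    (hb : ∀ e ∈ (answeredStep c).2.2.1, b e.1 = e.2) :
    ((answeredStep c).1, (answeredStep c).2.1) = smallStep b (c.1, c.2.1) := by
  obtain ⟨ctl, σ, log, as⟩ := c
  rcases ctl with _ | ⟨Q, ks⟩
  · rfl
  · cases Q with
    | query r s =>
      cases as with
      | nil => exact absurd ⟨⟨r, s, ks, rfl⟩, rfl⟩ h
      | cons a as =>
        have := hb (σ r, a) (by simp [answeredStep])
        simp only at this
        simp [answeredStep, smallStep, storeStep, nextCtl, this]
    | _ => rfl

theorem log_answeredStep (c : AnsweredConfig) : c.2.2.1 <+: (answeredStep c).2.2.1 := by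
  obtain ⟨ctl, σ, log, as⟩ := c
  rcases ctl with _ | ⟨Q, ks⟩
  · exact List.prefix_rfl
  · cases Q with
    | query r s =>
      cases as with
      | nil => exact List.prefix_rfl
      | cons a as => exact List.prefix_append _ _
    | _ => exact List.prefix_rfl

theorem log_answeredStep_length (c : AnsweredConfig) :
    (answeredStep c).2.2.1.length ≤ c.2.2.1.length + 1 := by
  obtain ⟨ctl, σ, log, as⟩ := c
  rcases ctl with _ | ⟨Q, ks⟩
  · simp [answeredStep]
  · cases Q with
    | query r s => cases as <;> simp [answeredStep]
    | _ => simp [answeredStep]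

theorem answers_answeredStep (c : AnsweredConfig) :
    (answeredStep c).2.2.1.map Prod.snd ++ (answeredStep c).2.2.2 =
      c.2.2.1.map Prod.snd ++ c.2.2.2 := by
  obtain ⟨ctl, σ, log, as⟩ := c
  rcases ctl with _ | ⟨Q, ks⟩
  · rfl
  · cases Q with
    | query r s => cases as <;> simp [answeredStep]
    | _ => rfl

theorem answeredStep_nil {c : AnsweredConfig} (h : c.2.2.2 = []) :
    (answeredStep c).2.2 = (c.2.2.1, []) := by
  obtain ⟨ctl, σ, log, as⟩ := c
  simp only at h
  subst h
  rcases ctl with _ | ⟨Q, ks⟩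
  · rfl
  · cases Q <;> rfl

/-- The configuration with one more answer at the end. -/
def AnsweredConfig.addAnswer (c : AnsweredConfig) (v : List Bool) : AnsweredConfig :=
  (c.1, c.2.1, c.2.2.1, c.2.2.2 ++ [v])

theorem answeredStep_addAnswer {c : AnsweredConfig} (h : ¬ c.Stuck) (v : List Bool) :
    answeredStep (c.addAnswer v) = (answeredStep c).addAnswer v := by
  obtain ⟨ctl, σ, log, as⟩ := c
  rcases ctl with _ | ⟨Q, ks⟩
  · rfl
  · cases Q with
    | query r s =>
      cases as with
      | nil => exact absurd ⟨⟨r, s, ks, rfl⟩, rfl⟩ h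
      | cons a as => rfl
    | _ => rfl

theorem answeredStep_addAnswer_of_stuck {c : AnsweredConfig} (h : c.Stuck) (v : List Bool) :
    (answeredStep (c.addAnswer v)).2.2 = (c.2.2.1 ++ [(c.view.2.1, v)], []) := by
  obtain ⟨ctl, σ, log, as⟩ := c
  obtain ⟨⟨r, s, ks, h1⟩, h2⟩ := h
  simp only at h1 h2
  subst h1 h2
  rfl

/-- A small step does not charge for the length of an answer. But an answer is no longer than its
query, and the query already lies on a stack, so a query does not raise the maximum. -/
theorem length_answeredStep (c : AnsweredConfig) (m : ℕ) (hm : ∀ r, (c.2.1 r).length ≤ m)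
    (h : ∀ e ∈ (answeredStep c).2.2.1, e.2.length ≤ e.1.length) (r : ℕ) :
    ((answeredStep c).2.1 r).length ≤ m + 1 := by
  obtain ⟨ctl, σ, log, as⟩ := c
  simp only at hm
  have h0 := (hm r).trans (Nat.le_succ m)
  rcases ctl with _ | ⟨Q, ks⟩
  · exact h0
  · cases Q with
    | push s b =>
      simp only [answeredStep, storeStep, Function.update_apply]
      split_ifs with hr
      · simpa using hm s
      · exact h0
    | pop s =>
      simp only [answeredStep, storeStep, Function.update_apply]
      split_ifs with hr
      · have := hm s
        simp
        omega
      · exact h0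
    | query s s' =>
      cases as with
      | nil => exact h0
      | cons a as =>
        have h1 := h (σ s, a) (by simp [answeredStep])
        simp only [answeredStep, Function.update_apply]
        split_ifs with hr
        · exact h1.trans ((hm s).trans (Nat.le_succ m))
        · exact h0
    | _ => exact h0

theorem mem_log_answeredStep (c : AnsweredConfig) (m : ℕ) (hm : ∀ r, (c.2.1 r).length ≤ m)
    {e : List Bool × List Bool} (he : e ∈ (answeredStep c).2.2.1) :
    e ∈ c.2.2.1 ∨ e.1.length ≤ m := by
  obtain ⟨ctl, σ, log, as⟩ := c
  rcases ctl with _ | ⟨Q, ks⟩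
  · exact Or.inl he
  · cases Q with
    | query r s =>
      cases as with
      | nil => exact Or.inl he
      | cons a as =>
        simp only [answeredStep, List.mem_append, List.mem_singleton] at he
        rcases he with he | rfl
        · exact Or.inl he
        · exact Or.inr (hm r)
    | _ => exact Or.inl he

section

variable (P : Prog) (x : List Bool) (as : List (List Bool))

/-- The configuration after `n` steps. -/
def answeredRun (n : ℕ) : AnsweredConfig := answeredStep^[n] (answeredStart P x as)

theorem answeredRun_succ (n : ℕ) :
    answeredRun P x as (n + 1) = answeredStep (answeredRun P x as n) :=
  Function.iterate_succ_apply' _ _ _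

theorem answeredRun_agrees {b : List Bool → List Bool} {n : ℕ}
    (h : ∀ m < n, ¬ (answeredRun P x as m).Stuck)
    (hb : ∀ e ∈ (answeredRun P x as n).2.2.1, b e.1 = e.2) :
    ((answeredRun P x as n).1, (answeredRun P x as n).2.1) =
      (smallStep b)^[n] ([P], fun i => [x].getD i []) := by
  induction n with
  | zero => rfl
  | succ n ih =>
    rw [answeredRun_succ] at hb ⊢
    rw [answeredStep_agrees (h n (by omega)) hb,
      ih (fun m hm => h m (by omega)) fun e he => hb e ((log_answeredStep _).subset he),
      Function.iterate_succ_apply']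

/-- Answers are consumed in order. When none remain, the list of answers can be recovered from the
log, whose length and entries are bounded by the running time. -/
theorem answers_answeredRun (n : ℕ) :
    (answeredRun P x as n).2.2.1.map Prod.snd ++ (answeredRun P x as n).2.2.2 = as := by
  induction n with
  | zero => rfl
  | succ n ih => rw [answeredRun_succ, answers_answeredStep, ih]

theorem log_answeredRun_length (n : ℕ) : (answeredRun P x as n).2.2.1.length ≤ n := by
  induction n with
  | zero => simp [answeredRun, answeredStart]
  | succ n ih =>
    have := log_answeredStep_length (answeredRun P x as n)
    rw [answeredRun_succ]
    omega

theorem length_answeredRun (n : ℕ)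
    (h : ∀ e ∈ (answeredRun P x as n).2.2.1, e.2.length ≤ e.1.length) :
    (∀ r, ((answeredRun P x as n).2.1 r).length ≤ x.length + n) ∧
      ∀ e ∈ (answeredRun P x as n).2.2.1, e.1.length ≤ x.length + n := by
  induction n with
  | zero =>
    refine ⟨fun r => ?_, by simp [answeredRun, answeredStart]⟩
    rcases r with _ | r <;> simp [answeredRun, answeredStart]
  | succ n ih =>
    rw [answeredRun_succ] at h ⊢
    obtain ⟨h1, h2⟩ := ih fun e he => h e ((log_answeredStep _).subset he)
    refine ⟨length_answeredStep _ _ h1 h, fun e he => ?_⟩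
    rcases mem_log_answeredStep _ _ h1 he with he | he
    · exact (h2 e he).trans (by omega)
    · omega

theorem answeredRun_of_stuck {n T : ℕ} (h : (answeredRun P x as n).Stuck) (hT : n ≤ T) :
    answeredRun P x as T = answeredRun P x as n := by
  induction T, hT using Nat.le_induction with
  | base => rfl
  | succ T _ ih => rw [answeredRun_succ, ih, answeredStep_of_stuck h]

theorem answeredRun_addAnswer (v : List Bool) {n : ℕ}
    (h : ∀ m < n, ¬ (answeredRun P x as m).Stuck) :
    answeredRun P x (as ++ [v]) n = (answeredRun P x as n).addAnswer v := by
  induction n with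
  | zero => rfl
  | succ n ih =>
    rw [answeredRun_succ, answeredRun_succ, ih fun m hm => h m (by omega),
      answeredStep_addAnswer (h n (by omega))]

theorem answeredRun_nil {n T : ℕ} (h : (answeredRun P x as n).2.2.2 = []) (hT : n ≤ T) :
    (answeredRun P x as T).2.2 = ((answeredRun P x as n).2.2.1, []) := by
  induction T, hT using Nat.le_induction with
  | base => rw [← h]
  | succ T _ ih => rw [answeredRun_succ, answeredStep_nil (by rw [ih]), ih]

/-- Either the run comes to an end like the run with an oracle, or the answers do not suffice. -/
theorem answeredRun_cases {b : List Bool → List Bool} {T : ℕ} {τ : Store}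
    (hb : ∀ e ∈ (answeredRun P x as T).2.2.1, b e.1 = e.2)
    (hT : (smallStep b)^[T] ([P], fun i => [x].getD i []) = ([], τ)) :
    ((answeredRun P x as T).1 = [] ∧ (answeredRun P x as T).2.1 = τ) ∨
      ((answeredRun P x as T).1 ≠ [] ∧ ∀ v, (answeredRun P x (as ++ [v]) T).2.2 =
        ((answeredRun P x as T).2.2.1 ++ [((answeredRun P x as T).view.2.1, v)], [])) := by
  by_cases h : ∃ n < T, (answeredRun P x as n).Stuck
  · right
    classical
    -- The first moment at which an answer is missing. The run stands still from then on; with `v`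
    -- appended it takes the same course up to this moment, consumes `v`, and its log no longer
    -- changes because no answer is left.
    have hn := Nat.find_spec h
    have hmin : ∀ m < Nat.find h, ¬ (answeredRun P x as m).Stuck := by
      intro m hm hs
      exact Nat.find_min h hm ⟨hm.trans hn.1, hs⟩
    set n := Nat.find h
    have hTn := answeredRun_of_stuck P x as hn.2 hn.1.le
    rw [hTn]
    refine ⟨fun h0 => ?_, fun v => ?_⟩
    · obtain ⟨⟨r, s, ks, h1⟩, -⟩ := hn.2
      rw [h0] at h1
      exact absurd h1 (by simp)
    · have h1 := answeredStep_addAnswer_of_stuck hn.2 v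
      rw [← answeredRun_addAnswer P x as v hmin, ← answeredRun_succ] at h1
      rw [answeredRun_nil P x (as ++ [v]) (n := n + 1) (by rw [h1]) hn.1, h1]
  · left
    push Not at h
    have h1 := answeredRun_agrees P x as h hb
    rw [hT, Prod.mk.injEq] at h1
    exact h1

end

/-! ## Search problems solved by oracle programs -/

/-- The answer to `u` in a list of pairs (query, answer). -/
def memo (log : List (List Bool × List Bool)) (u : List Bool) : Option (List Bool) :=
  log.foldl (fun s e => if e.1 = u then some e.2 else s) none

theorem memo_cases (log : List (List Bool × List Bool)) (u : List Bool) :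
    (memo log u = none ∧ ∀ e ∈ log, e.1 ≠ u) ∨ ∃ a, memo log u = some a ∧ (u, a) ∈ log := by
  induction log using List.reverseRecOn with
  | nil => exact Or.inl ⟨rfl, by simp⟩
  | append_singleton log e ih =>
    rw [memo, List.foldl_append, ← memo]
    obtain ⟨e1, e2⟩ := e
    by_cases h : e1 = u
    · subst h
      exact Or.inr ⟨e2, by simp, by simp⟩
    · simp only [List.foldl_cons, List.foldl_nil, h, if_false]
      rcases ih with ⟨h1, h2⟩ | ⟨a, h1, h2⟩
      · refine Or.inl ⟨h1, fun e he => ?_⟩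
        rcases List.mem_append.1 he with he | he
        · exact h2 e he
        · rw [List.mem_singleton.1 he]
          exact h
      · exact Or.inr ⟨a, h1, by simp [h2]⟩

@[fun_prop]
theorem PT.memo {γ : Type} [Rep γ] {log : γ → List (List Bool × List Bool)} {u : γ → List Bool}
    (hl : PT log) (hu : PT u) : PT fun c => memo (log c) (u c) :=
  PT.foldl (i := fun _ => (none : Option (List Bool)))
    (F := fun y : γ × Option (List Bool) × (List Bool × List Bool) =>
      if y.2.2.1 = u y.1 then some y.2.2.2 else y.2.1) hl (by fun_prop) (by fun_prop)
    (2 + Polynomial.X) fun c s a _ => by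
      obtain ⟨a1, a2⟩ := a
      have : sz (some a2) = 2 + sz a2 := by
        simp [sz, code, Rep.rep, Sexp.enc]; omega
      simp only [Polynomial.eval_add, Polynomial.eval_ofNat, Polynomial.eval_X, sz_prod]
      split_ifs <;> omega

/-- Equal queries have equal answers. -/
def isConsistent (log : List (List Bool × List Bool)) : Bool :=
  log.all fun e => log.all fun e' => !decide (e.1 = e'.1) || decide (e.2 = e'.2)

@[fun_prop]
theorem PT.isConsistent {γ : Type} [Rep γ] {log : γ → List (List Bool × List Bool)}
    (hl : PT log) : PT fun c => isConsistent (log c) := by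
  have h2 : PT fun y : γ × (List Bool × List Bool) => (log y.1).all fun e' =>
      !decide (y.2.1 = e'.1) || decide (y.2.2 = e'.2) :=
    PT.all (F := fun z : (γ × (List Bool × List Bool)) × (List Bool × List Bool) =>
      !decide (z.1.2.1 = z.2.1) || decide (z.1.2.2 = z.2.2)) (by fun_prop) (by fun_prop)
  exact PT.all hl h2

theorem isConsistent_iff (log : List (List Bool × List Bool)) :
    isConsistent log = true ↔ InternallyConsistent log := by
  simp only [isConsistent, List.all_eq_true, Bool.or_eq_true,
    Bool.not_eq_true', decide_eq_false_iff_not, decide_eq_true_iff, InternallyConsistent]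
  refine ⟨fun h u a a' h1 h2 => ?_, fun h e he e' he' => ?_⟩
  · exact (h _ h1 _ h2).resolve_left (fun h => h rfl)
  · by_cases h1 : e.1 = e'.1
    · right
      refine h e.1 e.2 e'.2 he ?_
      rw [h1]
      exact he'
    · exact Or.inl h1

/-- The answers are solutions, and equal queries have equal answers. -/
def isLog (log : List (List Bool × List Bool)) : Bool :=
  (log.all fun e => isSolution e.1 e.2) && isConsistent log

@[fun_prop]
theorem PT.isLog {γ : Type} [Rep γ] {log : γ → List (List Bool × List Bool)} (hl : PT log) :
    PT fun c => isLog (log c) :=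
  (PT.all (F := fun y : γ × (List Bool × List Bool) => TotalSearch.isSolution y.2.1 y.2.2) hl
    (by fun_prop)).and hl.isConsistent

theorem isLog_iff (log : List (List Bool × List Bool)) : isLog log = true ↔
    (∀ e ∈ log, SinkOfDAG e.1 e.2) ∧ InternallyConsistent log := by
  simp only [isLog, Bool.and_eq_true, List.all_eq_true, isSolution_iff, isConsistent_iff]

/-- By totality, queries outside the log can be given arbitrary solutions. A simulated run is thus a
run with a genuine oracle, to which the correctness and the time bound of the program apply. -/
theorem exists_instantiates {log : List (List Bool × List Bool)}
    (h1 : ∀ e ∈ log, SinkOfDAG e.1 e.2) (h2 : InternallyConsistent log) :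
    ∃ b, Instantiates b SinkOfDAG ∧ ∀ e ∈ log, b e.1 = e.2 := by
  have h : ∀ u, ∃ a, SinkOfDAG u a ∧ ∀ a', (u, a') ∈ log → a = a' := by
    intro u
    by_cases hu : ∃ a, (u, a) ∈ log
    · obtain ⟨a, ha⟩ := hu
      exact ⟨a, h1 _ ha, fun a' ha' => h2 u a a' ha ha'⟩
    · push Not at hu
      obtain ⟨a, ha⟩ := SinkOfDAG.total u
      exact ⟨a, ha, fun a' ha' => absurd ha' (hu a')⟩
  choose b hb using h
  exact ⟨b, fun u => (hb u).1, fun e he => (hb e.1).2 e.2 he⟩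

theorem sz_list_le {α : Type} [Rep α] (l : List α) (k : ℕ) (h : ∀ a ∈ l, sz a ≤ k) :
    sz l ≤ 1 + l.length * (1 + k) := by
  induction l with
  | nil => simp [sz_nil]
  | cons a l ih =>
    have h1 := h a (by simp)
    have h2 := ih fun a ha => h a (by simp [ha])
    rw [sz_cons, List.length_cons, add_mul]
    omega

/-- A search problem that is solved by a polynomial-time program with an oracle for Sink-of-DAG
reduces to Sink-of-DAG. -/
theorem reducible_of_fpOracle {R : SearchProblem}
    {h : (List Bool → List Bool) → List Bool → List Bool} (hh : FPOracle SinkOfDAG h)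
    (hR : ∀ b, Instantiates b SinkOfDAG → ∀ x, R x (h b x)) : ManyOneReducible R SinkOfDAG := by
  obtain ⟨P, p, hP⟩ := hh
  let T : List Bool → ℕ := fun x => 2 * p.eval x.length
  let view : List Bool × List (List Bool) →
      Bool × List Bool × List (List Bool × List Bool) × List (List Bool) := fun c =>
    (answeredStep^[T c.1] (answeredStart P c.1 c.2.tail)).view
  have hview : PT view := PT.answered P (n := fun c : List Bool × List (List Bool) => T c.1)
    (x := fun c => c.1) (as := fun c => c.2.tail) (by fun_prop) (by fun_prop) (by fun_prop)
  have hview_eq : ∀ x y as, view (x, y :: as) = (answeredRun P x as (T x)).view := fun _ _ _ => rfl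
  -- A state is `x` followed by answers that are all consumed, valid and consistent. The input is
  -- included because the final map of the search sees the state only.
  let valid : List Bool × List (List Bool) → Bool := fun c =>
    decide (c.2 = c.1 :: c.2.tail) && (decide ((view c).2.2.2 = []) && isLog (view c).2.2.1)
  have hvalid : ∀ x a, valid (x, a) = true → ∃ as, a = x :: as ∧
      (answeredRun P x as (T x)).2.2.2 = [] ∧
      (∀ e ∈ (answeredRun P x as (T x)).2.2.1, SinkOfDAG e.1 e.2) ∧
      InternallyConsistent (answeredRun P x as (T x)).2.2.1 := by
    intro x a ha
    simp only [valid, Bool.and_eq_true, decide_eq_true_iff] at ha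
    obtain ⟨h1, h2, h3⟩ := ha
    rw [h1, hview_eq, isLog_iff] at h3
    rw [h1, hview_eq] at h2
    exact ⟨a.tail, h1, h2, h3⟩
  have hvalid' : ∀ x as, (answeredRun P x as (T x)).2.2.2 = [] →
      (∀ e ∈ (answeredRun P x as (T x)).2.2.1, SinkOfDAG e.1 e.2) →
      InternallyConsistent (answeredRun P x as (T x)).2.2.1 → valid (x, x :: as) = true := by
    intro x as h1 h2 h3
    have h4 : isLog (view (x, x :: as)).2.2.1 = true := by
      rw [hview_eq, isLog_iff]
      exact ⟨h2, h3⟩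
    have h5 : (view (x, x :: as)).2.2.2 = [] := by
      rw [hview_eq]
      exact h1
    simp [valid, h4, h5]
  have hrun : ∀ x as, (∀ e ∈ (answeredRun P x as (T x)).2.2.1, SinkOfDAG e.1 e.2) →
      InternallyConsistent (answeredRun P x as (T x)).2.2.1 →
      ∃ b τ, Instantiates b SinkOfDAG ∧
        (∀ e ∈ (answeredRun P x as (T x)).2.2.1, b e.1 = e.2) ∧ τ 0 = h b x ∧
        (TotalSearch.smallStep b)^[T x] ([P], fun i => [x].getD i []) = ([], τ) := by
    intro x as h1 h2
    obtain ⟨b, h3, h4⟩ := exists_instantiates h1 h2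
    obtain ⟨τ, t, h5, h6, h7⟩ := hP b h3 x
    exact ⟨b, τ, h3, h4, h7, h5.smallStep_of_le (Nat.mul_le_mul_left 2 h6)⟩
  refine reducible_of_querySearch (valid := valid) (final := fun c => (view c).1)
    -- A query that occurred before is not asked again, as another solution would break consistency.
    -- The question is then the empty string, which encodes no instance, and its answer is ignored.
    (ask := fun c => if memo (view c).2.2.1 (view c).2.1 = none then (view c).2.1 else [])
    (resume := fun d => d.1.2 ++ [(memo (view d.1).2.2.1 (view d.1).2.1).getD d.2])
    -- A list of length $k$ has value $2^k-1$, which increases with each answer.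
    (val := fun c => List.replicate c.2.length true) (init := fun x => [x])
    (out := fun a => (view (a.headD [], a)).2.1)
    (by fun_prop) (by fun_prop) (by fun_prop) (by fun_prop) (by fun_prop) (by fun_prop)
    (by fun_prop)
    (1 + (4 * Polynomial.X + 1) + (1 + 2 * p * (1 + (4 * (Polynomial.X + 2 * p) + 1))))
    (fun x a ha => ?_) (fun x => ?_) (fun x a v ha hf hv => ?_) (fun x a ha hf => ?_)
  · obtain ⟨as, rfl, h1, h2, h3⟩ := hvalid x a ha
    have h4 : ∀ e ∈ (answeredRun P x as (T x)).2.2.1, e.2.length ≤ e.1.length := by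
      intro e he
      simpa [sinkOfDAGBound] using SinkOfDAG.length_le (h2 e he)
    have h5 := (length_answeredRun P x as (T x) h4).2
    have h6 := answers_answeredRun P x as (T x)
    rw [h1, List.append_nil] at h6
    have h7 := log_answeredRun_length P x as (T x)
    have h8 : ∀ a ∈ as, sz a ≤ 4 * (x.length + T x) + 1 := by
      intro a ha
      rw [← h6, List.mem_map] at ha
      obtain ⟨e, he, rfl⟩ := ha
      have := sz_bits_le e.2
      have := h4 e he
      have := h5 e he
      omega
    have h9 := sz_list_le as _ h8
    have h10 : as.length ≤ T x := by
      rw [← h6, List.length_map]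
      exact h7
    have h11 := Nat.mul_le_mul_right (1 + (4 * (x.length + T x) + 1)) h10
    have h12 := sz_bits_le x
    rw [sz_cons]
    simp only [T] at h9 h11
    simp only [Polynomial.eval_add, Polynomial.eval_mul, Polynomial.eval_one, Polynomial.eval_ofNat,
      Polynomial.eval_X]
    omega
  · have h1 := answeredRun_nil P x [] (n := 0) rfl (Nat.zero_le (T x))
    have h2 : (answeredRun P x [] 0).2.2.1 = [] := rfl
    rw [h2] at h1
    exact hvalid' x [] (by rw [h1]) (by rw [h1]; simp) (by rw [h1]; intro u a a' h; simp at h)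
  · obtain ⟨as, rfl, h1, h2, h3⟩ := hvalid x a ha
    obtain ⟨b, τ, h4, h5, h6, h7⟩ := hrun x as h2 h3
    simp only [hview_eq] at hf hv ⊢
    set C := answeredRun P x as (T x) with hC
    have hlog : C.view.2.2.1 = C.2.2.1 := rfl
    refine ⟨?_, ?_⟩
    · obtain ⟨w, hw⟩ : ∃ w, (memo C.view.2.2.1 C.view.2.1).getD v = w := ⟨_, rfl⟩
      rw [hw, List.cons_append]
      have key : SinkOfDAG C.view.2.1 w ∧ ∀ a, (C.view.2.1, a) ∈ C.2.2.1 → a = w := by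
        rcases memo_cases C.view.2.2.1 C.view.2.1 with ⟨h8, h9⟩ | ⟨a, h8, h9⟩
        · rw [if_pos h8] at hv
          rw [h8, Option.getD_none] at hw
          exact ⟨hw ▸ hv, fun a ha => absurd rfl (h9 _ ha)⟩
        · rw [h8, Option.getD_some] at hw
          subst hw
          exact ⟨h2 _ h9, fun a' ha' => h3 _ _ _ ha' h9⟩
      rcases answeredRun_cases P x as h5 h7 with ⟨h8, -⟩ | ⟨-, h8⟩
      · rw [AnsweredConfig.view, h8] at hf
        exact absurd hf (by simp)
      · have h9 := h8 w
        refine hvalid' x (as ++ [w]) (by rw [h9]) ?_ ?_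
        · rw [h9]
          intro e he
          rcases List.mem_append.1 he with he | he
          · exact h2 e he
          · rw [List.mem_singleton.1 he]
            exact key.1
        · rw [h9]
          intro u a a' ha ha'
          rw [List.mem_append, List.mem_singleton, Prod.mk.injEq] at ha ha'
          rcases ha with ha | ⟨rfl, rfl⟩ <;> rcases ha' with ha' | ⟨ha', rfl⟩
          · exact h3 u a a' ha ha'
          · subst ha'
            exact key.2 a ha
          · exact (key.2 a' ha').symm
          · rfl
    · have h8 := bitsToNat_replicate_true (x :: as).length
      rw [List.length_append, List.length_singleton]
      have h9 := bitsToNat_replicate_true ((x :: as).length + 1)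
      rw [pow_succ] at h9
      have : 0 < 2 ^ (x :: as).length := by positivity
      omega
  · obtain ⟨as, rfl, h1, h2, h3⟩ := hvalid x a ha
    obtain ⟨b, τ, h4, h5, h6, h7⟩ := hrun x as h2 h3
    simp only [hview_eq, List.headD_cons] at hf ⊢
    rcases answeredRun_cases P x as h5 h7 with ⟨h8, h9⟩ | ⟨h8, -⟩
    · rw [AnsweredConfig.view, h8, h9]
      change R x (τ 0)
      rw [h6]
      exact hR b h4 x
    · rw [AnsweredConfig.view, List.isEmpty_iff] at hf
      exact absurd hf h8

end TotalSearch

/-! ### Evaluation of oracle circuits with some answers still missing. -/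

namespace TotalSearch

/-! ## Evaluation of oracle circuits with an incomplete list of answers -/

/-- All queries have answers of full length. -/
def isFull (tr : List (List Bool × List Bool)) : Bool :=
  tr.all fun e => decide (e.2.length = e.1.length)

/-- The first query that has no answer of full length. -/
def pendingQuery (tr : List (List Bool × List Bool)) : List Bool :=
  (tr.flatMap fun e => if e.2.length < e.1.length then [e.1] else []).headD []

/-- The pairs (query, answer) with answers of full length. -/
def completed (tr : List (List Bool × List Bool)) : List (List Bool × List Bool) :=
  tr.flatMap fun e => if e.2.length = e.1.length then [e] else []

/-- The string `w` consists of the answers in `tr`, and each of them is of full length or empty. -/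
def isRow (tr : List (List Bool × List Bool)) (w : List Bool) : Bool :=
  decide ((tr.flatMap fun e => e.2) = w) &&
    tr.all fun e => decide (e.2.length = e.1.length) || decide (e.2 = [])

/-- The suffix of `a` that has the length of the solutions of `u` is a solution. -/
def isAnswer (u a : List Bool) : Bool :=
  isSolution u (a.drop (a.length - (startPoint u).length))

/-- The answers of full length are valid, and internally consistent. -/
def isPartialTrace (tr : List (List Bool × List Bool)) : Bool :=
  ((completed tr).all fun e => isAnswer e.1 e.2) && isConsistent (completed tr)

section

variable {γ : Type} [Rep γ] {tr : γ → List (List Bool × List Bool)}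

@[fun_prop]
theorem PT.isFull (h : PT tr) : PT fun c => isFull (tr c) :=
  PT.all (F := fun y : γ × (List Bool × List Bool) => decide (y.2.2.length = y.2.1.length)) h
    (by fun_prop)

@[fun_prop]
theorem PT.pendingQuery (h : PT tr) : PT fun c => pendingQuery (tr c) :=
  PT.headD (PT.flatMap (F := fun y : γ × (List Bool × List Bool) =>
    if y.2.2.length < y.2.1.length then [y.2.1] else []) h (by fun_prop)) (PT.const _)

@[fun_prop]
theorem PT.completed (h : PT tr) : PT fun c => completed (tr c) :=
  PT.flatMap (F := fun y : γ × (List Bool × List Bool) =>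
    if y.2.2.length = y.2.1.length then [y.2] else []) h (by fun_prop)

@[fun_prop]
theorem PT.isRow {w : γ → List Bool} (h : PT tr) (hw : PT w) : PT fun c => isRow (tr c) (w c) := by
  have h1 : PT fun c => (tr c).flatMap fun e => e.2 :=
    PT.flatMap (F := fun y : γ × (List Bool × List Bool) => y.2.2) h (by fun_prop)
  exact (h1.decide_eq hw).and (PT.all (F := fun y : γ × (List Bool × List Bool) =>
    decide (y.2.2.length = y.2.1.length) || decide (y.2.2 = [])) h (by fun_prop))

@[fun_prop]
theorem PT.isAnswer {u a : γ → List Bool} (hu : PT u) (ha : PT a) :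
    PT fun c => isAnswer (u c) (a c) := by
  unfold TotalSearch.isAnswer
  fun_prop

@[fun_prop]
theorem PT.isPartialTrace (h : PT tr) : PT fun c => isPartialTrace (tr c) :=
  (PT.all (F := fun y : γ × (List Bool × List Bool) => TotalSearch.isAnswer y.2.1 y.2.2)
    h.completed (by fun_prop)).and h.completed.isConsistent

end

theorem isFull_iff (tr : List (List Bool × List Bool)) :
    isFull tr = true ↔ ∀ e ∈ tr, e.2.length = e.1.length := by
  simp [isFull]

theorem mem_completed {tr : List (List Bool × List Bool)} {e : List Bool × List Bool} :
    e ∈ completed tr ↔ e ∈ tr ∧ e.2.length = e.1.length := by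
  simp only [completed, List.mem_flatMap]
  constructor
  · rintro ⟨e', h1, h2⟩
    split_ifs at h2 with h
    · rw [List.mem_singleton.1 h2]
      exact ⟨h1, h⟩
    · simp at h2
  · rintro ⟨h1, h2⟩
    exact ⟨e, h1, by simp [h2]⟩

theorem isRow_iff (tr : List (List Bool × List Bool)) (w : List Bool) : isRow tr w = true ↔
    (tr.flatMap fun e => e.2) = w ∧ ∀ e ∈ tr, e.2.length = e.1.length ∨ e.2 = [] := by
  simp [isRow]

theorem isPartialTrace_iff (tr : List (List Bool × List Bool)) : isPartialTrace tr = true ↔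
    (∀ e ∈ completed tr, isAnswer e.1 e.2 = true) ∧ InternallyConsistent (completed tr) := by
  simp only [isPartialTrace, Bool.and_eq_true, List.all_eq_true, isConsistent_iff]

theorem SinkOfDAG.length_eq {u v : List Bool} (h : SinkOfDAG u v) :
    v.length = (startPoint u).length := by
  rw [← isSolution_iff] at h
  unfold isSolution at h
  unfold startPoint
  split_ifs at h ⊢ with hi
  · simp only [Bool.and_eq_true, decide_eq_true_iff] at h
    simp [zeros, h.1]
  · simpa using h

theorem isAnswer_padLeft {u v : List Bool} (h : SinkOfDAG u v) :
    isAnswer u (padLeft u.length v) = true := by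
  have h1 : v.length ≤ u.length := by simpa [sinkOfDAGBound] using h.length_le
  rw [isAnswer, ← h.length_eq, padLeft_length, padLeft_of_le h1, List.drop_left' (by simp [zeros]),
    isSolution_iff]
  exact h

theorem sinkOfDAG_nil {v : List Bool} (h : v = []) : SinkOfDAG [] v := by
  refine Or.inr ⟨?_, h⟩
  rintro ⟨C, -, hC⟩
  simp [Circuit.encode, natCode] at hC

/-- An entry with an empty answer is either incomplete, hence ignored, or belongs to the empty
query, for which the empty answer is correct and the only one of full length. So the one new answer
is all that has to be checked. -/
theorem isPartialTrace_of_subset {tr tr' : List (List Bool × List Bool)}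
    (h : isPartialTrace tr = true) {u a : List Bool} (hu : isAnswer u a = true)
    (h1 : ∀ a', (u, a') ∈ completed tr → a' = a)
    (h2 : ∀ e ∈ tr', e ∈ tr ∨ e.2 = [] ∨ e = (u, a)) : isPartialTrace tr' = true := by
  rw [isPartialTrace_iff] at h ⊢
  have key : ∀ e ∈ completed tr', e ∈ completed tr ∨ e = ([], []) ∨ e = (u, a) := by
    rintro ⟨e1, e2⟩ he
    obtain ⟨h3, h4⟩ := mem_completed.1 he
    rcases h2 _ h3 with h5 | h5 | h5
    · exact Or.inl (mem_completed.2 ⟨h5, h4⟩)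
    · simp only at h4 h5
      subst h5
      right; left
      rw [List.length_nil, eq_comm, List.length_eq_zero_iff] at h4
      rw [h4]
    · exact Or.inr (Or.inr h5)
  have hnil : ∀ e2, ([], e2) ∈ completed tr' → e2 = [] := by
    intro e2 he
    have := (mem_completed.1 he).2
    simpa using this
  refine ⟨fun e he => ?_, fun v b b' hb hb' => ?_⟩
  · rcases key e he with h3 | rfl | rfl
    · exact h.1 e h3
    · exact (isSolution_iff _ _).2 (sinkOfDAG_nil (by simp))
    · exact hu
  · by_cases hv : v = []
    · subst hv
      rw [hnil _ hb, hnil _ hb']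
    · rcases key _ hb with h3 | h3 | h3 <;> rcases key _ hb' with h4 | h4 | h4
      · exact h.2 v b b' h3 h4
      · exact absurd (Prod.mk.inj h4).1 hv
      · obtain ⟨rfl, rfl⟩ := Prod.mk.inj h4
        exact h1 _ h3
      · exact absurd (Prod.mk.inj h3).1 hv
      · exact absurd (Prod.mk.inj h3).1 hv
      · exact absurd (Prod.mk.inj h3).1 hv
      · obtain ⟨rfl, rfl⟩ := Prod.mk.inj h3
        exact (h1 _ h4).symm
      · exact absurd (Prod.mk.inj h4).1 hv
      · rw [(Prod.mk.inj h3).2, (Prod.mk.inj h4).2]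

theorem runGates_nil_answers (gs : List Gate) (vals : List Bool) :
    ∀ e ∈ (runGates (fun k => k) gs vals []).2, e.2 = [] := by
  induction gs generalizing vals with
  | nil => simp [runGates]
  | cons g gs ih =>
    cases g with
    | const c => exact ih _
    | nand i j => exact ih _
    | oracle ins =>
      intro e he
      simp only [runGates, List.take_nil, List.drop_nil, List.mem_cons] at he
      rcases he with rfl | he
      · rfl
      · exact ih _ e he

theorem runGates_queries_length (gs : List Gate) (vals w : List Bool) :
    ((runGates (fun k => k) gs vals w).2.map fun e => e.1.length).sum =
      (gs.map (Gate.answerBits fun k => k)).sum := by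
  induction gs generalizing vals w with
  | nil => rfl
  | cons g gs ih =>
    cases g with
    | const c => simp [runGates, Gate.answerBits, ih]
    | nand i j => simp [runGates, Gate.answerBits, ih]
    | oracle ins => simp [runGates, Gate.answerBits, ih]

/-- Answers are cut off `w` in gate order, so there is a first gate that lacks its answer, and all
gates behind it receive nothing. Earlier queries depend on earlier answers only: appending an answer
leaves those entries unchanged and fills the first gap. Later queries may change, but they have only
empty answers. -/
theorem runGates_cases (gs : List Gate) (vals w : List Bool)
    (h : isRow (runGates (fun k => k) gs vals w).2 w = true) :
    isFull (runGates (fun k => k) gs vals w).2 = true ∨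
      ∃ u, pendingQuery (runGates (fun k => k) gs vals w).2 = u ∧ u ≠ [] ∧
        ∀ a, a.length = u.length →
          isRow (runGates (fun k => k) gs vals (w ++ a)).2 (w ++ a) = true ∧
          ∀ e ∈ (runGates (fun k => k) gs vals (w ++ a)).2,
            e ∈ (runGates (fun k => k) gs vals w).2 ∨ e.2 = [] ∨ e = (u, a) := by
  induction gs generalizing vals w with
  | nil => exact Or.inl rfl
  | cons g gs ih =>
    cases g with
    | const c => exact ih _ _ h
    | nand i j => exact ih _ _ h
    | oracle ins =>
      simp only [runGates] at h ⊢
      rw [isRow_iff] at h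
      obtain ⟨h1, h2⟩ := h
      rw [List.flatMap_cons] at h1
      simp only at h1
      have h3 := h2 _ List.mem_cons_self
      simp only [List.length_map] at h3
      by_cases hk : (w.take ins.length).length = ins.length
      · have hkw : ins.length ≤ w.length := by
          rw [List.length_take] at hk
          omega
        have h4 : isRow (runGates (fun k => k) gs (vals ++ w.take ins.length)
            (w.drop ins.length)).2 (w.drop ins.length) = true := by
          rw [isRow_iff]
          refine ⟨?_, fun e he => h2 e (List.mem_cons_of_mem _ he)⟩
          rw [← List.append_cancel_left_eq (w.take ins.length), h1, List.take_append_drop]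
        rcases ih _ _ h4 with h5 | ⟨u, h5, h6, h7⟩
        · left
          rw [isFull_iff] at h5 ⊢
          intro e he
          rcases List.mem_cons.1 he with rfl | he
          · simpa using hk
          · exact h5 e he
        · right
          refine ⟨u, ?_, h6, fun a ha => ?_⟩
          · rw [pendingQuery, List.flatMap_cons, if_neg (by simp [hk]), List.nil_append]
            exact h5
          · obtain ⟨h8, h9⟩ := h7 a ha
            rw [List.take_append_of_le_length hkw, List.drop_append_of_le_length hkw]
            rw [isRow_iff] at h8 ⊢
            refine ⟨⟨?_, fun e he => ?_⟩, fun e he => ?_⟩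
            · rw [List.flatMap_cons, h8.1, ← List.append_assoc, List.take_append_drop]
            · rcases List.mem_cons.1 he with rfl | he
              · exact Or.inl (by simpa using hk)
              · exact h8.2 e he
            · rcases List.mem_cons.1 he with rfl | he
              · exact Or.inl List.mem_cons_self
              · exact (h9 e he).imp_left (List.mem_cons_of_mem _)
      · right
        have h4 := h3.resolve_left hk
        have hk0 : ins.length ≠ 0 := by
          intro h0
          rw [h0] at hk
          simp at hk
        have hw : w = [] := (List.take_eq_nil_iff.1 h4).resolve_left hk0
        subst hw
        refine ⟨ins.map (wire vals), ?_, ?_, fun a ha => ?_⟩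
        · rw [pendingQuery, List.flatMap_cons, if_pos (by simp; omega)]
          rfl
        · intro h0
          rw [List.map_eq_nil_iff] at h0
          simp [h0] at hk0
        · rw [List.length_map] at ha
          rw [List.nil_append, List.take_of_length_le ha.le, List.drop_of_length_le ha.le]
          have h5 := runGates_nil_answers gs (vals ++ a)
          refine ⟨(isRow_iff _ _).2 ⟨?_, fun e he => ?_⟩, fun e he => ?_⟩
          · rw [List.flatMap_cons, List.flatMap_eq_nil_iff.2 h5, List.append_nil]
          · rcases List.mem_cons.1 he with rfl | he
            · exact Or.inl (by simp [ha])
            · exact Or.inr (h5 e he)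
          · rcases List.mem_cons.1 he with rfl | he
            · exact Or.inr (Or.inr rfl)
            · exact Or.inr (Or.inl (h5 e he))

/-- The list of all pairs (query, answer) in the evaluation of an oracle circuit. -/
def Circuit.trace (C : Circuit) (v w : List Bool) : List (List Bool × List Bool) :=
  (C.run (fun k => k) v w).2

/-- The successor of `v` in an instance with oracle gates. -/
def Circuit.succ (C : Circuit) (v w : List Bool) : List Bool :=
  (C.run (fun k => k) v w).1.take C.inputs

/-- The value of `v` in an instance with oracle gates. -/
def Circuit.value (C : Circuit) (v w : List Bool) : List Bool :=
  (C.run (fun k => k) v w).1.drop C.inputs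

section

variable {γ : Type} [Rep γ] {C : γ → Circuit} {v w : γ → List Bool}

@[fun_prop]
theorem PT.trace (hC : PT C) (hv : PT v) (hw : PT w) : PT fun c => (C c).trace (v c) (w c) := by
  unfold Circuit.trace
  fun_prop

@[fun_prop]
theorem PT.circuitSucc (hC : PT C) (hv : PT v) (hw : PT w) :
    PT fun c => (C c).succ (v c) (w c) := by
  unfold Circuit.succ
  fun_prop

@[fun_prop]
theorem PT.value (hC : PT C) (hv : PT v) (hw : PT w) : PT fun c => (C c).value (v c) (w c) := by
  unfold Circuit.value
  fun_prop

end

/-- Oracle gates have as many outputs as inputs, so the total length of the queries in a trace is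
the number of answer bits of the circuit, whatever the answers. -/
theorem length_le_of_isRow {C : Circuit} {v w : List Bool} (h : isRow (C.trace v w) w = true) :
    w.length ≤ C.answerBits (fun k => k) ∧
      (isFull (C.trace v w) = true → w.length = C.answerBits fun k => k) := by
  have h1 := runGates_queries_length C.gates v w
  obtain ⟨h2, h3⟩ := (isRow_iff _ _).1 h
  rw [isFull_iff]
  change ((C.trace v w).map _).sum = C.answerBits _ at h1
  have h4 : w.length = ((C.trace v w).map fun e => e.2.length).sum := by
    conv_lhs => rw [← h2]
    rw [List.length_flatMap]
  rw [h4, ← h1]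
  refine ⟨List.sum_le_sum fun e he => ?_, fun h5 => ?_⟩
  · rcases h3 e he with h5 | h5
    · exact h5.le
    · simp [h5]
  · rw [List.map_congr_left h5]

theorem answerBits_le (C : Circuit) : C.answerBits (fun k => k) ≤ C.encode.length := by
  have h : (C.gates.map (Gate.answerBits fun k => k)).sum ≤ (C.gates.flatMap Gate.encode).length := by
    rw [List.length_flatMap]
    refine List.sum_le_sum fun g _ => ?_
    cases g with
    | const c => simp [Gate.answerBits]
    | nand i j => simp [Gate.answerBits]
    | oracle ins => simp [Gate.answerBits, Gate.encode, listCode, natCode]; omega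
  simp only [Circuit.encode, listCode, List.length_append, Circuit.answerBits]
  omega

end TotalSearch

/-! ### The search for a solution of an instance with oracle gates. -/

namespace TotalSearch

/-! ## The relativized problem reduces to Sink-of-DAG -/

/-- The states of the search for a solution of an instance with oracle gates: `w` and `w'` are the
answers so far in the evaluations of the circuit at `v` and at the successor of `v`. -/
def Circuit.isSearchState (C : Circuit) (v w w' : List Bool) : Bool :=
  (decide (v.length = C.inputs) && (isRow (C.trace v w) w &&
    isRow (C.trace (C.succ v w) w') w')) &&
  (((decide (v = zeros C.inputs) || (isFull (C.trace v w) && !decide (C.succ v w = v))) &&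
    (isFull (C.trace v w) || decide (w' = []))) &&
  isPartialTrace (C.trace v w ++ C.trace (C.succ v w) w'))

/-- The search has come to an end. -/
def Circuit.isFinal (C : Circuit) (v w w' : List Bool) : Bool :=
  isFull (C.trace v w) && (decide (C.succ v w = v) || (isFull (C.trace (C.succ v w) w') &&
    (decide (C.succ (C.succ v w) w' = C.succ v w) ||
      leBits (C.value (C.succ v w) w') (C.value v w))))

theorem Circuit.isSearchState_iff (C : Circuit) (v w w' : List Bool) :
    C.isSearchState v w w' = true ↔
      (v.length = C.inputs ∧ isRow (C.trace v w) w = true ∧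
        isRow (C.trace (C.succ v w) w') w' = true) ∧
      ((v = zeros C.inputs ∨ isFull (C.trace v w) = true ∧ C.succ v w ≠ v) ∧
        (isFull (C.trace v w) = true ∨ w' = [])) ∧
      isPartialTrace (C.trace v w ++ C.trace (C.succ v w) w') = true := by
  simp only [Circuit.isSearchState, Bool.and_eq_true, decide_eq_true_iff, Bool.or_eq_true,
    Bool.not_eq_true', decide_eq_false_iff_not, ne_eq]

theorem Circuit.succ_length {C : Circuit} (hC : C.outputs.length = 2 * C.inputs) (v w : List Bool) :
    (C.succ v w).length = C.inputs := by
  rw [Circuit.succ, List.length_take, run_length, hC]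
  omega

theorem Circuit.value_length {C : Circuit} (hC : C.outputs.length = 2 * C.inputs)
    (v w : List Bool) : (C.value v w).length = C.inputs := by
  rw [Circuit.value, List.length_drop, run_length, hC]
  omega

theorem isRow_nil (C : Circuit) (v : List Bool) : isRow (C.trace v []) [] = true := by
  have h := runGates_nil_answers C.gates v
  exact (isRow_iff _ _).2 ⟨List.flatMap_eq_nil_iff.2 h, fun e he => Or.inr (h e he)⟩

theorem isPartialTrace_of_nil {tr tr' : List (List Bool × List Bool)}
    (h : isPartialTrace tr = true) (h' : ∀ e ∈ tr', e ∈ tr ∨ e.2 = []) :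
    isPartialTrace tr' = true :=
  isPartialTrace_of_subset h (u := []) (a := []) ((isSolution_iff _ _).2 (sinkOfDAG_nil (by simp)))
    (fun a' ha' => by simpa using (mem_completed.1 ha').2)
    fun e he => (h' e he).imp_right Or.inl

theorem Circuit.isSearchState_init (C : Circuit) :
    C.isSearchState (zeros C.inputs) [] [] = true := by
  rw [Circuit.isSearchState_iff]
  refine ⟨⟨by simp [zeros], isRow_nil _ _, isRow_nil _ _⟩, ⟨Or.inl rfl, Or.inr rfl⟩, ?_⟩
  refine isPartialTrace_of_nil (tr := []) rfl fun e he => Or.inr ?_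
  rcases List.mem_append.1 he with he | he
  · exact runGates_nil_answers _ _ e he
  · exact runGates_nil_answers _ _ e he

theorem exists_of_isAnswer {u a : List Bool} (h : isAnswer u a = true) :
    ∃ s, s <:+ a ∧ SinkOfDAG u s := by
  rw [isAnswer, isSolution_iff] at h
  exact ⟨_, List.drop_suffix _ _, h⟩

/-- A final state is a solution. -/
theorem Circuit.isRelativizedSolution_of_isFinal {C : Circuit} {v w w' : List Bool}
    (h : C.isSearchState v w w' = true) (hf : C.isFinal v w w' = true)
    (hC : C.outputs.length = 2 * C.inputs) :
    IsRelativizedSolution sinkOfDAGProblem SinkOfDAG (fun k => k) C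
      (v ++ w ++ if w'.length = w.length then w' else w) := by
  obtain ⟨⟨h1, h2, h3⟩, ⟨h4, -⟩, h6⟩ := (C.isSearchState_iff v w w').1 h
  simp only [Circuit.isFinal, Bool.and_eq_true, Bool.or_eq_true, decide_eq_true_iff] at hf
  obtain ⟨h7, h8⟩ := hf
  have hw := (length_le_of_isRow h2).2 h7
  -- A solution must contain two rows of full length even if the verifier stops after the first
  -- evaluation. If $S(v)\ne v$, the second row is complete and is used; if $S(v)=v$, it is never
  -- read, and `w` fills the place should `w'` be too short.
  obtain ⟨r, hr⟩ : ∃ r, (if w'.length = w.length then w' else w) = r := ⟨_, rfl⟩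
  have hrl : r.length = w.length := by
    rw [← hr]
    split_ifs with hl
    · exact hl
    · rfl
  have hr' : C.succ v w ≠ v → isFull (C.trace (C.succ v w) w') = true ∧ r = w' ∧
      (C.succ (C.succ v w) w' = C.succ v w ∨ leBits (C.value (C.succ v w) w') (C.value v w) = true) := by
    intro hne
    have h9 := h8.resolve_left hne
    refine ⟨h9.1, ?_, h9.2⟩
    rw [← hr, if_pos (((length_le_of_isRow h3).2 h9.1).trans hw.symm)]
  obtain ⟨h9, h10⟩ := (isPartialTrace_iff _).1 h6
  have hvalid : ∀ tr : List (List Bool × List Bool), isFull tr = true →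
      (∀ e ∈ tr, e ∈ C.trace v w ++ C.trace (C.succ v w) w') →
      AnswersValid SinkOfDAG tr ∧ InternallyConsistent tr := by
    intro tr h11 h12
    rw [isFull_iff] at h11
    have h13 : ∀ e ∈ tr, e ∈ completed (C.trace v w ++ C.trace (C.succ v w) w') :=
      fun e he => mem_completed.2 ⟨h12 e he, h11 e he⟩
    exact ⟨fun u a hu => exists_of_isAnswer (h9 (u, a) (h13 _ hu)),
      fun u a a' ha ha' => h10 u a a' (h13 _ ha) (h13 _ ha')⟩
  rw [hr]
  have hrun : (C.run (fun k => k) v w).1.take C.inputs = C.succ v w := rfl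
  have hrun' : (C.run (fun k => k) v w).1.drop C.inputs = C.value v w := rfl
  have htr : ∀ v w, (C.run (fun k => k) v w).2 = C.trace v w := fun _ _ => rfl
  have e1 : (v ++ w ++ r).take C.inputs = v := by
    rw [List.append_assoc, List.take_left' h1]
  have e2 : (v ++ w ++ r).drop C.inputs = w ++ r := by
    rw [List.append_assoc, List.drop_left' h1]
  have e3 : (List.range 2).map (fun i => ((w ++ r).drop
      (i * C.answerBits fun k => k)).take (C.answerBits fun k => k)) = [w, r] := by
    rw [← hw]
    simp [List.range_succ, List.take_of_length_le hrl.le]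
  simp only [IsRelativizedSolution, sinkOfDAGProblem, e1, e2, e3]
  refine ⟨by simp only [List.length_append, h1, hrl, hw]; ring, ?_⟩
  by_cases hne : C.succ v w = v
  · simp only [sinkOfDAGVerifier, BlackBox.simulate, hrun, hne, if_true, htr, List.append_nil]
    obtain ⟨h11, h12⟩ := hvalid _ h7 fun e he => List.mem_append_left _ he
    refine ⟨h11, h12, ?_⟩
    rw [decide_eq_true_iff]
    -- A fixed point is a search state only as $0^n$, the one case in which the verifier accepts it.
    exact h4.resolve_right fun h => h.2 hne
  · obtain ⟨h11, rfl, h12⟩ := hr' hne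
    simp only [sinkOfDAGVerifier, BlackBox.simulate, hrun, if_neg hne, htr, List.append_nil]
    obtain ⟨h13, h14⟩ := hvalid (C.trace v w ++ C.trace (C.succ v w) r) (by
        rw [isFull_iff] at h7 h11 ⊢
        intro e he
        rcases List.mem_append.1 he with he | he
        · exact h7 e he
        · exact h11 e he) fun e he => he
    refine ⟨h13, h14, ?_⟩
    rw [decide_eq_true_iff]
    rw [leBits_iff (by rw [Circuit.value_length hC, Circuit.value_length hC])] at h12
    exact h12

/-- The answer that is used in the evaluation: the earlier answer to the same query if there is
one. -/
def usedAnswer (tr : List (List Bool × List Bool)) (u v : List Bool) : List Bool :=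
  (memo (completed tr) u).getD (padLeft u.length v)

/-- The next query of the search. -/
def Circuit.searchQuery (C : Circuit) (v w w' : List Bool) : List Bool :=
  if isFull (C.trace v w) = true then pendingQuery (C.trace (C.succ v w) w')
  else pendingQuery (C.trace v w)

/-- The next instance to be solved in the search. -/
def Circuit.searchAsk (C : Circuit) (v w w' : List Bool) : List Bool :=
  if memo (completed (C.trace v w ++ C.trace (C.succ v w) w')) (C.searchQuery v w w') = none then
    C.searchQuery v w w' else []

/-- The next state of the search when `y` is the answer to the query. -/
def Circuit.searchNext (C : Circuit) (v w w' y : List Bool) : List (List Bool) :=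
  if isFull (C.trace v w) = true then
    if isFull (C.trace (C.succ v w) w') = true then [C.succ v w, w', []]
    else [v, w, w' ++ usedAnswer (C.trace v w ++ C.trace (C.succ v w) w') (C.searchQuery v w w') y]
  else [v, w ++ usedAnswer (C.trace v w ++ C.trace (C.succ v w) w') (C.searchQuery v w w') y, []]

/-- The value of a state of the search; `m` is the length of a counter. -/
def Circuit.searchValue (C : Circuit) (m : ℕ) (v w w' : List Bool) : List Bool :=
  (isFull (C.trace v w) :: if isFull (C.trace v w) = true then C.value v w else zeros C.inputs) ++
    padLeft m (List.replicate (w.length + w'.length) true)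

/-- An earlier answer is valid and unique by the assumption on the trace. A fresh solution is padded
on the left to the length of the query, which is permitted because only a suffix of an answer has to
be a solution. -/
theorem usedAnswer_spec {tr : List (List Bool × List Bool)} (h : isPartialTrace tr = true)
    {u y : List Bool} (hy : SinkOfDAG (if memo (completed tr) u = none then u else []) y) :
    isAnswer u (usedAnswer tr u y) = true ∧ (usedAnswer tr u y).length = u.length ∧
      ∀ a, (u, a) ∈ completed tr → a = usedAnswer tr u y := by
  rw [isPartialTrace_iff] at h
  rcases memo_cases (completed tr) u with ⟨h1, h2⟩ | ⟨a, h1, h2⟩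
  · rw [if_pos h1] at hy
    rw [usedAnswer, h1, Option.getD_none]
    exact ⟨isAnswer_padLeft hy, padLeft_length _ _, fun a ha => absurd rfl (h2 _ ha)⟩
  · rw [usedAnswer, h1, Option.getD_some]
    exact ⟨h.1 (u, a) h2, (mem_completed.1 h2).2, fun a' ha' => h.2 _ _ _ ha' h2⟩

/-- The order is lexicographic. The leading part is `0` followed by zeros while the first row is
incomplete, and `1` followed by $V(v)$ afterwards; the trailing part is $2^k-1$ for $k$ answer bits,
padded to a fixed length. -/
theorem Circuit.searchValue_lt {C : Circuit} {m : ℕ} {v w w' z x x' : List Bool}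
    (h : bitsToNat (isFull (C.trace v w) ::
      if isFull (C.trace v w) = true then C.value v w else zeros C.inputs) <
      bitsToNat (isFull (C.trace z x) ::
        if isFull (C.trace z x) = true then C.value z x else zeros C.inputs) ∨
      (isFull (C.trace v w) ::
        if isFull (C.trace v w) = true then C.value v w else zeros C.inputs) =
      (isFull (C.trace z x) ::
        if isFull (C.trace z x) = true then C.value z x else zeros C.inputs) ∧
      w.length + w'.length < x.length + x'.length ∧ x.length + x'.length ≤ m) :
    bitsToNat (C.searchValue m v w w') < bitsToNat (C.searchValue m z x x') := by
  rw [Circuit.searchValue, Circuit.searchValue]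
  rcases h with h | ⟨h1, h2, h3⟩
  · exact bitsToNat_append_lt h (by rw [padLeft_length, padLeft_length])
  · rw [h1, bitsToNat_append, bitsToNat_append (l := _ :: _), padLeft_length, padLeft_length,
      bitsToNat_padLeft (by simp; omega), bitsToNat_padLeft (by simpa using h3)]
    have h4 := bitsToNat_replicate_true (w.length + w'.length)
    have h5 := bitsToNat_replicate_true (x.length + x'.length)
    have h6 := Nat.pow_lt_pow_right (a := 2) (by norm_num) h2
    omega

theorem bitsToNat_true_cons_lt {l m : List Bool} (h : bitsToNat l < bitsToNat m)
    (hl : l.length = m.length) : bitsToNat (true :: l) < bitsToNat (true :: m) := by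
  rw [← List.singleton_append, ← List.singleton_append (l := m), bitsToNat_append,
    bitsToNat_append, hl]
  omega

/-- Three kinds of steps. While the row of `v` is incomplete (so that `v` is $0^n$), or else the row
of its successor, one answer is added and the count of answer bits grows, or the leading flag is
switched on. If both rows are complete and `v` is no solution, the search moves to the successor and
takes its row along, so that its value is literally the one just compared, and this value is larger.
-/
theorem Circuit.isSearchState_next {C : Circuit} {v w w' y : List Bool}
    (hC : C.outputs.length = 2 * C.inputs)
    (h : C.isSearchState v w w' = true) (hf : C.isFinal v w w' = false)
    (hy : SinkOfDAG (C.searchAsk v w w') y) {m : ℕ} (hm : 2 * C.answerBits (fun k => k) ≤ m) :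
    ∃ z x x', C.searchNext v w w' y = [z, x, x'] ∧ C.isSearchState z x x' = true ∧
      bitsToNat (C.searchValue m v w w') < bitsToNat (C.searchValue m z x x') := by
  obtain ⟨⟨h1, h2, h3⟩, ⟨h4, h5⟩, h6⟩ := (C.isSearchState_iff v w w').1 h
  obtain ⟨ha, hal, hau⟩ := usedAnswer_spec h6 hy
  set a := usedAnswer (C.trace v w ++ C.trace (C.succ v w) w') (C.searchQuery v w w') y
  cases hF : isFull (C.trace v w) with
  | false =>
    have h5 := h5.resolve_left (by simp [hF])
    subst h5
    obtain ⟨u, hu, hu0, hstep⟩ := (runGates_cases C.gates v w h2).resolve_left (by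
      change ¬ isFull (C.trace v w) = true
      simp [hF])
    have hq : C.searchQuery v w [] = u := by
      rw [Circuit.searchQuery, hF, if_neg (by simp)]
      exact hu
    rw [hq] at hal hau ha
    obtain ⟨hrow, hmem⟩ := hstep a hal
    have hrow : isRow (C.trace v (w ++ a)) (w ++ a) = true := hrow
    have hempty : ∀ z, ∀ e ∈ C.trace z [], e.2 = [] := fun z => runGates_nil_answers C.gates z
    have ha0 : 0 < a.length := by
      rw [hal]
      exact List.length_pos_of_ne_nil hu0
    have hl := (length_le_of_isRow hrow).1
    rw [List.length_append] at hl
    refine ⟨v, w ++ a, [], by rw [Circuit.searchNext, hF, if_neg (by simp)], ?_, ?_⟩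
    · rw [Circuit.isSearchState_iff]
      have h4 := h4.resolve_right (by simp [hF])
      refine ⟨⟨h1, hrow, isRow_nil _ _⟩, ⟨Or.inl h4, Or.inr rfl⟩, ?_⟩
      refine isPartialTrace_of_subset h6 ha hau fun e he => ?_
      rcases List.mem_append.1 he with he | he
      · exact (hmem e he).imp_left (List.mem_append_left _)
      · exact Or.inr (Or.inl (hempty _ e he))
    · apply Circuit.searchValue_lt
      cases hF'' : isFull (C.trace v (w ++ a)) with
      | false =>
        right
        refine ⟨by simp [hF], ?_, ?_⟩ <;> simp only [List.length_append, List.length_nil] <;> omega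
      | true =>
        left
        simp only [hF, if_true, Bool.false_eq_true, if_false]
        rw [← List.singleton_append, ← List.singleton_append (l := C.value _ _)]
        exact bitsToNat_append_lt (by simp [bitsToNat]) (by
          rw [Circuit.value_length hC]; simp [zeros])
  | true =>
    cases hG : isFull (C.trace (C.succ v w) w') with
    | true =>
      simp only [Circuit.isFinal, hF, hG, Bool.true_and, Bool.or_eq_false_iff,
        decide_eq_false_iff_not] at hf
      obtain ⟨h7, h8, h9⟩ := hf
      refine ⟨C.succ v w, w', [], by rw [Circuit.searchNext, hF, hG, if_pos rfl, if_pos rfl], ?_, ?_⟩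
      · rw [Circuit.isSearchState_iff]
        refine ⟨⟨Circuit.succ_length hC _ _, h3, isRow_nil _ _⟩,
          ⟨Or.inr ⟨hG, h8⟩, Or.inr rfl⟩, ?_⟩
        -- The row of the old vertex is dropped and the row of the new successor is still empty, so
        -- no new answer appears.
        refine isPartialTrace_of_nil h6 fun e he => ?_
        rcases List.mem_append.1 he with he | he
        · exact Or.inl (List.mem_append_right _ he)
        · exact Or.inr (runGates_nil_answers _ _ e he)
      · apply Circuit.searchValue_lt
        left
        simp only [hF, hG, if_true]
        refine bitsToNat_true_cons_lt ?_ (by rw [Circuit.value_length hC, Circuit.value_length hC])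
        rw [← not_le, ← leBits_iff (by rw [Circuit.value_length hC, Circuit.value_length hC]), h9]
        simp
    | false =>
      obtain ⟨u, hu, hu0, hstep⟩ := (runGates_cases C.gates (C.succ v w) w' h3).resolve_left (by
        change ¬ isFull (C.trace (C.succ v w) w') = true
        simp [hG])
      have hq : C.searchQuery v w w' = u := by
        rw [Circuit.searchQuery, hF, if_pos rfl]
        exact hu
      rw [hq] at hal hau ha
      obtain ⟨hrow, hmem⟩ := hstep a hal
      have hrow : isRow (C.trace (C.succ v w) (w' ++ a)) (w' ++ a) = true := hrow
      have ha0 : 0 < a.length := by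
        rw [hal]
        exact List.length_pos_of_ne_nil hu0
      have hl := (length_le_of_isRow hrow).1
      have hl' := (length_le_of_isRow h2).1
      rw [List.length_append] at hl
      refine ⟨v, w, w' ++ a,
        by rw [Circuit.searchNext, hF, hG, if_pos rfl, if_neg (by simp)], ?_, ?_⟩
      · rw [Circuit.isSearchState_iff]
        refine ⟨⟨h1, h2, hrow⟩, ⟨h4, Or.inl hF⟩, ?_⟩
        refine isPartialTrace_of_subset h6 ha hau fun e he => ?_
        rcases List.mem_append.1 he with he | he
        · exact Or.inl (List.mem_append_left _ he)
        · exact (hmem e he).imp_left (List.mem_append_right _)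
      · apply Circuit.searchValue_lt
        right
        refine ⟨rfl, ?_, ?_⟩ <;> simp only [List.length_append] <;> omega

end TotalSearch

/-! ### Assembly of the reductions and the two inclusions. -/

namespace TotalSearch

section

variable {γ : Type} [Rep γ] {C : γ → Circuit} {v w w' : γ → List Bool}

@[fun_prop]
theorem PT.isSearchState (hC : PT C) (hv : PT v) (hw : PT w) (hw' : PT w') :
    PT fun c => (C c).isSearchState (v c) (w c) (w' c) := by
  unfold Circuit.isSearchState
  fun_prop

@[fun_prop]
theorem PT.isFinal (hC : PT C) (hv : PT v) (hw : PT w) (hw' : PT w') :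
    PT fun c => (C c).isFinal (v c) (w c) (w' c) := by
  unfold Circuit.isFinal
  fun_prop

@[fun_prop]
theorem PT.searchQuery (hC : PT C) (hv : PT v) (hw : PT w) (hw' : PT w') :
    PT fun c => (C c).searchQuery (v c) (w c) (w' c) := by
  unfold Circuit.searchQuery
  fun_prop

@[fun_prop]
theorem PT.searchAsk (hC : PT C) (hv : PT v) (hw : PT w) (hw' : PT w') :
    PT fun c => (C c).searchAsk (v c) (w c) (w' c) := by
  unfold Circuit.searchAsk
  fun_prop

@[fun_prop]
theorem PT.searchNext {y : γ → List Bool} (hC : PT C) (hv : PT v) (hw : PT w) (hw' : PT w')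
    (hy : PT y) : PT fun c => (C c).searchNext (v c) (w c) (w' c) (y c) := by
  unfold Circuit.searchNext usedAnswer
  fun_prop

@[fun_prop]
theorem PT.searchValue {m : γ → ℕ} (hC : PT C) (hm : PT m) (hv : PT v) (hw : PT w) (hw' : PT w') :
    PT fun c => (C c).searchValue (m c) (v c) (w c) (w' c) := by
  unfold Circuit.searchValue
  fun_prop

end

/-- Decision whether a string encodes an instance with oracle gates. -/
def isOracleInstance (u : List Bool) : Bool :=
  decide ((parseCircuit u).encode = u) &&
    decide ((parseCircuit u).outputs.length = 2 * (parseCircuit u).inputs)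

@[fun_prop]
theorem PT.isOracleInstance {γ : Type} [Rep γ] {u : γ → List Bool} (hu : PT u) :
    PT fun c => isOracleInstance (u c) := by
  unfold TotalSearch.isOracleInstance
  fun_prop

theorem eval_sinkOfDAGBound : (fun k => sinkOfDAGBound.eval k) = fun k => k := by
  simp [sinkOfDAGBound]

/-- Sink-of-DAG with oracle gates for Sink-of-DAG reduces to Sink-of-DAG. -/
theorem relativize_sinkOfDAG_reducible :
    ManyOneReducible (relativize sinkOfDAGProblem SinkOfDAG sinkOfDAGBound) SinkOfDAG := by
  let C : List Bool × List (List Bool) → Circuit := fun c => parseCircuit c.1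
  let v : List Bool × List (List Bool) → List Bool := fun c => c.2.getD 0 []
  let w : List Bool × List (List Bool) → List Bool := fun c => c.2.getD 1 []
  let w' : List Bool × List (List Bool) → List Bool := fun c => c.2.getD 2 []
  have hC : PT C := by fun_prop
  have hv : PT v := by fun_prop
  have hw : PT w := by fun_prop
  have hw' : PT w' := by fun_prop
  let valid : List Bool × List (List Bool) → Bool := fun c =>
    if isOracleInstance c.1 = true then
      decide (c.2 = [v c, w c, w' c]) && (C c).isSearchState (v c) (w c) (w' c)
    else decide (c.2 = [])
  have hvalid : ∀ x a, valid (x, a) = true →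
      (isOracleInstance x = true ∧ ∃ v w w', a = [v, w, w'] ∧
        (parseCircuit x).isSearchState v w w' = true) ∨ (isOracleInstance x = false ∧ a = []) := by
    intro x a h
    cases hx : isOracleInstance x
    · right
      simp only [valid, hx, Bool.false_eq_true, if_false, decide_eq_true_iff] at h
      exact ⟨rfl, h⟩
    · left
      simp only [valid, hx, if_true, Bool.and_eq_true, decide_eq_true_iff] at h
      exact ⟨rfl, _, _, _, h⟩
  have hvalid' : ∀ x v w w', isOracleInstance x = true →
      (parseCircuit x).isSearchState v w w' = true → valid (x, [v, w, w']) = true := by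
    intro x v' w1 w2 hx h
    simp only [valid, hx, if_true, Bool.and_eq_true, decide_eq_true_iff]
    exact ⟨rfl, h⟩
  have hinst : ∀ x, isOracleInstance x = true → (parseCircuit x).encode = x ∧
      (parseCircuit x).outputs.length = 2 * (parseCircuit x).inputs := by
    intro x hx
    simpa [isOracleInstance] using hx
  refine reducible_of_querySearch (valid := valid)
    (final := fun c => !isOracleInstance c.1 || (C c).isFinal (v c) (w c) (w' c))
    (ask := fun c => (C c).searchAsk (v c) (w c) (w' c))
    (resume := fun d => (C d.1).searchNext (v d.1) (w d.1) (w' d.1) d.2)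
    (val := fun c => (C c).searchValue (2 * c.1.length) (v c) (w c) (w' c))
    (init := fun x => if isOracleInstance x = true then [zeros (parseCircuit x).inputs, [], []]
      else [])
    (out := fun a => a.getD 0 [] ++ a.getD 1 [] ++
      if (a.getD 2 []).length = (a.getD 1 []).length then a.getD 2 [] else a.getD 1 [])
    (by fun_prop) (by fun_prop) (by fun_prop) (by fun_prop) (by fun_prop) (by fun_prop)
    -- Three strings, each no longer than the description of the circuit.
    (by fun_prop) (4 + 3 * (4 * Polynomial.X + 1)) (fun x a ha => ?_) (fun x => ?_)
    (fun x a y ha hf hy => ?_) (fun x a ha hf => ?_)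
  · rcases hvalid x a ha with ⟨hx, v, w, w', rfl, h⟩ | ⟨hx, rfl⟩
    · obtain ⟨⟨h1, h2, h3⟩, -⟩ := (Circuit.isSearchState_iff _ _ _ _).1 h
      have h4 := answerBits_le (parseCircuit x)
      have h5 : (parseCircuit x).inputs ≤ (parseCircuit x).encode.length := by
        simp [Circuit.encode, natCode]
      rw [(hinst x hx).1] at h4 h5
      have h6 := (length_le_of_isRow h2).1
      have h7 := (length_le_of_isRow h3).1
      have h8 := sz_bits_le v
      have h9 := sz_bits_le w
      have h10 := sz_bits_le w'
      simp only [sz_cons, sz_nil, Polynomial.eval_add, Polynomial.eval_mul, Polynomial.eval_ofNat,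
        Polynomial.eval_X, Polynomial.eval_one]
      omega
    · simp [sz_nil]
      omega
  · cases hx : isOracleInstance x
    · simp [valid, hx]
    · rw [if_pos rfl]
      exact hvalid' x _ _ _ hx (Circuit.isSearchState_init _)
  · rcases hvalid x a ha with ⟨hx, z, z1, z2, rfl, h⟩ | ⟨hx, rfl⟩
    · obtain ⟨h1, h2⟩ := hinst x hx
      simp only [hx, Bool.not_true, Bool.false_or] at hf
      have h3 := answerBits_le (parseCircuit x)
      rw [h1] at h3
      obtain ⟨z', w1, w2, h4, h5, h6⟩ := Circuit.isSearchState_next (m := 2 * x.length) h2 h hf hy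
        (by omega)
      refine ⟨?_, ?_⟩
      · change valid (x, (parseCircuit x).searchNext z z1 z2 y) = true
        rw [h4]
        exact hvalid' x _ _ _ hx h5
      · change _ < bitsToNat ((parseCircuit x).searchValue (2 * x.length)
          (((parseCircuit x).searchNext z z1 z2 y).getD 0 [])
          (((parseCircuit x).searchNext z z1 z2 y).getD 1 [])
          (((parseCircuit x).searchNext z z1 z2 y).getD 2 []))
        rw [h4]
        exact h6
    · simp [hx] at hf
  · rcases hvalid x a ha with ⟨hx, z, z1, z2, rfl, h⟩ | ⟨hx, rfl⟩
    · obtain ⟨h1, h2⟩ := hinst x hx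
      simp only [hx, Bool.not_true, Bool.false_or] at hf
      refine Or.inl ⟨parseCircuit x, h2, h1.symm, ?_⟩
      rw [eval_sinkOfDAGBound]
      exact Circuit.isRelativizedSolution_of_isFinal h hf h2
    · refine Or.inr ⟨?_, rfl⟩
      rintro ⟨D, hD, rfl⟩
      have hD : D.outputs.length = 2 * D.inputs := hD
      simp [isOracleInstance, parseCircuit_encode, hD] at hx

/-- Solutions of an instance without oracle gates. -/
theorem isSinkOfDAGSolution_of_relativized {C : Circuit} (hC : C.Plain) (p : ℕ → ℕ)
    {z : List Bool} (h : IsRelativizedSolution sinkOfDAGProblem SinkOfDAG p C z) :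
    z.length = C.inputs ∧ IsSinkOfDAGSolution C.inputs (fun x => (C.eval x).take C.inputs)
      (fun x => (C.eval x).drop C.inputs) z := by
  have hL : C.answerBits p = 0 := by
    rw [Circuit.answerBits, List.sum_eq_zero_iff]
    intro k hk
    obtain ⟨g, hg, rfl⟩ := List.mem_map.1 hk
    have := hC g hg
    cases g <;> first | rfl | exact this.elim
  simp only [IsRelativizedSolution, hL, sinkOfDAGProblem, mul_zero, add_zero] at h
  obtain ⟨h1, -, -, h2⟩ := h
  refine ⟨h1, (sinkOfDAGVerifier_verdict _ _ _).1 ?_⟩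
  rw [List.take_of_length_le h1.le] at h2
  rw [← h2]
  simp only [sinkOfDAGVerifier, BlackBox.verdict, BlackBox.simulate, List.range_succ,
    List.range_zero, List.nil_append, List.cons_append, List.map_cons, List.map_nil, hC.run_eq]
  split_ifs <;> simp only [BlackBox.verdict, BlackBox.simulate, hC.run_eq]

/-- With an oracle `b` at hand, the relativized instance `f b x` is solved by reducing it to
Sink-of-DAG and asking `b` once more. So $R$ is solved outright by an oracle program, and
`reducible_of_fpOracle` removes the oracle. -/
theorem PLSrelPLS_subset_PLS : PLSrelPLS ⊆ PLS := by
  rintro R ⟨hR, f, g, hf, hg, h⟩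
  obtain ⟨f', g', hf', hg', h'⟩ := relativize_sinkOfDAG_reducible
  refine ⟨hR, reducible_of_fpOracle (h := fun b x => g b (g' (b (f' (f b x)))))
    (hg.comp ((hg'.fpOracle _).comp (fpOracle_apply.comp ((hf'.fpOracle _).comp hf))))
    fun b hb x => h b hb x _ (h' _ _ (hb _))⟩

theorem PLS_subset_PLSrelPLS : PLS ⊆ PLSrelPLS := by
  rintro R ⟨hR, f, g, hf, hg, h⟩
  -- A string may encode a circuit with oracle gates: no instance of Sink-of-DAG, but possibly one
  -- of the relativized problem. Strings that are no Sink-of-DAG instances are replaced by the empty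
  -- string, which encodes no circuit, so that in both problems the empty string is the only
  -- solution.
  let k : List Bool → List Bool := fun u => if isInstance u = true then u else []
  have hk : PT k := by fun_prop
  refine ⟨hR, fun _ x => k (f x), fun _ => g, (hk.fp.comp hf).fpOracle _, hg.fpOracle _,
    fun b _ x y hy => h x y ?_⟩
  by_cases hi : isInstance (f x) = true
  · simp only [k, if_pos hi] at hy
    obtain ⟨C, hC, hfx⟩ := (isInstance_iff _).1 hi
    rw [hfx] at hy ⊢
    rcases hy with ⟨D, -, h1, h2⟩ | ⟨h1, -⟩
    · cases Circuit.encode_injective h1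
      exact Or.inl ⟨C, hC, rfl, isSinkOfDAGSolution_of_relativized hC.1 _ h2⟩
    · exact absurd ⟨C, hC.2, rfl⟩ h1
  · simp only [k, if_neg hi] at hy
    refine Or.inr ⟨fun h1 => hi ((isInstance_iff _).2 h1), ?_⟩
    rcases hy with ⟨D, -, h1, -⟩ | ⟨-, rfl⟩
    · simp [Circuit.encode, natCode] at h1
    · rfl

end TotalSearch

theorem mainTheorem2 : TotalSearch.PLSrelPLS = TotalSearch.PLS :=
  Set.Subset.antisymm TotalSearch.PLSrelPLS_subset_PLS TotalSearch.PLS_subset_PLSrelPLS
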